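/- Fix integers $n\ge 1$ and $n_r\ge n$. Consider the quasi-static Rayleigh channel $Y=HX+W$ with $X\in\mathbb C^{n\times n}$ (that is, $n_t=T=n$), where $H\in\mathbb C^{n_r\times n}$ and $W\in\mathbb C^{n_r\times n}$ are independent with i.i.d. $\mathcal{CN}(0,1)$ entries. **Code.** A threaded code is given by invertible matrices $C_1,\dots,C_n\in\mathbb C^{n\times n}$. The $n^2$ information symbols are split into $n$ threads $s^{(1)},\dots,s^{(n)}$ of $n$ symbols, and $[X]_{j,k}=\theta\,[C_l s^{(l)}]_j$ for the thread $l$ with $k=((j-l)\bmod n)+1$. The symbols are independent and uniform over the Gaussian integers with real and imaginary parts in $[-\eta,\eta]$, and are independent of $(H,W)$. For the multiplexing gain $r\in[0,n]$, the parameters $\theta=\theta_r(\rho)>0$ and $\eta=\eta_r(\rho)>0$ are such that, for all sufficiently large SNR $\rho$, the average of $\|X\|_F^2$ over the codebook $\mathcal X$ equals $\rho n$, and $\frac1n\frac{\log|\mathcal X|}{\log\rho}\to r$ as $\rho\to\infty$. The code is DMT optimal at $r$ if the error probability of maximum likelihood (ML) decoding satisfies $-\log P(\hat X_{ML}\ne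 X)/\log\rho\to d(r)$, where $d$ is the piecewise linear curve through the points $(k,(n-k)(n_r-k))$, $k=0,\dots,n$; it is DMT optimal if this holds for all $r\in[0,n]$. **Decoder.** Order the symbols in a vector $s\in\mathbb C^{n^2}$ so that the symbols of each thread occupy one of the $n$ consecutive blocks of $n$ positions (thread-wise grouping; the order of the threads, and the order inside each thread, are arbitrary). Write the received block, column by column, as $y=Ms+w$, let $M=QR$ be a thin QR decomposition and put $v=Q^{\mathsf H}y$. With the squared radius $\xi^2=z\log\rho$, $z>d(r)$, the sphere decoder visits at layer $k$ the nodes $\hat s_k$ (vectors of $k$ constellation symbols) with $\|v_k-R_k\hat s_k\|^2\le\xi^2$, where $v_k$ holds the last $k$ entries of $v$ and $R_k$ is the lower right $k\times k$ block of $R$. Let $N$ be the total number of visited nodes at the layers $1,\dots,n^2$. Its complexity exponent is $c(r)=\inf\{x\in\mathbb R:\Psi(x)>d(r)\}$, where $\Psi(x)=-\lim_{\rho\to\infty}\log P(N\ge\rho^x)/\log\rho$ (where this limit does not exist, $\Psi(x)$ may be given any value between the lower and the upper limit). The decoder errs if the ML decision is wrong or the search sphere contains no symbol vector. **Theorem.**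 For every threaded code, every thread-wise grouping and every $r\in[0,n]$ at which the code is DMT optimal, $$c(r)=r(n-\lfloor r\rfloor-1)+\big(n\lfloor r\rfloor-r(n-1)\big)^+ ,$$ and sphere decoding achieves DMT optimality: the error probability of the sphere decoder has SNR exponent $d(r)$, also when, for a fixed $x>c(r)$, the event $N\ge\rho^x$ is counted as an additional error. For every integer $k\in\{0,\dots,n\}$ at which the code is DMT optimal, $c(k)=k(n-k)$. Consequently, if $n\ge2$ and the code is DMT optimal at all $r\in[0,n]$, then $c$ is neither non-decreasing nor non-increasing on $[0,n]$. -/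

import Mathlib

open Filter Topology MeasureTheory ProbabilityTheory
open scoped Matrix Kronecker ENNReal

namespace MIMO

noncomputable section

/-! ### Full rate linear dispersive codes -/

/-- The QAM-like alphabet of Gaussian integers `a + b i` with `a, b ∈ ℤ ∩ [-η, η]`. -/
def constellation (η : ℝ) : Finset ℂ :=
  (Finset.Icc (-⌊η⌋) ⌊η⌋ ×ˢ Finset.Icc (-⌊η⌋) ⌊η⌋).image
    (fun p : ℤ × ℤ => (p.1 : ℂ) + (p.2 : ℂ) * Complex.I)

theorem mem_constellation {η : ℝ} {s : ℂ} :
    s ∈ constellation η ↔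
      ∃ a b : ℤ, |(a : ℝ)| ≤ η ∧ |(b : ℝ)| ≤ η ∧ s = (a : ℂ) + (b : ℂ) * Complex.I := by
  have key : ∀ a : ℤ, (-⌊η⌋ ≤ a ∧ a ≤ ⌊η⌋) ↔ |(a : ℝ)| ≤ η := by
    intro a
    rw [abs_le, Int.le_floor, neg_le, Int.le_floor, Int.cast_neg, neg_le]
  simp only [constellation, Finset.mem_image, Finset.mem_product, Finset.mem_Icc, key,
    Prod.exists]
  constructor
  · rintro ⟨a, b, ⟨ha, hb⟩, rfl⟩
    exact ⟨a, b, ha, hb, rfl⟩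
  · rintro ⟨a, b, ha, hb, rfl⟩
    exact ⟨a, b, ⟨ha, hb⟩, rfl⟩

/-- Symbol vectors: all vectors of length `k` with entries in the constellation. -/
def symbolVectors (k : ℕ) (η : ℝ) : Finset (Fin k → ℂ) :=
  Fintype.piFinset fun _ => constellation η

/-- Squared Euclidean norm of a complex vector. -/
def normSq {ι : Type*} [Fintype ι] (v : ι → ℂ) : ℝ := ∑ i, ‖v i‖ ^ 2

variable {nr nt T κ : ℕ}

open Classical in
/-- The codebook, in vectorized form: all `vec X = θ G s`. The columns of the generator matrix `G`
are the vectorized dispersion matrices; a row index is a pair (column of `X`, row of `X`). -/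
def codebook (G : Matrix (Fin T × Fin nt) (Fin κ) ℂ) (θ η : ℝ) :
    Finset (Fin T × Fin nt → ℂ) :=
  (symbolVectors κ η).image fun s => (θ : ℂ) • (G *ᵥ s)

/-- The average power constraint `E ‖X‖² = ρ T` for `X` uniform on the codebook. -/
def MeetsPowerConstraint (G : Matrix (Fin T × Fin nt) (Fin κ) ℂ) (θ η ρ : ℝ) : Prop :=
  (1 / ((codebook G θ η).card : ℝ)) * ∑ x ∈ codebook G θ η, normSq x = ρ * T

/-- `η ρ` (constellation size) and `θ ρ` (power scaling) are admissible choices, for large SNR `ρ`,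
for operating the code generated by `G` at multiplexing gain `r`. -/
structure OperatesAt (G : Matrix (Fin T × Fin nt) (Fin κ) ℂ) (θ η : ℝ → ℝ) (r : ℝ) : Prop where
  pos : ∀ᶠ ρ in atTop, 0 < θ ρ ∧ 0 < η ρ
  power : ∀ᶠ ρ in atTop, MeetsPowerConstraint G (θ ρ) (η ρ) ρ
  gain : Tendsto (fun ρ => (1 / (T : ℝ)) *
    (Real.log ((codebook G (θ ρ) (η ρ)).card : ℝ) / Real.log ρ)) atTop (𝓝 r)

/-! ### Threaded codes -/

/-- Generator matrix of the `n × n` threaded code with component generators `C l`: symbol `m` of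
thread `l` is `s (l, m)`, the coded symbols of thread `l` are `C l *ᵥ s (l, ·)`, and coded symbol `j`
of thread `l` is placed in row `j` and column `j - l` (modulo `n`) of the codeword. -/
def threadedGenerator {n : ℕ} (C : Fin n → Matrix (Fin n) (Fin n) ℂ) :
    Matrix (Fin n × Fin n) (Fin n × Fin n) ℂ :=
  Matrix.of fun p q => if p.1 = p.2 - q.1 then C q.1 p.2 q.2 else 0

/-- An ordering of the `n²` symbols `(thread, index in the thread)` is a thread-wise grouping if each
of the `n` consecutive blocks of `n` positions contains symbols of one thread only. -/
def IsThreadwiseGrouping {n : ℕ} (e : Fin (n * n) ≃ Fin n × Fin n) : Prop :=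
  ∀ i j : Fin (n * n), (i : ℕ) / n = (j : ℕ) / n → (e i).1 = (e j).1

/-- Generator matrix of the threaded code with its columns in the order `e`. -/
def orderedThreadedGenerator {n : ℕ} (C : Fin n → Matrix (Fin n) (Fin n) ℂ)
    (e : Fin (n * n) ≃ Fin n × Fin n) : Matrix (Fin n × Fin n) (Fin (n * n)) ℂ :=
  (threadedGenerator C).submatrix id e

/-! ### The quasi-static Rayleigh fading channel -/

/-- The circularly symmetric complex Gaussian law with unit variance. -/
def complexGaussian : Measure ℂ :=
  ((gaussianReal 0 (1 / 2)).prod (gaussianReal 0 (1 / 2))).map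
    (fun p : ℝ × ℝ => (p.1 : ℂ) + (p.2 : ℂ) * Complex.I)

/-- The law of an `a × b` array with i.i.d. unit variance complex Gaussian entries. -/
def gaussianArray (a b : ℕ) : Measure (Fin a → Fin b → ℂ) :=
  Measure.pi fun _ => Measure.pi fun _ => complexGaussian

/-- A realization of channel `H`, noise `W` and transmitted symbol vector `s`. -/
abbrev Outcome (nr nt T κ : ℕ) : Type :=
  (Fin nr → Fin nt → ℂ) × (Fin nr → Fin T → ℂ) × (Fin κ → ℂ)

/-- The joint law: `H`, `W` and `s` independent, `H` and `W` Gaussian, `s` uniform. -/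
def outcomeLaw (nr nt T κ : ℕ) (η : ℝ) : Measure (Outcome nr nt T κ) :=
  (gaussianArray nr nt).prod
    ((gaussianArray nr T).prod (uniformOn (symbolVectors κ η : Set (Fin κ → ℂ))))

/-- The code-channel generator matrix `M = θ (I_T ⊗ H) G`. -/
def codeChannel (G : Matrix (Fin T × Fin nt) (Fin κ) ℂ) (θ : ℝ) (H : Fin nr → Fin nt → ℂ) :
    Matrix (Fin T × Fin nr) (Fin κ) ℂ :=
  (θ : ℂ) • (((1 : Matrix (Fin T) (Fin T) ℂ) ⊗ₖ Matrix.of H) * G)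

/-- The received vector `y = M s + vec W`. -/
def received (G : Matrix (Fin T × Fin nt) (Fin κ) ℂ) (θ : ℝ) (ω : Outcome nr nt T κ) :
    Fin T × Fin nr → ℂ :=
  codeChannel G θ ω.1 *ᵥ ω.2.2 + Matrix.vec (Matrix.of ω.2.1)

/-- The event that maximum likelihood decoding fails: some other symbol vector has a metric that is
not larger than that of the transmitted one (ties, which have probability zero for a full rank
generator, are counted as errors). -/
def mlError (nr : ℕ) (G : Matrix (Fin T × Fin nt) (Fin κ) ℂ) (θ η : ℝ) :
    Set (Outcome nr nt T κ) :=
  {ω | ∃ s' ∈ symbolVectors κ η, s' ≠ ω.2.2 ∧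
    normSq (received G θ ω - codeChannel G θ ω.1 *ᵥ s') ≤
      normSq (received G θ ω - codeChannel G θ ω.1 *ᵥ ω.2.2)}

/-! ### The sphere decoder -/

/-- `A = Q R` is a thin QR decomposition: `Qᴴ Q = I` and `R` is upper triangular. -/
structure IsThinQR {m : Type*} [Fintype m] (A Q : Matrix m (Fin κ) ℂ)
    (R : Matrix (Fin κ) (Fin κ) ℂ) : Prop where
  unitary : Qᴴ * Q = 1
  upper : ∀ i j, j < i → R i j = 0
  mul_eq : Q * R = A

/-- The indices of the last `k` of `κ` components. -/
def lastIdx {k : ℕ} (hk : k ≤ κ) (i : Fin k) : Fin κ := ⟨κ - k + i, by omega⟩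

open Classical in
/-- The nodes visited at layer `k`: the partial symbol vectors `s'` of length `k` which satisfy
`‖r_k - R_k s'‖² ≤ ξ²`, where `r_k` holds the last `k` components of `v = Qᴴ y` and `R_k` is the
lower right `k × k` corner of `R`. -/
def visitedNodes (R : Matrix (Fin κ) (Fin κ) ℂ) (v : Fin κ → ℂ) (η ξ : ℝ) (k : ℕ) (hk : k ≤ κ) :
    Finset (Fin k → ℂ) :=
  (symbolVectors k η).filter fun s' =>
    normSq (v ∘ lastIdx hk - R.submatrix (lastIdx hk) (lastIdx hk) *ᵥ s') ≤ ξ ^ 2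

/-- A procedure returning a pair `(Q, R)` for each code-channel matrix. -/
abbrev QRProcedure (nr T κ : ℕ) : Type :=
  Matrix (Fin T × Fin nr) (Fin κ) ℂ →
    Matrix (Fin T × Fin nr) (Fin κ) ℂ × Matrix (Fin κ) (Fin κ) ℂ

/-- The nodes visited at layer `k` for a given realization. -/
def nodesAt (qr : QRProcedure nr T κ) (G : Matrix (Fin T × Fin nt) (Fin κ) ℂ) (θ η ξ : ℝ)
    (ω : Outcome nr nt T κ) (k : ℕ) (hk : k ≤ κ) : Finset (Fin k → ℂ) :=
  visitedNodes (qr (codeChannel G θ ω.1)).2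
    ((qr (codeChannel G θ ω.1)).1ᴴ *ᵥ received G θ ω) η ξ k hk

/-- The complexity `N`: total number of nodes visited in the layers `1, …, κ`. -/
def complexity (qr : QRProcedure nr T κ) (G : Matrix (Fin T × Fin nt) (Fin κ) ℂ) (θ η ξ : ℝ)
    (ω : Outcome nr nt T κ) : ℕ :=
  ∑ k : Fin κ, (nodesAt qr G θ η ξ ω ((k : ℕ) + 1) k.isLt).card

/-- The sphere radius, `ξ² = z log ρ`. -/
def radius (z ρ : ℝ) : ℝ := √(z * Real.log ρ)

/-- The error event of the sphere decoder without run-time limit: the ML decision is wrong, or no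
symbol vector lies in the search sphere. -/
def sdError (qr : QRProcedure nr T κ) (G : Matrix (Fin T × Fin nt) (Fin κ) ℂ) (θ η ξ : ℝ) :
    Set (Outcome nr nt T κ) :=
  mlError nr G θ η ∪ {ω | nodesAt qr G θ η ξ ω κ le_rfl = ∅}

/-- The event that the number of visited nodes is at least `b`. -/
def complexityTail (qr : QRProcedure nr T κ) (G : Matrix (Fin T × Fin nt) (Fin κ) ℂ) (θ η ξ : ℝ)
    (b : ℝ) : Set (Outcome nr nt T κ) :=
  {ω | b ≤ (complexity qr G θ η ξ ω : ℝ)}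

/-! ### SNR exponents -/

/-- `- log (p ρ) / log ρ`, in the extended reals, with `- log 0 = ⊤`. -/
def snrExponent (p : ℝ → ℝ≥0∞) (ρ : ℝ) : EReal :=
  -ENNReal.log (p ρ) / ((Real.log ρ : ℝ) : EReal)

/-- The code has diversity gain `d` under ML decoding. -/
def HasDiversityGain (nr : ℕ) (G : Matrix (Fin T × Fin nt) (Fin κ) ℂ) (θ η : ℝ → ℝ) (d : ℝ) :
    Prop :=
  Tendsto (snrExponent fun ρ => outcomeLaw nr nt T κ (η ρ) (mlError nr G (θ ρ) (η ρ)))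
    atTop (𝓝 (d : EReal))

/-- The optimal diversity-multiplexing tradeoff of the Rayleigh channel: the piecewise linear
curve through the points `(k, (nt - k) (nr - k))`, `k = 0, …, min nt nr`. -/
def dmt (nt nr : ℕ) (r : ℝ) : ℝ :=
  ((nt : ℝ) - ⌊r⌋) * ((nr : ℝ) - ⌊r⌋) - (r - ⌊r⌋) * ((nt : ℝ) + nr - 2 * ⌊r⌋ - 1)

/-- The code generated by `G`, operated at multiplexing gain `r`, is DMT optimal there. -/
structure IsDMTOptimalAt (nr : ℕ) (G : Matrix (Fin T × Fin nt) (Fin κ) ℂ) (θ η : ℝ → ℝ)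
    (r : ℝ) : Prop where
  operates : OperatesAt G θ η r
  diversity : HasDiversityGain nr G θ η (dmt nt nr r)

/-- `ρ ↦ P (N ≥ ρ ^ x)` for the sphere decoder with squared radius `z log ρ`. -/
def tailProb (qr : QRProcedure nr T κ) (G : Matrix (Fin T × Fin nt) (Fin κ) ℂ) (θ η : ℝ → ℝ)
    (z x ρ : ℝ) : ℝ≥0∞ :=
  outcomeLaw nr nt T κ (η ρ) (complexityTail qr G (θ ρ) (η ρ) (radius z ρ) (ρ ^ x))

/-- `Ψ` is a complexity rate function: `Ψ x = - lim log P (N ≥ ρ ^ x) / log ρ` wherever this limit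
exists, and elsewhere `Ψ x` is any value between the lower and the upper limit. -/
def IsRateFunction (qr : QRProcedure nr T κ) (G : Matrix (Fin T × Fin nt) (Fin κ) ℂ)
    (θ η : ℝ → ℝ) (z : ℝ) (Ψ : ℝ → EReal) : Prop :=
  ∀ x : ℝ, liminf (snrExponent (tailProb qr G θ η z x)) atTop ≤ Ψ x ∧
    Ψ x ≤ limsup (snrExponent (tailProb qr G θ η z x)) atTop

/-- The SD complexity exponent `inf {x | Ψ x > d}`. -/
def complexityExponent (Ψ : ℝ → EReal) (d : ℝ) : EReal :=
  sInf ((fun x : ℝ => (x : EReal)) '' {x : ℝ | (d : EReal) < Ψ x})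

/-- The sphere decoder without run-time limit, and its version that declares an outage when it
visits at least `ρ ^ x` nodes, for each `x > c`, have error probabilities with SNR exponent `d`. -/
def SDAchieves (qr : QRProcedure nr T κ) (G : Matrix (Fin T × Fin nt) (Fin κ) ℂ)
    (θ η : ℝ → ℝ) (z : ℝ) (c : EReal) (d : ℝ) : Prop :=
  Tendsto (snrExponent fun ρ => outcomeLaw nr nt T κ (η ρ)
      (sdError qr G (θ ρ) (η ρ) (radius z ρ))) atTop (𝓝 (d : EReal)) ∧
  ∀ x : ℝ, c < (x : EReal) →
    Tendsto (snrExponent fun ρ => outcomeLaw nr nt T κ (η ρ)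
      (sdError qr G (θ ρ) (η ρ) (radius z ρ) ∪
        complexityTail qr G (θ ρ) (η ρ) (radius z ρ) (ρ ^ x))) atTop (𝓝 (d : EReal))

end

end MIMO

/-!
# The complexity exponent of sphere decoding for threaded codes

*The channel.* Complete pivoting turns the channel matrix into pivots `p 0, …, p (n - 1)` and the
Schur complements in between. Each elimination step adds to some entries a function of the others,
so it preserves volume, and since the pivot bounds the other entries of its step, the probability
of the moduli `‖p k‖² ≈ ρ ^ (-t k)` is about `ρ ^ (-∑ w k * t k)` with the weights
`w k = (nr - k) + (n - k) - 1` (`gaussianFlat_pivot_le`,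
`eventually_gaussianFlat_compl_regularChannels_le`). Channels with `∑ w k * t k > d(r)` are less
likely than an ML error and can be ignored.

*Upper bound.* By orthogonality of the QR decomposition, the difference of two nodes of a layer has
a completion whose image under the channel is of the size of the search sphere. With the unit
triangular factor of the channel, each column of its codeword satisfies `n` conditions
`‖rowForm k‖ ≲ ρ ^ (t k / 2 - (1 - r / n) / 2)`, up to factors `ρ ^ ε`. Since the symbols are
Gaussian integers and the code map is bi-Lipschitz, counting cells (`card_le_prod_cells`) gives at
most `ρ ^ ∑ max 0 (n * t k - (n - r))` nodes, and this exponent is at most `c(r)` under the budget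
`∑ w k * t k ≤ d(r)`, by a linear programming bound (`sum_max_le_of_weight_le`).

*Lower bound.* The order of the layers matters here. Channels which are nearly singular on a space
of a suitable dimension `q = n - h` are about as likely as an ML error, also when this space is in
general position with respect to all coordinate subspaces (`exists_gaussianFlat_hasWeakDirections_ge`,
with a Vandermonde array in the first rows). The last `q` threads meet each column of the codeword
in exactly `q` coordinates. So any difference of symbols in these threads can be completed, by
*complex* numbers in the other threads, to a codeword all of whose columns lie in the nearly singular
space (`exists_completion`); its image under the channel is small, up to one form per column. By the
pigeonhole principle for these forms, at least half of the symbol vectors have the required number of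
neighbours at layer `q * n` (`exists_good_symbolVectors`). With `k ≤ r ≤ k + 1` and `f = r - k`, the
singular space has dimension `n - k - 1` if `r ≤ n * f`, and otherwise dimension `n - k` with
one direction that is only weakened by `ρ ^ (-(1 - f) / 2)`; this gives the two cases of the maximum.

*The sphere decoder.* The energy of the noise has exponential tails, so an empty sphere of squared
radius `z log ρ`, `z > d(r)`, is less likely than an ML error, and so is `N ≥ ρ ^ x` for
`x > c(r)` (`exists_eventually_tailProb_le`). The values `c(0) = 0`, `c(1) = n - 1` and `c(n) = 0`
exclude monotonicity.
-/

namespace MIMO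

/-! ### Gaussian arrays compared with Lebesgue measure -/

theorem outerMeasure_pi_mono {ι : Type*} [Fintype ι] {α : ι → Type*}
    {m m' : ∀ i, OuterMeasure (α i)} (h : ∀ i, m i ≤ m' i) :
    OuterMeasure.pi m ≤ OuterMeasure.pi m' := by
  rw [OuterMeasure.le_pi]
  intro s _
  refine (OuterMeasure.pi_pi_le m s).trans ?_
  exact Finset.prod_le_prod' fun i _ => h i (s i)

theorem measurePi_mono {ι : Type*} [Fintype ι] {α : ι → Type*} [∀ i, MeasurableSpace (α i)]
    {μ ν : ∀ i, Measure (α i)} (h : ∀ i, μ i ≤ ν i) : Measure.pi μ ≤ Measure.pi ν := by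
  rw [Measure.le_iff]
  intro s hs
  rw [Measure.pi, Measure.pi, toMeasure_apply _ _ hs, toMeasure_apply _ _ hs]
  exact outerMeasure_pi_mono (fun i => Measure.toOuterMeasure_le.2 (h i)) s

theorem measurePi_const_smul {ι : Type*} [Fintype ι] {α : Type*} [MeasurableSpace α]
    (μ : Measure α) [SigmaFinite μ] (c : ℝ≥0∞) (hc : c ≠ ⊤) :
    Measure.pi (fun _ : ι => c • μ) = c ^ Fintype.card ι • Measure.pi fun _ : ι => μ := by
  lift c to NNReal using hc
  have : SigmaFinite ((c : ℝ≥0∞) • μ) := inferInstanceAs (SigmaFinite (c • μ))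
  refine Measure.pi_eq fun s _ => ?_
  simp [Measure.pi_pi, Finset.prod_mul_distrib]

theorem gaussianPDFReal_half (x : ℝ) :
    gaussianPDFReal 0 (1 / 2) x = (√Real.pi)⁻¹ * Real.exp (-x ^ 2) := by
  have h : (2 : ℝ) * Real.pi * ((1 / 2 : NNReal) : ℝ) = Real.pi := by push_cast; ring
  have h' : (2 : ℝ) * ((1 / 2 : NNReal) : ℝ) = 1 := by push_cast; ring
  rw [gaussianPDFReal, h, h']
  simp

theorem gaussianReal_half_le_volume : gaussianReal 0 (1 / 2) ≤ volume := by
  rw [gaussianReal_of_var_ne_zero _ (by norm_num)]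
  calc volume.withDensity (gaussianPDF 0 (1 / 2)) ≤ volume.withDensity (fun _ => 1) := by
        refine withDensity_mono (Eventually.of_forall fun x => ?_)
        rw [gaussianPDF, gaussianPDFReal_half]
        rw [ENNReal.ofReal_le_one]
        have h1 : (√Real.pi)⁻¹ ≤ 1 := by
          apply inv_le_one_of_one_le₀
          rw [Real.one_le_sqrt]
          linarith [Real.pi_gt_three]
        have h2 : Real.exp (-x ^ 2) ≤ 1 := by
          rw [Real.exp_le_one_iff]; nlinarith [sq_nonneg x]
        have h3 := Real.exp_pos (-x ^ 2)
        nlinarith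
    _ = volume := by simp

theorem complexGaussian_eq : complexGaussian =
    ((gaussianReal 0 (1 / 2)).prod (gaussianReal 0 (1 / 2))).map
      Complex.measurableEquivRealProd.symm := by
  rw [complexGaussian]
  congr 1
  ext p
  simp [Complex.mk_eq_add_mul_I]

instance : IsProbabilityMeasure complexGaussian := by
  rw [complexGaussian_eq]
  exact Measure.isProbabilityMeasure_map (by fun_prop)

instance (a b : ℕ) : IsProbabilityMeasure (gaussianArray a b) := by
  unfold gaussianArray; infer_instance

theorem complexGaussian_le_volume : complexGaussian ≤ volume := by
  rw [complexGaussian_eq, ← Complex.volume_preserving_equiv_real_prod.symm.map_eq]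
  exact Measure.map_mono (Measure.prod_mono gaussianReal_half_le_volume gaussianReal_half_le_volume)
    (by fun_prop)

theorem smul_volume_restrict_le_gaussianReal_half (K : ℝ) :
    ENNReal.ofReal ((√Real.pi)⁻¹ * Real.exp (-K ^ 2)) • volume.restrict (Set.Icc (-K) K) ≤
      gaussianReal 0 (1 / 2) := by
  rw [gaussianReal_of_var_ne_zero _ (by norm_num), ← withDensity_const, 
    ← withDensity_indicator measurableSet_Icc]
  refine withDensity_mono (Eventually.of_forall fun x => ?_)
  by_cases hx : x ∈ Set.Icc (-K) K
  · rw [Set.indicator_of_mem hx, gaussianPDF, gaussianPDFReal_half]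
    refine ENNReal.ofReal_le_ofReal ?_
    have := sq_le_sq' hx.1 hx.2
    gcongr
  · rw [Set.indicator_of_notMem hx]; exact zero_le

theorem exists_smul_volume_restrict_le_complexGaussian (K : ℝ) :
    ∃ c : ℝ≥0∞, c ≠ 0 ∧ c ≠ ⊤ ∧
      c • volume.restrict (Metric.closedBall (0 : ℂ) K) ≤ complexGaussian := by
  set d : ℝ≥0∞ := ENNReal.ofReal ((√Real.pi)⁻¹ * Real.exp (-K ^ 2)) with hd
  have hd0 : d ≠ 0 := by
    rw [hd, Ne, ENNReal.ofReal_eq_zero, not_le]; positivity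
  have hdt : d ≠ ⊤ := ENNReal.ofReal_ne_top
  refine ⟨d * d, mul_ne_zero hd0 hd0, ENNReal.mul_ne_top hdt hdt, ?_⟩
  have h := Measure.prod_mono (smul_volume_restrict_le_gaussianReal_half K)
    (smul_volume_restrict_le_gaussianReal_half K)
  rw [← hd] at h
  have h1 := Measure.map_mono h (f := Complex.measurableEquivRealProd.symm) (by fun_prop)
  rw [← complexGaussian_eq] at h1
  refine le_trans ?_ h1
  rw [Measure.prod_smul_left, Measure.prod_smul_right, smul_smul, Measure.prod_restrict,
    Measure.map_smul]
  have h2 : Measure.map Complex.measurableEquivRealProd.symm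
      ((volume.prod volume).restrict (Set.Icc (-K) K ×ˢ Set.Icc (-K) K)) =
      volume.restrict (Complex.measurableEquivRealProd ⁻¹' (Set.Icc (-K) K ×ˢ Set.Icc (-K) K)) := by
    rw [← Complex.volume_preserving_equiv_real_prod.symm.map_eq,
      MeasurableEquiv.restrict_map]
    congr 2
  rw [h2]
  refine Measure.le_iff'.2 fun s => ?_
  rw [Measure.smul_apply, Measure.smul_apply]
  gcongr
  intro w hw
  rw [mem_closedBall_zero_iff] at hw
  simp only [Set.mem_preimage, Complex.measurableEquivRealProd_apply, Set.mem_prod, Set.mem_Icc,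
    ← abs_le]
  exact ⟨(Complex.abs_re_le_norm w).trans hw, (Complex.abs_im_le_norm w).trans hw⟩

/-- The law of a Gaussian array with its entries indexed by pairs. -/
noncomputable def gaussianFlat (a b : ℕ) : Measure (Fin a × Fin b → ℂ) :=
  Measure.pi fun _ => complexGaussian

instance (a b : ℕ) : IsProbabilityMeasure (gaussianFlat a b) := by
  unfold gaussianFlat; infer_instance

theorem measurePreserving_uncurry (a b : ℕ) :
    MeasurePreserving (fun H : Fin a → Fin b → ℂ => fun p : Fin a × Fin b => H p.1 p.2)
      (gaussianArray a b) (gaussianFlat a b) := by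
  refine ⟨by fun_prop, ?_⟩
  refine (Measure.pi_eq fun s hs => ?_).symm
  rw [Measure.map_apply (by fun_prop) (MeasurableSet.univ_pi hs)]
  have : (fun H : Fin a → Fin b → ℂ => fun p : Fin a × Fin b => H p.1 p.2) ⁻¹' (Set.univ.pi s) =
      Set.univ.pi fun i => Set.univ.pi fun j => s (i, j) := by
    ext H; simp [Set.mem_pi]
  rw [this, gaussianArray, Measure.pi_pi, Fintype.prod_prod_type]
  simp [Measure.pi_pi]

theorem gaussianFlat_le_volume (a b : ℕ) : gaussianFlat a b ≤ volume :=
  measurePi_mono fun _ => complexGaussian_le_volume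

/-- On bounded sets of arrays the Gaussian law dominates a multiple of Lebesgue measure. -/
theorem exists_mul_volume_le_gaussianFlat (a b : ℕ) (K : ℝ) :
    ∃ c : ℝ≥0∞, c ≠ 0 ∧ c ≠ ⊤ ∧ ∀ S : Set (Fin a × Fin b → ℂ), (∀ H ∈ S, ∀ p, ‖H p‖ ≤ K) →
      c * volume S ≤ gaussianFlat a b S := by
  obtain ⟨c, h0, ht, hc⟩ := exists_smul_volume_restrict_le_complexGaussian K
  refine ⟨c ^ Fintype.card (Fin a × Fin b), pow_ne_zero _ h0, ENNReal.pow_ne_top ht,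
    fun S hS => ?_⟩
  have h1 := measurePi_mono (ι := Fin a × Fin b) fun _ => hc
  rw [measurePi_const_smul _ _ ht, ← Measure.restrict_pi_pi] at h1
  refine le_trans (le_of_eq ?_) (h1 S)
  rw [Measure.smul_apply, smul_eq_mul, Measure.restrict_eq_self]
  · rfl
  · intro H hH i _
    simpa using hS H hH i

/-- Adding to the coordinates in `A` a function of the other coordinates preserves volume. -/
theorem measurePreserving_shear {ι : Type*} [Fintype ι] (A : ι → Prop) [DecidablePred A]
    (f : (ι → ℂ) → ι → ℂ) (hf : Measurable f)
    (hdep : ∀ x y : ι → ℂ, (∀ i, ¬ A i → x i = y i) → ∀ i, A i → f x i = f y i) :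
    MeasurePreserving (fun x : ι → ℂ => fun i => if A i then x i + f x i else x i)
      volume volume := by
  set E := MeasurableEquiv.piEquivPiSubtypeProd (fun _ : ι => ℂ) (fun i => ¬ A i) with hE
  have hEp := volume_preserving_piEquivPiSubtypeProd (fun _ : ι => ℂ) (fun i => ¬ A i)
  set g : ({i // ¬ A i} → ℂ) → ({i // ¬ ¬ A i} → ℂ) → ({i // ¬ ¬ A i} → ℂ) :=
    fun u v i => v i + f (E.symm (u, 0)) i with hg
  have hgm : Measurable (Function.uncurry g) := by
    rw [hg]
    refine measurable_pi_lambda _ fun i => ?_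
    refine Measurable.add (by fun_prop) ?_
    exact (measurable_pi_apply (i : ι)).comp (hf.comp (E.symm.measurable.comp
      (measurable_fst.prodMk measurable_const)))
  have hsk := (MeasurePreserving.id (volume : Measure ({i // ¬ A i} → ℂ))).skew_product
    (μc := (volume : Measure ({i // ¬ ¬ A i} → ℂ))) (μd := (volume : Measure ({i // ¬ ¬ A i} → ℂ)))
    hgm (Eventually.of_forall fun u => by
      have : g u = fun v => v + fun i : {i // ¬ ¬ A i} => f (E.symm (u, 0)) i := rfl
      rw [this]
      exact (measurePreserving_add_right _ _).map_eq)
  have h := (hEp.symm.comp hsk).comp hEp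
  refine Eq.mp (congrArg (fun F => MeasurePreserving F volume volume) ?_) h
  symm
  funext x
  funext i
  by_cases hi : A i
  · simp only [hi, if_true, Function.comp_apply, hg, id]
    have : f x i = f (E.symm ((fun i : {i // ¬ A i} => x i), 0)) i := by
      refine hdep _ _ (fun j hj => ?_) i hi
      simp [hE, MeasurableEquiv.piEquivPiSubtypeProd, Equiv.piEquivPiSubtypeProd, hj]
    rw [this]
    simp [hE, MeasurableEquiv.piEquivPiSubtypeProd, Equiv.piEquivPiSubtypeProd, hi]
  · simp [MeasurableEquiv.piEquivPiSubtypeProd, Equiv.piEquivPiSubtypeProd, hi]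

/-! ### Gaussian tails -/

theorem integrable_exp_sq_gaussianReal_half {l : ℝ} (hl : l < 1) :
    Integrable (fun x => Real.exp (l * x ^ 2)) (gaussianReal 0 (1 / 2)) := by
  rw [gaussianReal_of_var_ne_zero _ (by norm_num),
    integrable_withDensity_iff (by fun_prop) (Eventually.of_forall fun x => gaussianPDF_lt_top)]
  have h := (integrable_exp_neg_mul_sq (b := 1 - l) (by linarith)).const_mul (√Real.pi)⁻¹
  refine h.congr (Eventually.of_forall fun x => ?_)
  simp only [gaussianPDF]
  rw [ENNReal.toReal_ofReal (gaussianPDFReal_nonneg _ _ _), gaussianPDFReal_half, mul_left_comm,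
    ← Real.exp_add]
  ring_nf

theorem integrable_exp_normSq_complexGaussian {l : ℝ} (hl : l < 1) :
    Integrable (fun w : ℂ => Real.exp (l * ‖w‖ ^ 2)) complexGaussian := by
  rw [complexGaussian_eq, integrable_map_equiv]
  refine ((integrable_exp_sq_gaussianReal_half hl).mul_prod
    (integrable_exp_sq_gaussianReal_half hl)).congr (Eventually.of_forall fun p => ?_)
  simp only [Function.comp_apply]
  rw [← Real.exp_add, Complex.sq_norm, Complex.normSq_apply]
  simp
  ring

/-- Chernoff bound for the energy of a Gaussian array. -/
theorem exists_gaussianFlat_tail (a b : ℕ) {l : ℝ} (hl0 : 0 ≤ l) (hl : l < 1) :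
    ∃ C : ℝ, 0 < C ∧ ∀ t : ℝ, gaussianFlat a b {w | t ≤ normSq w} ≤
      ENNReal.ofReal (C * Real.exp (-(l * t))) := by
  have hint : Integrable (fun w : Fin a × Fin b → ℂ => Real.exp (l * normSq w))
      (gaussianFlat a b) := by
    refine (Integrable.fintype_prod (f := fun _ : Fin a × Fin b => fun w : ℂ =>
      Real.exp (l * ‖w‖ ^ 2)) fun _ => integrable_exp_normSq_complexGaussian hl).congr
        (Eventually.of_forall fun w => ?_)
    simp only [normSq, Finset.mul_sum, Real.exp_sum]
  set I := ∫ w, Real.exp (l * normSq w) ∂(gaussianFlat a b) with hI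
  have hI0 : 0 ≤ I := integral_nonneg fun w => (Real.exp_pos _).le
  refine ⟨I + 1, by linarith, fun t => ?_⟩
  have hm := mul_meas_ge_le_integral_of_nonneg (μ := gaussianFlat a b)
    (f := fun w => Real.exp (l * normSq w)) (Eventually.of_forall fun w => (Real.exp_pos _).le)
    hint (Real.exp (l * t))
  have hsub : {w : Fin a × Fin b → ℂ | t ≤ normSq w} ⊆
      {w | Real.exp (l * t) ≤ Real.exp (l * normSq w)} := by
    intro w hw
    simp only [Set.mem_ofPred_eq, Real.exp_le_exp] at hw ⊢
    exact mul_le_mul_of_nonneg_left hw hl0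
  refine (measure_mono hsub).trans ?_
  rw [← ENNReal.ofReal_toReal (measure_ne_top (gaussianFlat a b) _)]
  refine ENNReal.ofReal_le_ofReal ?_
  rw [Real.exp_neg, ← div_eq_mul_inv, le_div_iff₀ (Real.exp_pos _), mul_comm]
  exact hm.trans (by linarith)

/-! ### Elimination -/

section Elimination

variable {a b : ℕ}

/-- The entries that are in neither of the first `k` pivot rows and pivot columns. -/
def Active (pr : ℕ → Fin a) (pc : ℕ → Fin b) (k : ℕ) (p : Fin a × Fin b) : Prop :=
  ∀ m < k, pr m ≠ p.1 ∧ pc m ≠ p.2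

instance (pr : ℕ → Fin a) (pc : ℕ → Fin b) (k : ℕ) : DecidablePred (Active pr pc k) :=
  fun p => inferInstanceAs (Decidable (∀ m < k, pr m ≠ p.1 ∧ pc m ≠ p.2))

/-- In-place Gaussian elimination with pivots at `(pr k, pc k)`: at each step the entries outside
of the pivot rows and columns used so far are replaced by the Schur complement. -/
noncomputable def elim (pr : ℕ → Fin a) (pc : ℕ → Fin b) :
    ℕ → (Fin a × Fin b → ℂ) → Fin a × Fin b → ℂ
  | 0, H => H
  | k + 1, H => fun p =>
      if Active pr pc (k + 1) p then
        elim pr pc k H p + -(elim pr pc k H (p.1, pc k) * elim pr pc k H (pr k, p.2) /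
          elim pr pc k H (pr k, pc k))
      else elim pr pc k H p

/-- Each elimination step adds to the remaining entries a function of the entries of the previous
pivot rows and columns, which it leaves unchanged. -/
theorem measurePreserving_elim (pr : ℕ → Fin a) (pc : ℕ → Fin b) (k : ℕ) :
    MeasurePreserving (elim pr pc k) volume volume := by
  induction k with
  | zero => exact MeasurePreserving.id _
  | succ k ih =>
    refine (measurePreserving_shear (Active pr pc (k + 1))
      (fun x p => -(x (p.1, pc k) * x (pr k, p.2) / x (pr k, pc k))) (by fun_prop)
      fun x y h p hp => ?_).comp ih
    have h1 : ∀ i, x (i, pc k) = y (i, pc k) := fun i =>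
      h _ fun H => (H k (Nat.lt_succ_self k)).2 rfl
    have h2 : ∀ j, x (pr k, j) = y (pr k, j) := fun j =>
      h _ fun H => (H k (Nat.lt_succ_self k)).1 rfl
    simp only [h1, h2]

theorem Active.mono {pr : ℕ → Fin a} {pc : ℕ → Fin b} {k l : ℕ} (h : k ≤ l) {p : Fin a × Fin b}
    (hp : Active pr pc l p) : Active pr pc k p :=
  fun m hm => hp m (hm.trans_le h)

/-- An entry keeps its value once its row or column contains a pivot. -/
theorem elim_eq_of_not_active {pr : ℕ → Fin a} {pc : ℕ → Fin b} {k l : ℕ} (h : k ≤ l)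
    {p : Fin a × Fin b} (hp : ¬ Active pr pc (k + 1) p) (H : Fin a × Fin b → ℂ) :
    elim pr pc l H p = elim pr pc k H p := by
  induction l, h using Nat.le_induction with
  | base => rfl
  | succ l hl ih =>
    rw [← ih]
    simp only [elim]
    rw [if_neg fun h' => hp (h'.mono (by omega))]

theorem elim_congr {pr pr' : ℕ → Fin a} {pc pc' : ℕ → Fin b} {k : ℕ}
    (hr : ∀ m < k, pr m = pr' m) (hc : ∀ m < k, pc m = pc' m) (H : Fin a × Fin b → ℂ) :
    elim pr pc k H = elim pr' pc' k H := by
  induction k with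
  | zero => rfl
  | succ k ih =>
    have hA : ∀ p, Active pr pc (k + 1) p ↔ Active pr' pc' (k + 1) p := fun p =>
      forall₂_congr fun m hm => by rw [hr m hm, hc m hm]
    ext p
    simp only [elim]
    rw [ih (fun m hm => hr m (by omega)) (fun m hm => hc m (by omega)), hr k (by omega),
      hc k (by omega)]
    simp only [hA]

theorem active_congr {pr pr' : ℕ → Fin a} {pc pc' : ℕ → Fin b} {k : ℕ}
    (hr : ∀ m < k, pr m = pr' m) (hc : ∀ m < k, pc m = pc' m) (p : Fin a × Fin b) :
    Active pr pc k p ↔ Active pr' pc' k p :=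
  forall₂_congr fun m hm => by rw [hr m hm, hc m hm]

/-- The first `n` pivots are complete pivots for `H`: each is an entry of largest modulus among
the active entries at its step. -/
def IsPivoting (pr : ℕ → Fin a) (pc : ℕ → Fin b) (n : ℕ) (H : Fin a × Fin b → ℂ) : Prop :=
  ∀ k < n, Active pr pc k (pr k, pc k) ∧
    ∀ p, Active pr pc k p → ‖elim pr pc k H p‖ ≤ ‖elim pr pc k H (pr k, pc k)‖

theorem exists_active {pr : ℕ → Fin a} {pc : ℕ → Fin b} {k : ℕ} (ha : k < a) (hb : k < b) :
    ∃ p, Active pr pc k p := by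
  have h1 : ∃ i, i ∉ (Finset.range k).image pr := by
    by_contra! h
    have : (Finset.univ : Finset (Fin a)).card ≤ ((Finset.range k).image pr).card :=
      Finset.card_le_card fun i _ => h i
    have h2 := Finset.card_image_le (s := Finset.range k) (f := pr)
    simp at this h2
    omega
  have h2 : ∃ i, i ∉ (Finset.range k).image pc := by
    by_contra! h
    have : (Finset.univ : Finset (Fin b)).card ≤ ((Finset.range k).image pc).card :=
      Finset.card_le_card fun i _ => h i
    have h2 := Finset.card_image_le (s := Finset.range k) (f := pc)
    simp at this h2
    omega
  obtain ⟨i, hi⟩ := h1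
  obtain ⟨j, hj⟩ := h2
  refine ⟨(i, j), fun m hm => ⟨fun h => hi ?_, fun h => hj ?_⟩⟩
  · exact Finset.mem_image.2 ⟨m, Finset.mem_range.2 hm, h⟩
  · exact Finset.mem_image.2 ⟨m, Finset.mem_range.2 hm, h⟩

theorem exists_isPivoting (i₀ : Fin a) (j₀ : Fin b) (H : Fin a × Fin b → ℂ) (n : ℕ) (ha : n ≤ a)
    (hb : n ≤ b) : ∃ pr pc, IsPivoting pr pc n H ∧ (∀ m, n ≤ m → pr m = i₀ ∧ pc m = j₀) := by
  induction n with
  | zero => exact ⟨fun _ => i₀, fun _ => j₀, fun k hk => absurd hk (by omega), fun m _ => ⟨rfl, rfl⟩⟩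
  | succ n ih =>
    obtain ⟨pr, pc, h, h0⟩ := ih (by omega) (by omega)
    obtain ⟨p, hp⟩ := exists_active (pr := pr) (pc := pc) (k := n) (by omega) (by omega)
    obtain ⟨q, hq, hmax⟩ := Finset.exists_max_image
      (Finset.univ.filter fun p => Active pr pc n p) (fun p => ‖elim pr pc n H p‖)
      ⟨p, by simpa using hp⟩
    simp only [Finset.mem_filter, Finset.mem_univ, true_and] at hq hmax
    have er : ∀ m < n, Function.update pr n q.1 m = pr m := fun m hm =>
      Function.update_of_ne (by omega) _ _
    have ec : ∀ m < n, Function.update pc n q.2 m = pc m := fun m hm =>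
      Function.update_of_ne (by omega) _ _
    refine ⟨Function.update pr n q.1, Function.update pc n q.2, fun k hk => ?_, fun m hm => ?_⟩
    · have er' : ∀ m < k, Function.update pr n q.1 m = pr m := fun m hm => er m (by omega)
      have ec' : ∀ m < k, Function.update pc n q.2 m = pc m := fun m hm => ec m (by omega)
      simp only [active_congr er' ec', elim_congr er' ec']
      rcases Nat.lt_succ_iff_lt_or_eq.1 hk with hk | rfl
      · rw [er k hk, ec k hk]; exact h k hk
      · simp only [Function.update_self]
        exact ⟨hq, hmax⟩
    · rw [Function.update_of_ne (by omega), Function.update_of_ne (by omega)]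
      exact h0 m (by omega)

end Elimination

section Pivoting

variable {a b : ℕ} {pr : ℕ → Fin a} {pc : ℕ → Fin b} {n : ℕ} {H : Fin a × Fin b → ℂ}

/-- With complete pivoting all quotients of an elimination step have modulus at most `1`, so the
entries at most double in each step. -/
theorem norm_elim_le (h : IsPivoting pr pc n H) {M : ℝ} (hM : ∀ p, ‖H p‖ ≤ M) {k : ℕ} (hk : k ≤ n)
    (p : Fin a × Fin b) : ‖elim pr pc k H p‖ ≤ 2 ^ k * M := by
  induction k generalizing p with
  | zero => simpa [elim] using hM p
  | succ k ih =>
    have hM0 : 0 ≤ M := (norm_nonneg _).trans (hM p)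
    have ih := ih (by omega)
    have h2 : (2 : ℝ) ^ (k + 1) * M = 2 ^ k * M + 2 ^ k * M := by ring
    simp only [elim]
    split_ifs with hp
    · refine (norm_add_le _ _).trans ?_
      rw [h2, norm_neg, norm_div, norm_mul]
      refine add_le_add (ih p) ?_
      have hq := hp.mono (Nat.le_succ k)
      have h1 := (h k (by omega)).2 (p.1, pc k)
        (fun m hm => ⟨(hq m hm).1, ((h k (by omega)).1 m hm).2⟩)
      refine le_trans ?_ (ih (pr k, p.2))
      rw [mul_div_right_comm]
      exact mul_le_of_le_one_left (norm_nonneg _) (div_le_one_of_le₀ h1 (norm_nonneg _))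
    · refine (ih p).trans ?_
      rw [h2]
      have : 0 ≤ 2 ^ k * M := by positivity
      linarith

/-- The columns that contain none of the first `k` pivots. -/
def activeCols (pc : ℕ → Fin b) (k : ℕ) : Finset (Fin b) :=
  Finset.univ.filter fun j => ∀ m < k, pc m ≠ j

theorem activeCols_eq_insert (h : IsPivoting pr pc n H) {k : ℕ} (hk : k < n) :
    activeCols pc k = insert (pc k) (activeCols pc (k + 1)) ∧
      pc k ∉ activeCols pc (k + 1) := by
  constructor
  · ext j
    simp only [activeCols, Finset.mem_insert, Finset.mem_filter, Finset.mem_univ, true_and]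
    constructor
    · intro hj
      by_cases hjk : j = pc k
      · exact Or.inl hjk
      · refine Or.inr fun m hm => ?_
        rcases Nat.lt_succ_iff_lt_or_eq.1 hm with hm | rfl
        · exact hj m hm
        · exact fun h => hjk h.symm
    · rintro (rfl | hj) m hm
      · exact ((h k hk).1 m hm).2
      · exact hj m (by omega)
  · simp only [activeCols, Finset.mem_filter, Finset.mem_univ, true_and, not_forall]
    exact ⟨k, Nat.lt_succ_self k, fun h => h rfl⟩

/-- If `H x` is small, so is the product of each Schur complement with the remaining part of `x`. -/
theorem norm_sum_elim_le (h : IsPivoting pr pc n H) {x : Fin b → ℂ} {M : ℝ}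
    (hM : ∀ i, ‖∑ j, H (i, j) * x j‖ ≤ M) {k : ℕ} (hk : k ≤ n) (i : Fin a)
    (hi : ∀ m < k, pr m ≠ i) :
    ‖∑ j ∈ activeCols pc k, elim pr pc k H (i, j) * x j‖ ≤ 2 ^ k * M := by
  induction k generalizing i with
  | zero => simpa [elim, activeCols] using hM i
  | succ k ih =>
    have ih := ih (by omega)
    obtain ⟨hins, hnot⟩ := activeCols_eq_insert h (k := k) (by omega)
    have hk' : k < n := by omega
    set P := elim pr pc k H (pr k, pc k) with hP
    set q := elim pr pc k H (i, pc k) / P with hq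
    have hle : ‖elim pr pc k H (i, pc k)‖ ≤ ‖P‖ :=
      (h k hk').2 _ fun m hm => ⟨hi m (by omega), ((h k hk').1 m hm).2⟩
    have hqP : q * P = elim pr pc k H (i, pc k) := by
      by_cases h0 : P = 0
      · rw [h0, mul_zero]
        rw [h0, norm_zero] at hle
        exact (norm_le_zero_iff.1 hle).symm
      · rw [hq, div_mul_cancel₀ _ h0]
    have key : ∑ j ∈ activeCols pc (k + 1), elim pr pc (k + 1) H (i, j) * x j =
        ∑ j ∈ activeCols pc k, elim pr pc k H (i, j) * x j -
          q * ∑ j ∈ activeCols pc k, elim pr pc k H (pr k, j) * x j := by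
      rw [hins, Finset.sum_insert hnot, Finset.sum_insert hnot, mul_add, Finset.mul_sum,
        add_sub_add_comm, ← Finset.sum_sub_distrib, ← hP, ← mul_assoc, hqP, sub_self, zero_add]
      refine Finset.sum_congr rfl fun j hj => ?_
      simp only [elim]
      rw [if_pos]
      · simp only [← hP, hq]; ring
      · intro m hm
        simp only [activeCols, Finset.mem_filter] at hj
        exact ⟨hi m hm, hj.2 m hm⟩
    rw [key]
    refine (norm_sub_le _ _).trans ?_
    rw [norm_mul]
    have h1 := ih i fun m hm => hi m (by omega)
    have h2 := ih (pr k) fun m hm => ((h k hk').1 m hm).1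
    have h3 : ‖q‖ ≤ 1 := by
      rw [hq, norm_div]
      exact div_le_one_of_le₀ hle (norm_nonneg _)
    have h4 := mul_le_of_le_one_left (norm_nonneg
      (∑ j ∈ activeCols pc k, elim pr pc k H (pr k, j) * x j)) h3
    rw [pow_succ]
    linarith

/-- The `k`-th row of the unit triangular factor of `H`. -/
noncomputable def rowForm (pr : ℕ → Fin a) (pc : ℕ → Fin b) (H : Fin a × Fin b → ℂ) (k : ℕ) :
    (Fin b → ℂ) →ₗ[ℂ] ℂ :=
  ∑ j ∈ activeCols pc k,
    (elim pr pc k H (pr k, j) / elim pr pc k H (pr k, pc k)) • LinearMap.proj j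

theorem rowForm_apply (k : ℕ) (x : Fin b → ℂ) :
    rowForm pr pc H k x = ∑ j ∈ activeCols pc k,
      (elim pr pc k H (pr k, j) / elim pr pc k H (pr k, pc k)) * x j := by
  simp [rowForm, LinearMap.sum_apply]

/-- A vector with small image under `H` has small row forms, except for those of small pivots. -/
theorem norm_pivot_mul_rowForm_le (h : IsPivoting pr pc n H) {x : Fin b → ℂ} {M : ℝ}
    (hM : ∀ i, ‖∑ j, H (i, j) * x j‖ ≤ M) {k : ℕ} (hk : k < n) :
    ‖elim pr pc k H (pr k, pc k)‖ * ‖rowForm pr pc H k x‖ ≤ 2 ^ k * M := by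
  have h1 := norm_sum_elim_le h hM hk.le (pr k) fun m hm => ((h k hk).1 m hm).1
  by_cases h0 : elim pr pc k H (pr k, pc k) = 0
  · rw [h0, norm_zero, zero_mul]
    exact (norm_nonneg _).trans h1
  · rw [← norm_mul, rowForm_apply, Finset.mul_sum]
    convert h1 using 3 with j
    field_simp

/-- The row forms control all coordinates: the unit triangular factor has entries of modulus at most
`1`, so back substitution loses at most a factor `n + 1` at each step. -/
theorem norm_le_of_rowForm_le {pc : ℕ → Fin n} {H : Fin a × Fin n → ℂ}
    (h : IsPivoting pr pc n H) (h0 : ∀ k < n, elim pr pc k H (pr k, pc k) ≠ 0)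
    {x : Fin n → ℂ} {δ : ℝ} (hδ : ∀ k < n, ‖rowForm pr pc H k x‖ ≤ δ) (j : Fin n) :
    ‖x j‖ ≤ ((n : ℝ) + 1) ^ n * δ := by
  have hn : 0 < n := j.pos
  have hδ0 : 0 ≤ δ := (norm_nonneg _).trans (hδ 0 hn)
  have card : ∀ k ≤ n, (activeCols pc k).card = n - k := by
    intro k hk
    induction k with
    | zero => simp [activeCols]
    | succ k ih =>
      obtain ⟨h1, h2⟩ := activeCols_eq_insert h (k := k) (by omega)
      have := ih (by omega)
      rw [h1, Finset.card_insert_of_notMem h2] at this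
      omega
  have key : ∀ d ≤ n, ∀ i ∈ activeCols pc (n - d), ‖x i‖ ≤ ((n : ℝ) + 1) ^ d * δ := by
    intro d hd
    induction d with
    | zero =>
      intro i hi
      have := Finset.card_pos.2 ⟨i, hi⟩
      rw [card _ (by omega)] at this
      omega
    | succ d ih =>
      have ih := ih (by omega)
      intro i hi
      have hk : n - (d + 1) < n := by omega
      obtain ⟨h1, h2⟩ := activeCols_eq_insert h hk
      have e : n - (d + 1) + 1 = n - d := by omega
      rw [e] at h1 h2
      set k := n - (d + 1)
      have hpow : (1 : ℝ) ≤ ((n : ℝ) + 1) ^ d := one_le_pow₀ (by linarith [(Nat.cast_nonneg n : (0:ℝ) ≤ n)])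
      rw [h1, Finset.mem_insert] at hi
      rcases hi with rfl | hi
      · have hz := hδ k hk
        rw [rowForm_apply, h1, Finset.sum_insert h2, div_self (h0 k hk), one_mul] at hz
        have hs : ‖∑ j ∈ activeCols pc (n - d),
            (elim pr pc k H (pr k, j) / elim pr pc k H (pr k, pc k)) * x j‖ ≤
            n * (((n : ℝ) + 1) ^ d * δ) := by
          refine (norm_sum_le _ _).trans ?_
          have hle : ∀ j ∈ activeCols pc (n - d),
              ‖(elim pr pc k H (pr k, j) / elim pr pc k H (pr k, pc k)) * x j‖ ≤
                ((n : ℝ) + 1) ^ d * δ := by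
            intro j hj
            rw [norm_mul, norm_div]
            refine le_trans (mul_le_of_le_one_left (norm_nonneg _) ?_) (ih j hj)
            refine div_le_one_of_le₀ ((h k hk).2 _ fun m hm => ⟨((h k hk).1 m hm).1, ?_⟩)
              (norm_nonneg _)
            have : j ∈ activeCols pc k := by rw [h1]; exact Finset.mem_insert_of_mem hj
            simp only [activeCols, Finset.mem_filter] at this
            exact this.2 m hm
          refine (Finset.sum_le_card_nsmul _ _ _ hle).trans ?_
          rw [nsmul_eq_mul]
          have : ((activeCols pc (n - d)).card : ℝ) ≤ n := by
            rw [card _ (by omega)]; exact_mod_cast Nat.sub_le _ _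
          exact mul_le_mul_of_nonneg_right this (by positivity)
        have h3 := norm_sub_le (x (pc k) + ∑ j ∈ activeCols pc (n - d),
            (elim pr pc k H (pr k, j) / elim pr pc k H (pr k, pc k)) * x j)
            (∑ j ∈ activeCols pc (n - d),
            (elim pr pc k H (pr k, j) / elim pr pc k H (pr k, pc k)) * x j)
        rw [add_sub_cancel_right] at h3
        have h4 : δ ≤ ((n : ℝ) + 1) ^ d * δ := le_mul_of_one_le_left hδ0 hpow
        rw [pow_succ]
        linarith
      · refine (ih i hi).trans ?_
        rw [pow_succ]
        have : 0 ≤ ((n : ℝ) + 1) ^ d * δ := by positivity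
        have hn0 : (0 : ℝ) ≤ n := Nat.cast_nonneg n
        nlinarith
  exact key n le_rfl j (by simp [activeCols])

/-! ### Volume of the set of arrays with small pivots -/

/-- The number of the elimination step at which an entry gets its final value. -/
def level (pr : ℕ → Fin a) (pc : ℕ → Fin b) (n : ℕ) (p : Fin a × Fin b) : ℕ :=
  ((Finset.range n).filter fun m => Active pr pc (m + 1) p).card

theorem level_eq {p : Fin a × Fin b} {k : ℕ} (hk : k < n) (h1 : Active pr pc k p)
    (h2 : ¬ Active pr pc (k + 1) p) : level pr pc n p = k := by
  have : ((Finset.range n).filter fun m => Active pr pc (m + 1) p) = Finset.range k := by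
    ext m
    simp only [Finset.mem_filter, Finset.mem_range]
    constructor
    · rintro ⟨_, h⟩
      by_contra hm
      exact h2 (h.mono (by omega))
    · intro hm
      exact ⟨by omega, h1.mono (by omega)⟩
  rw [level, this, Finset.card_range]

theorem exists_level {pc : ℕ → Fin n} {H : Fin a × Fin n → ℂ} (h : IsPivoting pr pc n H)
    (p : Fin a × Fin n) : ∃ k < n, Active pr pc k p ∧ ¬ Active pr pc (k + 1) p := by
  have hn : ¬ Active pr pc n p := by
    intro hA
    have hinj : Set.InjOn pc (Finset.range n : Set ℕ) := by
      intro i hi j hj hij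
      simp only [Finset.coe_range, Set.mem_Iio] at hi hj
      by_contra hne
      rcases Nat.lt_or_gt_of_ne hne with h' | h'
      · exact ((h j hj).1 i h').2 hij
      · exact ((h i hi).1 j h').2 hij.symm
    have hc := Finset.card_image_of_injOn hinj
    rw [Finset.card_range] at hc
    have hu : (Finset.range n).image pc = Finset.univ :=
      Finset.eq_univ_of_card _ (by simpa using hc)
    have := Finset.mem_univ p.2
    rw [← hu, Finset.mem_image] at this
    obtain ⟨m, hm, hmp⟩ := this
    exact (hA m (Finset.mem_range.1 hm)).2 hmp
  have h0 : Active pr pc 0 p := fun m hm => absurd hm (by omega)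
  by_contra! hcon
  have : ∀ k ≤ n, Active pr pc k p := by
    intro k hk
    induction k with
    | zero => exact h0
    | succ k ih => exact hcon k (by omega) (ih (by omega))
  exact hn (this n le_rfl)

theorem norm_elim_le_pivot_level {pc : ℕ → Fin n} {H : Fin a × Fin n → ℂ}
    (h : IsPivoting pr pc n H) (p : Fin a × Fin n) :
    level pr pc n p < n ∧ ‖elim pr pc n H p‖ ≤
      ‖elim pr pc (level pr pc n p) H (pr (level pr pc n p), pc (level pr pc n p))‖ := by
  obtain ⟨k, hk, h1, h2⟩ := exists_level h p
  rw [level_eq hk h1 h2, elim_eq_of_not_active hk.le h2]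
  exact ⟨hk, (h k hk).2 p h1⟩

theorem card_active {a b : ℕ} {pr : ℕ → Fin a} {pc : ℕ → Fin b} {n : ℕ} {H : Fin a × Fin b → ℂ}
    (h : IsPivoting pr pc n H) {k : ℕ} (hk : k ≤ n) :
    (Finset.univ.filter fun p => Active pr pc k p).card = (a - k) * (b - k) := by
  have e : (Finset.univ.filter fun p => Active pr pc k p) =
      ((Finset.range k).image pr)ᶜ ×ˢ ((Finset.range k).image pc)ᶜ := by
    ext p
    simp only [Finset.mem_filter, Finset.mem_univ, true_and, Finset.mem_product,
      Finset.mem_compl, Finset.mem_image, Finset.mem_range, not_exists, not_and]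
    exact ⟨fun h => ⟨fun m hm => (h m hm).1, fun m hm => (h m hm).2⟩,
      fun h m hm => ⟨h.1 m hm, h.2 m hm⟩⟩
  have hr : Set.InjOn pr (Finset.range k : Set ℕ) := by
    intro i hi j hj hij
    simp only [Finset.coe_range, Set.mem_Iio] at hi hj
    by_contra hne
    rcases Nat.lt_or_gt_of_ne hne with h' | h'
    · exact ((h j (by omega)).1 i h').1 hij
    · exact ((h i (by omega)).1 j h').1 hij.symm
  have hc : Set.InjOn pc (Finset.range k : Set ℕ) := by
    intro i hi j hj hij
    simp only [Finset.coe_range, Set.mem_Iio] at hi hj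
    by_contra hne
    rcases Nat.lt_or_gt_of_ne hne with h' | h'
    · exact ((h j (by omega)).1 i h').2 hij
    · exact ((h i (by omega)).1 j h').2 hij.symm
  rw [e, Finset.card_product, Finset.card_compl, Finset.card_compl,
    Finset.card_image_of_injOn hr, Finset.card_image_of_injOn hc]
  simp

/-- The entries that get their final value at step `k` are those in the row and the column of the
`k`-th pivot. Their number is the weight of the `k`-th pivot in the exponent budget. -/
theorem card_level_eq {pc : ℕ → Fin n} {H : Fin a × Fin n → ℂ} (hna : n ≤ a)
    (h : IsPivoting pr pc n H) {k : ℕ} (hk : k < n) :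
    (Finset.univ.filter fun p => level pr pc n p = k).card = (a - k) + (n - k) - 1 := by
  have e : (Finset.univ.filter fun p => level pr pc n p = k) =
      (Finset.univ.filter fun p => Active pr pc k p) \
        (Finset.univ.filter fun p => Active pr pc (k + 1) p) := by
    ext p
    simp only [Finset.mem_filter, Finset.mem_univ, true_and, Finset.mem_sdiff]
    constructor
    · intro hp
      obtain ⟨l, hl, h1, h2⟩ := exists_level h p
      rw [level_eq hl h1 h2] at hp
      subst hp
      exact ⟨h1, h2⟩
    · rintro ⟨h1, h2⟩
      exact level_eq hk h1 h2
  rw [e, Finset.card_sdiff_of_subset, card_active h hk.le, card_active h hk]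
  · obtain ⟨u, hu⟩ : ∃ u, a - k = u + 1 := ⟨a - k - 1, by omega⟩
    obtain ⟨v, hv⟩ : ∃ v, n - k = v + 1 := ⟨n - k - 1, by omega⟩
    have hu' : a - (k + 1) = u := by omega
    have hv' : n - (k + 1) = v := by omega
    rw [hu, hv, hu', hv']
    have : (u + 1) * (v + 1) = u * v + (u + v + 1) := by ring
    omega
  · intro p hp
    simp only [Finset.mem_filter, Finset.mem_univ, true_and] at hp ⊢
    exact hp.mono (Nat.le_succ k)

/-- The probability that complete pivoting with given pivot positions has pivots of moduli at most
`A 0, …, A (n - 1)`: elimination preserves volume and maps these arrays into a product of discs, since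
the pivot of each step bounds the entries that get their final value at this step. -/
theorem gaussianFlat_pivot_le (hna : n ≤ a) (pr : ℕ → Fin a) (pc : ℕ → Fin n) {A : ℕ → ℝ}
    (hA : ∀ k, 0 ≤ A k) :
    gaussianFlat a n {H | IsPivoting pr pc n H ∧ ∀ k < n, ‖elim pr pc k H (pr k, pc k)‖ ≤ A k} ≤
      ENNReal.ofReal (∏ k ∈ Finset.range n, (Real.pi * A k ^ 2) ^ ((a - k) + (n - k) - 1)) := by
  rcases Set.eq_empty_or_nonempty
    {H | IsPivoting pr pc n H ∧ ∀ k < n, ‖elim pr pc k H (pr k, pc k)‖ ≤ A k} with he | ⟨H₀, h₀, -⟩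
  · rw [he, measure_empty]; exact zero_le
  set B : Set (Fin a × Fin n → ℂ) :=
    Set.univ.pi fun p => Metric.closedBall 0 (A (level pr pc n p)) with hB
  have hsub : {H | IsPivoting pr pc n H ∧ ∀ k < n, ‖elim pr pc k H (pr k, pc k)‖ ≤ A k} ⊆
      elim pr pc n ⁻¹' B := by
    rintro H ⟨hH, hk⟩
    rw [Set.mem_preimage, hB, Set.mem_univ_pi]
    intro p
    rw [mem_closedBall_zero_iff]
    obtain ⟨h1, h2⟩ := norm_elim_le_pivot_level hH p
    exact h2.trans (hk _ h1)
  refine (measure_mono hsub).trans ((gaussianFlat_le_volume a n _).trans ?_)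
  rw [(measurePreserving_elim pr pc n).measure_preimage
    (MeasurableSet.univ_pi fun p => measurableSet_closedBall).nullMeasurableSet, volume_pi_pi]
  simp only [Complex.volume_closedBall]
  have hfac : ∀ k, ENNReal.ofReal (A k) ^ 2 * (NNReal.pi : ℝ≥0∞) =
      ENNReal.ofReal (Real.pi * A k ^ 2) := by
    intro k
    rw [← ENNReal.ofReal_pow (hA k), ← NNReal.coe_real_pi, mul_comm, ENNReal.ofReal_mul (NNReal.coe_nonneg _),
      ENNReal.ofReal_coe_nnreal]
  simp only [hfac]
  rw [← ENNReal.ofReal_prod_of_nonneg fun p _ => by have := hA (level pr pc n p); positivity]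
  refine ENNReal.ofReal_le_ofReal (le_of_eq ?_)
  rw [← Finset.prod_fiberwise_of_maps_to (s := Finset.univ) (t := Finset.range n)
    (g := level pr pc n) fun p _ => Finset.mem_range.2 (norm_elim_le_pivot_level h₀ p).1]
  refine Finset.prod_congr rfl fun k hk => ?_
  rw [← card_level_eq hna h₀ (Finset.mem_range.1 hk)]
  rw [Finset.prod_congr rfl (g := fun _ => Real.pi * A k ^ 2), Finset.prod_const]
  intro p hp
  rw [(Finset.mem_filter.1 hp).2]

end Pivoting

/-! ### Singularity exponents of the channel -/

theorem eventually_le_rpow (C : ℝ) {δ : ℝ} (hδ : 0 < δ) : ∀ᶠ ρ : ℝ in atTop, C ≤ ρ ^ δ :=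
  (tendsto_rpow_atTop hδ).eventually_ge_atTop C

theorem eventually_exp_neg_rpow_le (C : ℝ) {ε : ℝ} (hε : 0 < ε) (D : ℝ) :
    ∀ᶠ ρ : ℝ in atTop, C * Real.exp (-(1 / 2 * ρ ^ ε)) ≤ ρ ^ D := by
  have h := (isLittleO_exp_neg_mul_rpow_atTop (a := 1 / 2) (by norm_num) (D / ε)).comp_tendsto
    (tendsto_rpow_atTop hε)
  have h2 := (h.const_mul_left C).bound one_pos
  filter_upwards [h2, eventually_gt_atTop 0] with ρ hρ h0
  simp only [Function.comp_apply, one_mul, Real.norm_eq_abs] at hρ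
  rw [← Real.rpow_mul h0.le, mul_div_cancel₀ _ hε.ne',
    abs_of_nonneg (Real.rpow_nonneg h0.le D)] at hρ
  refine (le_abs_self _).trans (le_trans (le_of_eq ?_) hρ)
  ring_nf

/-- The exponent `t ∈ [0, 1]` with `x = ρ ^ (-t / 2)`, clipped to the unit interval. -/
noncomputable def decayExponent (ρ x : ℝ) : ℝ := max 0 (min 1 (-2 * Real.log x / Real.log ρ))

theorem decayExponent_mem (ρ x : ℝ) : 0 ≤ decayExponent ρ x ∧ decayExponent ρ x ≤ 1 :=
  ⟨le_max_left _ _, max_le zero_le_one (min_le_left _ _)⟩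

theorem le_rpow_neg_decayExponent {ρ x : ℝ} (hρ : 1 < ρ) (hx : 0 < x)
    (h : 0 < decayExponent ρ x) : x ≤ ρ ^ (-(decayExponent ρ x) / 2) := by
  have hl := Real.log_pos hρ
  have h1 : decayExponent ρ x ≤ -2 * Real.log x / Real.log ρ := by
    unfold decayExponent at h ⊢
    rcases lt_max_iff.1 h with h | h
    · exact absurd h (lt_irrefl _)
    · rw [max_eq_right h.le]; exact min_le_right _ _
  rw [le_div_iff₀ hl] at h1
  rw [Real.rpow_def_of_pos (by linarith), ← Real.log_le_iff_le_exp hx]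
  nlinarith

theorem rpow_neg_decayExponent_le {ρ x : ℝ} (hρ : 1 < ρ) (hx : 0 < x)
    (h : decayExponent ρ x < 1) : ρ ^ (-(decayExponent ρ x) / 2) ≤ x := by
  have hl := Real.log_pos hρ
  have h1 : -2 * Real.log x / Real.log ρ ≤ decayExponent ρ x := by
    unfold decayExponent at h ⊢
    have h2 := (max_lt_iff.1 h).2
    rcases min_lt_iff.1 h2 with h2 | h2
    · exact absurd h2 (lt_irrefl _)
    · rw [min_eq_right h2.le]; exact le_max_right _ _
  rw [div_le_iff₀ hl] at h1
  rw [Real.rpow_def_of_pos (by linarith), ← Real.le_log_iff_exp_le hx]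
  nlinarith

/-- The channel matrices that have complete pivots which are nonzero and whose decay exponents
have weighted sum at most `D`. -/
def regularChannels (a n : ℕ) (D ρ : ℝ) : Set (Fin a × Fin n → ℂ) :=
  {H | ∃ pr pc, IsPivoting pr pc n H ∧ (∀ k < n, elim pr pc k H (pr k, pc k) ≠ 0) ∧
    ∑ k ∈ Finset.range n, (((a - k) + (n - k) - 1 : ℕ) : ℝ) *
      decayExponent ρ ‖elim pr pc k H (pr k, pc k)‖ ≤ D}

/-- Sequences of pivot positions that are determined by the first `n` positions. -/
def pivotSeq {a n : ℕ} (hn : 0 < n) (f : Fin n → Fin a × Fin n) : ℕ → Fin a × Fin n :=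
  fun k => if h : k < n then f ⟨k, h⟩ else f ⟨0, hn⟩

theorem exists_pivotSeq {a n : ℕ} (hn : 0 < n) (hna : n ≤ a) (H : Fin a × Fin n → ℂ) :
    ∃ f : Fin n → Fin a × Fin n,
      IsPivoting (fun k => (pivotSeq hn f k).1) (fun k => (pivotSeq hn f k).2) n H := by
  obtain ⟨pr, pc, h, -⟩ := exists_isPivoting (⟨0, by omega⟩ : Fin a) (⟨0, hn⟩ : Fin n) H n hna le_rfl
  refine ⟨fun k => (pr k, pc k), fun k hk => ?_⟩
  have er : ∀ m < k, (pivotSeq hn (fun k : Fin n => (pr k, pc k)) m).1 = pr m := fun m hm => by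
    simp [pivotSeq, hm.trans hk]
  have ec : ∀ m < k, (pivotSeq hn (fun k : Fin n => (pr k, pc k)) m).2 = pc m := fun m hm => by
    simp [pivotSeq, hm.trans hk]
  simp only [active_congr er ec, elim_congr er ec]
  have : pivotSeq hn (fun k : Fin n => (pr k, pc k)) k = (pr k, pc k) := by simp [pivotSeq, hk]
  rw [this]
  exact h k hk

/-- The channel matrices with weighted sum of the decay exponents above `D` have probability at most
`ρ ^ (-D)` up to a factor `ρ ^ δ`. -/
theorem eventually_gaussianFlat_compl_regularChannels_le {a n : ℕ} (hn : 0 < n) (hna : n ≤ a)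
    (D : ℝ) {δ : ℝ} (hδ : 0 < δ) :
    ∀ᶠ ρ in atTop, gaussianFlat a n (regularChannels a n D ρ)ᶜ ≤
      ENNReal.ofReal (ρ ^ (-D + δ)) := by
  set w : ℕ → ℕ := fun k => (a - k) + (n - k) - 1 with hw
  set W : ℝ := ∑ k ∈ Finset.range n, (w k : ℝ) with hW
  have hW0 : 0 ≤ W := Finset.sum_nonneg fun k _ => Nat.cast_nonneg _
  obtain ⟨M, hM⟩ := exists_nat_gt (max 1 (3 * W / δ))
  have hM1 : (1 : ℝ) < M := (le_max_left _ _).trans_lt hM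
  have hM0 : (0 : ℝ) < M := by linarith
  have hMW : W / M ≤ δ / 3 := by
    have := (le_max_right (1 : ℝ) (3 * W / δ)).trans_lt hM
    rw [div_lt_iff₀ hδ] at this
    rw [div_le_div_iff₀ hM0 (by norm_num)]
    linarith
  obtain ⟨ε, hε, hεW⟩ : ∃ ε : ℝ, 0 < ε ∧ 2 * ε * W ≤ δ / 3 := by
    refine ⟨δ / (6 * (W + 1)), by positivity, ?_⟩
    rw [mul_comm (2 : ℝ), mul_assoc, div_mul_eq_mul_div, div_le_div_iff₀ (by positivity) (by norm_num)]
    nlinarith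
  obtain ⟨C, hC, htail⟩ := exists_gaussianFlat_tail a n (l := 1 / 2) (by norm_num) (by norm_num)
  set C' : ℝ := ∏ k ∈ Finset.range n, (Real.pi * (2 ^ n) ^ 2) ^ w k with hC'
  have hC'0 : 0 < C' := Finset.prod_pos fun k _ => by positivity
  set F := (Fin n → Fin a × Fin n) with hF
  set N : ℝ := Fintype.card F * Fintype.card (Fin n → Fin (M + 1)) with hN
  filter_upwards [eventually_gt_atTop 1, eventually_le_rpow (N * C' + 1) (δ := δ / 3) (by linarith),
    eventually_exp_neg_rpow_le C (ε := 2 * ε) (by linarith) (-D + 2 * δ / 3)] with ρ hρ1 hρ2 hρ3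
  have hρ0 : 0 < ρ := by linarith
  set A : (Fin n → Fin (M + 1)) → ℕ → ℝ := fun m k =>
    2 ^ n * ρ ^ (ε - (if h : k < n then ((m ⟨k, h⟩ : ℕ) : ℝ) else 0) / M / 2) with hA
  -- The decay exponents are rounded down to multiples of `1 / M`. There are finitely many choices `m`
  -- of the rounded exponents, and `A m` are the corresponding bounds for the pivots.
  set S : F → (ℕ → ℝ) → Set (Fin a × Fin n → ℂ) := fun f A =>
    {H | IsPivoting (fun k => (pivotSeq hn f k).1) (fun k => (pivotSeq hn f k).2) n H ∧
      ∀ k < n, ‖elim (fun k => (pivotSeq hn f k).1) (fun k => (pivotSeq hn f k).2) k H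
        ((pivotSeq hn f k).1, (pivotSeq hn f k).2)‖ ≤ A k} with hS
  set Bad := Finset.univ.filter fun m : Fin n → Fin (M + 1) =>
    D - δ / 3 ≤ ∑ k : Fin n, (w k : ℝ) * ((m k : ℕ) / M) with hBad
  -- A channel outside of the regular set has a large entry, a vanishing pivot, or small pivots.
  have hcover : (regularChannels a n D ρ)ᶜ ⊆ {H | ρ ^ (2 * ε) ≤ normSq H} ∪
      ((⋃ f : F, ⋃ j : Fin n, S f fun k => if k = j then 0 else 2 ^ n * ρ ^ ε) ∪
        ⋃ f : F, ⋃ m ∈ Bad, S f (A m)) := by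
    intro H hH
    by_cases h1 : ρ ^ (2 * ε) ≤ normSq H
    · exact Or.inl h1
    refine Or.inr ?_
    have hent : ∀ p, ‖H p‖ ≤ ρ ^ ε := by
      intro p
      have h2 : ‖H p‖ ^ 2 ≤ normSq H :=
        Finset.single_le_sum (f := fun p => ‖H p‖ ^ 2) (fun p _ => by positivity)
          (Finset.mem_univ p)
      have h3 : ‖H p‖ ^ 2 ≤ (ρ ^ ε) ^ 2 := by
        rw [← Real.rpow_natCast (ρ ^ ε), ← Real.rpow_mul hρ0.le, mul_comm ε]
        push_cast
        linarith
      exact le_of_sq_le_sq h3 (Real.rpow_nonneg hρ0.le _)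
    obtain ⟨f, hf⟩ := exists_pivotSeq hn hna H
    have hP : ∀ k < n, ‖elim (fun k => (pivotSeq hn f k).1) (fun k => (pivotSeq hn f k).2) k H
        ((pivotSeq hn f k).1, (pivotSeq hn f k).2)‖ ≤ 2 ^ n * ρ ^ ε := by
      intro k hk
      refine (norm_elim_le hf hent hk.le _).trans ?_
      gcongr
      norm_num
    set P : ℕ → ℂ := fun k =>
      elim (fun k => (pivotSeq hn f k).1) (fun k => (pivotSeq hn f k).2) k H
        ((pivotSeq hn f k).1, (pivotSeq hn f k).2) with hPdef
    by_cases hz : ∃ j < n, P j = 0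
    · obtain ⟨j, hj, hz⟩ := hz
      refine Or.inl (Set.mem_iUnion.2 ⟨f, Set.mem_iUnion.2 ⟨⟨j, hj⟩, hf, fun k hk => ?_⟩⟩)
      dsimp only
      split_ifs with hkj
      · subst hkj
        change ‖P k‖ ≤ 0
        rw [hz, norm_zero]
      · exact hP k hk
    push Not at hz
    set t : ℕ → ℝ := fun k => decayExponent ρ ‖P k‖ with ht
    have ht01 : ∀ k, 0 ≤ t k ∧ t k ≤ 1 := fun k => decayExponent_mem _ _
    have hsum : D < ∑ k ∈ Finset.range n, (w k : ℝ) * t k := by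
      by_contra! hcon
      exact hH ⟨_, _, hf, hz, hcon⟩
    refine Or.inr (Set.mem_iUnion.2 ⟨f, Set.mem_iUnion₂.2
      ⟨fun k => ⟨⌊(M : ℝ) * t k⌋₊, ?_⟩, ?_, hf, fun k hk => ?_⟩⟩)
    · rw [Nat.lt_succ_iff]
      refine Nat.floor_le_of_le ?_
      exact mul_le_of_le_one_right hM0.le (ht01 k).2
    · rw [hBad, Finset.mem_filter]
      refine ⟨Finset.mem_univ _, ?_⟩
      rw [Fin.sum_univ_eq_sum_range (fun k => (w k : ℝ) * ((⌊(M : ℝ) * t k⌋₊ : ℝ) / M)) n]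
      have hle : ∑ k ∈ Finset.range n, (w k : ℝ) * t k - W / M ≤
          ∑ k ∈ Finset.range n, (w k : ℝ) * ((⌊(M : ℝ) * t k⌋₊ : ℝ) / M) := by
        rw [hW, Finset.sum_div, ← Finset.sum_sub_distrib]
        refine Finset.sum_le_sum fun k _ => ?_
        have h2 := Nat.lt_floor_add_one ((M : ℝ) * t k)
        have h3 : t k ≤ (⌊(M : ℝ) * t k⌋₊ : ℝ) / M + 1 / M := by
          rw [← add_div, le_div_iff₀ hM0]; linarith
        have h4 : (0 : ℝ) ≤ w k := Nat.cast_nonneg _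
        have h5 := mul_le_mul_of_nonneg_left h3 h4
        rw [mul_add, mul_one_div] at h5
        linarith
      linarith
    · simp only [hA, hk, dif_pos]
      change ‖P k‖ ≤ _
      have hm : (⌊(M : ℝ) * t k⌋₊ : ℝ) / M ≤ t k := by
        rw [div_le_iff₀ hM0]
        linarith [Nat.floor_le (mul_nonneg hM0.le (ht01 k).1)]
      rcases (ht01 k).1.eq_or_lt with h0 | hpos
      · have hm0 : (⌊(M : ℝ) * t k⌋₊ : ℝ) = 0 := by rw [← h0]; simp
        rw [hm0]
        simpa using hP k hk
      · have h2 := le_rpow_neg_decayExponent hρ1 (norm_pos_iff.2 (hz k hk)) hpos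
        refine h2.trans ?_
        have h3 : ρ ^ (-decayExponent ρ ‖P k‖ / 2) ≤
            ρ ^ (ε - (⌊(M : ℝ) * t k⌋₊ : ℝ) / M / 2) := by
          refine Real.rpow_le_rpow_of_exponent_le hρ1.le ?_
          change (⌊(M : ℝ) * t k⌋₊ : ℝ) / M ≤ decayExponent ρ ‖P k‖ at hm
          linarith
        refine h3.trans (le_mul_of_one_le_left (Real.rpow_nonneg hρ0.le _) ?_)
        exact one_le_pow₀ (by norm_num)
  have hzero : ∀ f : F, ∀ j : Fin n,
      gaussianFlat a n (S f fun k => if k = j then 0 else 2 ^ n * ρ ^ ε) = 0 := by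
    intro f j
    refine le_antisymm ((gaussianFlat_pivot_le hna _ _ fun k => ?_).trans (le_of_eq ?_)) zero_le
    · split_ifs
      · exact le_rfl
      · positivity
    · rw [Finset.prod_eq_zero (Finset.mem_range.2 j.2), ENNReal.ofReal_zero]
      simp only [if_true]
      have := j.2
      rw [zero_pow two_ne_zero, mul_zero, zero_pow (by omega)]
  have hsmall : ∀ f : F, ∀ m ∈ Bad, gaussianFlat a n (S f (A m)) ≤
      ENNReal.ofReal (C' * ρ ^ (-D + 2 * δ / 3)) := by
    intro f m hm
    refine (gaussianFlat_pivot_le hna _ _ fun k => ?_).trans (ENNReal.ofReal_le_ofReal ?_)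
    · rw [hA]; positivity
    have hprod : ∏ k ∈ Finset.range n, (Real.pi * A m k ^ 2) ^ w k =
        C' * ρ ^ (∑ k ∈ Finset.range n, (w k : ℝ) * (2 * (ε -
          (if h : k < n then ((m ⟨k, h⟩ : ℕ) : ℝ) else 0) / M / 2))) := by
      rw [Real.rpow_sum_of_pos hρ0, hC', ← Finset.prod_mul_distrib]
      refine Finset.prod_congr rfl fun k _ => ?_
      rw [hA, mul_comm (w k : ℝ), Real.rpow_mul hρ0.le, Real.rpow_natCast, mul_comm (2 : ℝ),
        Real.rpow_mul hρ0.le, ← mul_pow]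
      norm_num
      ring
    rw [hprod]
    refine mul_le_mul_of_nonneg_left (Real.rpow_le_rpow_of_exponent_le hρ1.le ?_) hC'0.le
    have e1 : ∑ k ∈ Finset.range n, (w k : ℝ) * (2 * (ε -
          (if h : k < n then ((m ⟨k, h⟩ : ℕ) : ℝ) else 0) / M / 2)) =
        2 * ε * W - ∑ k : Fin n, (w k : ℝ) * ((m k : ℕ) / M) := by
      rw [hW, Finset.mul_sum, ← Fin.sum_univ_eq_sum_range, ← Fin.sum_univ_eq_sum_range,
        ← Finset.sum_sub_distrib]
      refine Finset.sum_congr rfl fun k _ => ?_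
      simp only [k.2, dif_pos]
      ring
    rw [e1]
    have := (Finset.mem_filter.1 hm).2
    linarith
  refine (measure_mono hcover).trans ((measure_union_le _ _).trans ?_)
  have hT := (htail (ρ ^ (2 * ε))).trans (ENNReal.ofReal_le_ofReal hρ3)
  have hU : gaussianFlat a n ((⋃ f : F, ⋃ j : Fin n, S f fun k => if k = j then 0 else 2 ^ n * ρ ^ ε) ∪
        ⋃ f : F, ⋃ m ∈ Bad, S f (A m)) ≤ ENNReal.ofReal (N * (C' * ρ ^ (-D + 2 * δ / 3))) := by
    refine (measure_union_le _ _).trans ?_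
    have hz : gaussianFlat a n
        (⋃ f : F, ⋃ j : Fin n, S f fun k => if k = j then 0 else 2 ^ n * ρ ^ ε) = 0 :=
      measure_iUnion_null fun f => measure_iUnion_null fun j => hzero f j
    rw [hz, zero_add]
    have h1 : ∀ f : F, gaussianFlat a n (⋃ m ∈ Bad, S f (A m)) ≤
        Fintype.card (Fin n → Fin (M + 1)) * ENNReal.ofReal (C' * ρ ^ (-D + 2 * δ / 3)) := by
      intro f
      refine (measure_biUnion_finset_le _ _).trans ((Finset.sum_le_card_nsmul _ _ _ (hsmall f)).trans ?_)
      rw [nsmul_eq_mul]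
      gcongr
      exact Finset.card_le_univ _
    refine (measure_iUnion_fintype_le _ _).trans ((Finset.sum_le_card_nsmul _ _ _ fun f _ => h1 f).trans ?_)
    rw [nsmul_eq_mul, Finset.card_univ, ← mul_assoc, hN,
      ENNReal.ofReal_mul (p := (Fintype.card F : ℝ) * Fintype.card (Fin n → Fin (M + 1)))
        (by positivity), ENNReal.ofReal_mul (p := (Fintype.card F : ℝ)) (by positivity), ENNReal.ofReal_natCast, ENNReal.ofReal_natCast]
  refine (add_le_add hT hU).trans ?_
  rw [← ENNReal.ofReal_add (by positivity) (by positivity)]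
  refine ENNReal.ofReal_le_ofReal ?_
  have e : ρ ^ (-D + δ) = ρ ^ (δ / 3) * ρ ^ (-D + 2 * δ / 3) := by
    rw [← Real.rpow_add hρ0]; ring_nf
  rw [e]
  have hp : 0 < ρ ^ (-D + 2 * δ / 3) := Real.rpow_pos_of_pos hρ0 _
  nlinarith

/-! ### The exponent budget -/

/-- The piecewise linear function of `r` that is the complexity exponent of the threaded code. -/
noncomputable def sdExponent (n : ℕ) (r : ℝ) : ℝ :=
  r * ((n : ℝ) - ⌊r⌋ - 1) + max ((n : ℝ) * ⌊r⌋ - r * ((n : ℝ) - 1)) 0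

/-- The multiplexing gain `r` lies in a unit interval `[k, k + 1]` on which the tradeoff curve is linear. -/
theorem exists_linear_piece {n : ℕ} (hn : 1 ≤ n) (a : ℕ) {r : ℝ} (hr : r ∈ Set.Icc (0 : ℝ) n) :
    ∃ (k : ℕ) (f : ℝ), k < n ∧ 0 ≤ f ∧ f ≤ 1 ∧ r = k + f ∧
      dmt n a r = ((n : ℝ) - k) * ((a : ℝ) - k) - f * ((n : ℝ) + a - 2 * k - 1) ∧
      sdExponent n r = ((n : ℝ) - k - 1) * r + max (r - n * f) 0 := by
  rcases hr.2.lt_or_eq with h | h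
  · have h0 : 0 ≤ ⌊r⌋ := Int.floor_nonneg.2 hr.1
    obtain ⟨k, hk⟩ := Int.eq_ofNat_of_zero_le h0
    have hkr : (⌊r⌋ : ℝ) = k := by rw [hk]; simp
    have h1 := Int.floor_le r
    have h2 := Int.lt_floor_add_one r
    rw [hkr] at h1 h2
    refine ⟨k, r - k, by exact_mod_cast h1.trans_lt h, by linarith, by linarith, by ring, ?_, ?_⟩
    · rw [dmt, hkr]
    · rw [sdExponent, hkr]
      congr 1
      · ring
      · congr 1; ring
  · have hf : (⌊r⌋ : ℝ) = n := by rw [h]; simp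
    have e : ((n - 1 : ℕ) : ℝ) = (n : ℝ) - 1 := by push_cast [Nat.cast_sub hn]; ring
    refine ⟨n - 1, 1, by omega, zero_le_one, le_rfl, by rw [e, h]; ring, ?_, ?_⟩
    · rw [dmt, hf, h, e]; ring
    · rw [sdExponent, hf, h, e]
      have h1 : (n : ℝ) * n - n * ((n : ℝ) - 1) = n := by ring
      have h2 : (n : ℝ) - n * 1 = 0 := by ring
      rw [h1, h2, max_eq_left (Nat.cast_nonneg n), max_self]
      ring

theorem sum_tail_weights (n a k : ℕ) (hk : k < n) :
    ∑ j ∈ Finset.range n, (((a : ℝ) - j) + ((n : ℝ) - j) - 1) * (if k < j then 1 else 0) =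
      ((n : ℝ) - k - 1) * ((a : ℝ) - k - 1) := by
  have key : ∀ m, k < m → m ≤ n →
      ∑ j ∈ Finset.range m, (((a : ℝ) - j) + ((n : ℝ) - j) - 1) * (if k < j then 1 else 0) =
      ((n : ℝ) - k - 1) * ((a : ℝ) - k - 1) - (n - m) * (a - m) := by
    intro m hkm
    induction m, hkm using Nat.le_induction with
    | base =>
      intro _
      rw [Finset.sum_eq_zero]
      · push_cast; ring
      · intro j hj
        rw [Finset.mem_range] at hj
        rw [if_neg (by omega), mul_zero]
    | succ m hm ih =>
      intro h
      rw [Finset.sum_range_succ, ih (by omega), if_pos (by omega)]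
      push_cast
      ring
  rw [key n hk le_rfl]
  ring

/-- Linear programming bound: a weighted budget given by the tradeoff curve for the decay exponents of
the pivots bounds the exponent of the number of nodes. -/
theorem sum_max_le_of_weight_le {n a : ℕ} (hn : 1 ≤ n) (hna : n ≤ a) {r ε : ℝ}
    (hr : r ∈ Set.Icc (0 : ℝ) n) (hε : 0 ≤ ε) {t : ℕ → ℝ} (ht : ∀ k, 0 ≤ t k ∧ t k ≤ 1)
    (h : ∑ k ∈ Finset.range n, (((a - k) + (n - k) - 1 : ℕ) : ℝ) * t k ≤ dmt n a r + ε) :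
    ∑ k ∈ Finset.range n, max 0 (n * t k - (n - r)) ≤ sdExponent n r + n * ε := by
  obtain ⟨k₀, f, hk₀, hf0, hf1, hrk, hd, hc⟩ := exists_linear_piece hn a hr
  rw [hc]
  rw [hd] at h
  have hw : ∀ k ∈ Finset.range n, (((a - k) + (n - k) - 1 : ℕ) : ℝ) * t k =
      (((a : ℝ) - k) + ((n : ℝ) - k) - 1) * t k := by
    intro k hk
    rw [Finset.mem_range] at hk
    rw [Nat.cast_sub (by omega), Nat.cast_add, Nat.cast_sub (by omega), Nat.cast_sub hk.le]
    simp
  rw [Finset.sum_congr rfl hw] at h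
  have hna' : (n : ℝ) ≤ a := by exact_mod_cast hna
  have hk₀' : (k₀ : ℝ) + 1 ≤ n := by exact_mod_cast hk₀
  -- The weights decrease, so the optimal allocation `s` saturates the last coordinates; each `t k` is
  -- compared with it, which bounds the unweighted sum of the `t k` by `n - r + ε`.
  set u : ℝ := ((a : ℝ) - k₀) + ((n : ℝ) - k₀) - 1 with hu
  have hu1 : 1 ≤ u := by rw [hu]; linarith
  set s : ℕ → ℝ := fun k => (if k₀ < k then 1 else 0) + (1 - f) * (if k = k₀ then 1 else 0) with hs
  have hcmp : 0 ≤ ∑ k ∈ Finset.range n,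
      ((((a : ℝ) - k) + ((n : ℝ) - k) - 1) - u) * (t k - s k) := by
    refine Finset.sum_nonneg fun k _ => ?_
    rcases lt_trichotomy k k₀ with hk | hk | hk
    · have h1 : (k : ℝ) ≤ k₀ := by exact_mod_cast hk.le
      have h2 : s k = 0 := by simp [hs, hk.ne, hk.le]
      rw [h2]
      exact mul_nonneg (by rw [hu]; linarith) (by linarith [(ht k).1])
    · subst hk
      rw [hu]; simp
    · have h1 : (k₀ : ℝ) ≤ k := by exact_mod_cast hk.le
      have h2 : s k = 1 := by simp [hs, hk.ne', hk]
      rw [h2]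
      exact mul_nonneg_of_nonpos_of_nonpos (by rw [hu]; linarith) (by linarith [(ht k).2])
  have hsum1 : ∑ k ∈ Finset.range n, s k = n - r := by
    have e1 : ∑ k ∈ Finset.range n, (if k₀ < k then (1 : ℝ) else 0) = n - k₀ - 1 := by
      rw [Finset.sum_boole]
      have : (Finset.range n).filter (fun k => k₀ < k) = Finset.Ico (k₀ + 1) n := by
        ext k; simp; omega
      rw [this, Nat.card_Ico, Nat.cast_sub (by omega)]
      push_cast; ring
    rw [hs, Finset.sum_add_distrib, e1, ← Finset.mul_sum, Finset.sum_ite_eq' (Finset.range n) k₀,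
      if_pos (Finset.mem_range.2 hk₀), hrk]
    ring
  have hsum2 : ∑ k ∈ Finset.range n, (((a : ℝ) - k) + ((n : ℝ) - k) - 1) * s k =
      ((n : ℝ) - k₀) * ((a : ℝ) - k₀) - f * ((n : ℝ) + a - 2 * k₀ - 1) := by
    simp only [hs, mul_add, Finset.sum_add_distrib]
    rw [sum_tail_weights n a k₀ hk₀]
    have : ∑ k ∈ Finset.range n, (((a : ℝ) - k) + ((n : ℝ) - k) - 1) *
        ((1 - f) * (if k = k₀ then 1 else 0)) = u * (1 - f) := by
      rw [Finset.sum_eq_single k₀]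
      · rw [if_pos rfl, hu]; ring
      · intro j _ hj; rw [if_neg hj]; ring
      · intro hj; exact absurd (Finset.mem_range.2 hk₀) hj
    rw [this, hu]
    ring
  have hA : ∑ k ∈ Finset.range n, t k ≤ n - r + ε := by
    have e : ∑ k ∈ Finset.range n, ((((a : ℝ) - k) + ((n : ℝ) - k) - 1) - u) * (t k - s k) =
        (∑ k ∈ Finset.range n, (((a : ℝ) - k) + ((n : ℝ) - k) - 1) * t k -
          ∑ k ∈ Finset.range n, (((a : ℝ) - k) + ((n : ℝ) - k) - 1) * s k) -
        u * (∑ k ∈ Finset.range n, t k - ∑ k ∈ Finset.range n, s k) := by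
      rw [← Finset.sum_sub_distrib, ← Finset.sum_sub_distrib, Finset.mul_sum,
        ← Finset.sum_sub_distrib]
      exact Finset.sum_congr rfl fun k _ => by ring
    rw [e, hsum1, hsum2] at hcmp
    by_contra! hcon
    nlinarith
  set S := (Finset.range n).filter fun k => 0 ≤ n * t k - (n - r) with hS
  have hle : ∑ k ∈ Finset.range n, max 0 (n * t k - (n - r)) =
      ∑ k ∈ S, (n * t k - (n - r)) := by
    rw [hS, Finset.sum_filter]
    refine Finset.sum_congr rfl fun k _ => ?_
    split_ifs with hk
    · exact max_eq_right hk
    · exact max_eq_left (le_of_not_ge hk)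
  have hn0 : (0 : ℝ) ≤ n := Nat.cast_nonneg n
  rw [hle, Finset.sum_sub_distrib, Finset.sum_const, nsmul_eq_mul, ← Finset.mul_sum]
  have hS1 : ∑ k ∈ S, t k ≤ S.card := by
    have := Finset.sum_le_card_nsmul S t 1 fun k _ => (ht k).2
    simpa using this
  have hS2 : ∑ k ∈ S, t k ≤ n - r + ε :=
    (Finset.sum_le_sum_of_subset_of_nonneg (Finset.filter_subset _ _) fun k _ _ => (ht k).1).trans hA
  have hnε : 0 ≤ n * ε := mul_nonneg hn0 hε
  -- For few positive terms the bound `t k ≤ 1` is the better one, otherwise the bound for the sum.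
  by_cases hm : S.card + k₀ + 1 ≤ n
  · have hm' : (S.card : ℝ) ≤ n - k₀ - 1 := by
      have : (S.card : ℝ) + k₀ + 1 ≤ n := by exact_mod_cast hm
      linarith
    have h1 := mul_le_mul_of_nonneg_left hS1 hn0
    have h2 := mul_le_mul_of_nonneg_right hm' hr.1
    have h3 := le_max_right (r - n * f) 0
    linarith
  · have hm' : (n : ℝ) - k₀ ≤ S.card := by
      have : (n : ℝ) ≤ (S.card : ℝ) + k₀ := by exact_mod_cast (by omega : n ≤ S.card + k₀)
      linarith
    have h1 := mul_le_mul_of_nonneg_left hS2 hn0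
    have h2 := mul_le_mul_of_nonneg_right hm' (sub_nonneg.2 hr.2)
    have h3 := le_max_left (r - n * f) 0
    have h4 : n * ((n : ℝ) - r) - ((n : ℝ) - k₀) * (n - r) = ((n : ℝ) - k₀ - 1) * r + (r - n * f) := by
      rw [hrk]; ring
    linarith

/-! ### Counting Gaussian integer vectors -/

/-- A subspace of dimension `d` has `d` coordinates that control all others. -/
theorem exists_controlling_coordinates {ι : Type*} [Fintype ι] [DecidableEq ι] (d : ℕ)
    (V : Submodule ℂ (ι → ℂ)) (hV : Module.finrank ℂ V ≤ d) :
    ∃ I : Finset ι, I.card ≤ d ∧ ∀ δ : ℝ, 0 ≤ δ → ∀ v ∈ V, (∀ i ∈ I, ‖v i‖ ≤ δ) →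
      ∀ i, ‖v i‖ ≤ 3 ^ d * δ := by
  induction d generalizing V with
  | zero =>
    refine ⟨∅, by simp, fun δ hδ v hv _ i => ?_⟩
    have : V = ⊥ := Submodule.finrank_eq_zero.1 (by omega)
    rw [this, Submodule.mem_bot] at hv
    simpa [hv] using hδ
  | succ d ih =>
    by_cases hbot : V = ⊥
    · refine ⟨∅, by simp, fun δ hδ v hv _ i => ?_⟩
      rw [hbot, Submodule.mem_bot] at hv
      simp only [hv, Pi.zero_apply, norm_zero]; positivity
    obtain ⟨v, hvV, hv0⟩ := Submodule.exists_mem_ne_zero_of_ne_bot hbot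
    obtain ⟨j, hj⟩ := Function.ne_iff.1 hv0
    obtain ⟨i₀, -, hi₀⟩ := Finset.exists_max_image Finset.univ (fun i => ‖v i‖) ⟨j, Finset.mem_univ j⟩
    have hvi₀ : v i₀ ≠ 0 := by
      intro h
      have := hi₀ j (Finset.mem_univ j)
      rw [h, norm_zero] at this
      exact hj (norm_le_zero_iff.1 this)
    -- The largest coordinate of one vector of `V` is used to eliminate this vector.
    set V' := V ⊓ LinearMap.ker (LinearMap.proj (R := ℂ) (φ := fun _ : ι => ℂ) i₀) with hV'
    have hlt : V' < V := by
      refine lt_of_le_of_ne inf_le_left fun h => hvi₀ ?_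
      have := hvV
      rw [← h, hV', Submodule.mem_inf, LinearMap.mem_ker] at this
      exact this.2
    have hfin := Submodule.finrank_lt_finrank_of_lt hlt
    obtain ⟨I, hI, hctl⟩ := ih V' (by omega)
    refine ⟨insert i₀ I, (Finset.card_insert_le _ _).trans (by omega), fun δ hδ x hx hxI i => ?_⟩
    set y := x - (x i₀ / v i₀) • v with hy
    have hyV : y ∈ V' := by
      rw [hV', Submodule.mem_inf, LinearMap.mem_ker]
      refine ⟨V.sub_mem hx (V.smul_mem _ hvV), ?_⟩
      simp [hy, hvi₀]
    have hcoef : ∀ i, ‖((x i₀ / v i₀) • v) i‖ ≤ δ := by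
      intro i
      have h1 := hi₀ i (Finset.mem_univ i)
      have h2 := hxI i₀ (Finset.mem_insert_self _ _)
      rw [Pi.smul_apply, smul_eq_mul, norm_mul, norm_div, div_mul_eq_mul_div, mul_div_assoc]
      refine (mul_le_of_le_one_right (norm_nonneg _) ?_).trans h2
      exact div_le_one_of_le₀ h1 (norm_nonneg _)
    have h3 := hctl (2 * δ) (by positivity) y hyV (fun i hi => by
      have h1 := hxI i (Finset.mem_insert_of_mem hi)
      have h2 := norm_sub_le (x i) (((x i₀ / v i₀) • v) i)
      change ‖x i - ((x i₀ / v i₀) • v) i‖ ≤ _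
      linarith [hcoef i]) i
    have h4 : x i = y i + ((x i₀ / v i₀) • v) i := by simp [hy]
    rw [h4]
    refine (norm_add_le _ _).trans ((add_le_add h3 (hcoef i)).trans ?_)
    have h5 : (1 : ℝ) ≤ 3 ^ d := one_le_pow₀ (by norm_num)
    rw [pow_succ]
    nlinarith

/-- The cell of side `δ` of the complex plane containing `w`. -/
noncomputable def cell (δ : ℝ) (w : ℂ) : ℤ × ℤ := (⌊w.re / δ⌋, ⌊w.im / δ⌋)

/-- The cells that meet the disc of radius `β`. -/
noncomputable def cells (δ β : ℝ) : Finset (ℤ × ℤ) :=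
  Finset.Icc (-⌈β / δ⌉) ⌈β / δ⌉ ×ˢ Finset.Icc (-⌈β / δ⌉) ⌈β / δ⌉

theorem cell_mem_cells {δ β : ℝ} (hδ : 0 < δ) {w : ℂ} (hw : ‖w‖ ≤ β) : cell δ w ∈ cells δ β := by
  have key : ∀ x : ℝ, |x| ≤ β → ⌊x / δ⌋ ∈ Finset.Icc (-⌈β / δ⌉) ⌈β / δ⌉ := by
    intro x hx
    obtain ⟨h1, h2⟩ := abs_le.1 hx
    rw [Finset.mem_Icc]
    constructor
    · rw [Int.le_floor]
      push_cast
      have := Int.le_ceil (β / δ)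
      have h3 : -(β / δ) ≤ x / δ := by rw [← neg_div]; gcongr
      linarith
    · have h3 : x / δ ≤ β / δ := by gcongr
      exact_mod_cast (Int.floor_le (x / δ)).trans (h3.trans (Int.le_ceil _))
  rw [cell, cells, Finset.mem_product]
  exact ⟨key _ ((Complex.abs_re_le_norm w).trans hw), key _ ((Complex.abs_im_le_norm w).trans hw)⟩

theorem card_cells_le {δ β : ℝ} (hδ : 0 < δ) (hβ : 0 ≤ β) :
    ((cells δ β).card : ℝ) ≤ (2 * (β / δ) + 3) ^ 2 := by
  have h0 : 0 ≤ ⌈β / δ⌉ := Int.ceil_nonneg (by positivity)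
  have h1 := Int.ceil_lt_add_one (β / δ)
  have h2 : ((Finset.Icc (-⌈β / δ⌉) ⌈β / δ⌉).card : ℝ) ≤ 2 * (β / δ) + 3 := by
    rw [Int.card_Icc]
    have : (((⌈β / δ⌉ + 1 - -⌈β / δ⌉).toNat : ℤ) : ℝ) = 2 * ⌈β / δ⌉ + 1 := by
      rw [Int.toNat_of_nonneg (by omega)]
      push_cast; ring
    rw [Int.cast_natCast] at this
    rw [this]
    linarith
  rw [cells, Finset.card_product, Nat.cast_mul, ← sq]
  exact pow_le_pow_left₀ (Nat.cast_nonneg _) h2 2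

theorem norm_sub_le_of_cell_eq {δ : ℝ} (hδ : 0 < δ) {w w' : ℂ} (h : cell δ w = cell δ w') :
    ‖w - w'‖ ≤ 2 * δ := by
  have key : ∀ x y : ℝ, ⌊x / δ⌋ = ⌊y / δ⌋ → |x - y| ≤ δ := by
    intro x y hxy
    have h1 := (Int.abs_sub_lt_one_of_floor_eq_floor hxy).le
    rw [← sub_div, abs_div, abs_of_pos hδ, div_le_one hδ] at h1
    exact h1
  simp only [cell, Prod.mk.injEq] at h
  have h1 := key _ _ h.1
  have h2 := key _ _ h.2
  have h3 := Complex.norm_le_abs_re_add_abs_im (w - w')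
  rw [Complex.sub_re, Complex.sub_im] at h3
  linarith

theorem eq_of_mem_constellation {η : ℝ} {s s' : ℂ} (hs : s ∈ constellation η)
    (hs' : s' ∈ constellation η) (h : ‖s - s'‖ < 1) : s = s' := by
  obtain ⟨a, b, -, -, rfl⟩ := mem_constellation.1 hs
  obtain ⟨c, d, -, -, rfl⟩ := mem_constellation.1 hs'
  have h1 := (Complex.abs_re_le_norm _).trans_lt h
  have h2 := (Complex.abs_im_le_norm _).trans_lt h
  simp at h1 h2
  have h1' : |a - c| < 1 := by exact_mod_cast h1
  have h2' : |b - d| < 1 := by exact_mod_cast h2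
  rw [Int.abs_lt_one_iff] at h1' h2'
  rw [sub_eq_zero.1 h1', sub_eq_zero.1 h2']

theorem norm_le_of_mem_constellation {η : ℝ} {s : ℂ} (hs : s ∈ constellation η) :
    ‖s‖ ≤ 2 * η := by
  obtain ⟨a, b, ha, hb, rfl⟩ := mem_constellation.1 hs
  have h3 := Complex.norm_le_abs_re_add_abs_im ((a : ℂ) + (b : ℂ) * Complex.I)
  simp at h3
  linarith

/-- The number of symbol vectors whose differences have extensions with small values of the forms
`Z j`, `j ∈ J`. Each form in `J` contributes its number of cells, each other form at most the
number of cells of the constellation. -/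
theorem card_le_prod_cells {P : Type*} [Fintype P] [DecidableEq P] {κ k : ℕ}
    (hP : Fintype.card P = κ) (Z : (Fin κ → ℂ) →ₗ[ℂ] (P → ℂ)) {K : ℝ} (hK : 0 ≤ K)
    (hZ : ∀ x : Fin κ → ℂ, ∀ δ : ℝ, 0 ≤ δ → (∀ j, ‖Z x j‖ ≤ δ) → ∀ i, ‖x i‖ ≤ K * δ)
    (φ : Fin k → Fin κ) (J : Finset P) (β : P → ℝ) {η : ℝ} (hη : 0 ≤ η)
    (S : Finset (Fin k → ℂ)) (hS : S ⊆ symbolVectors k η)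
    (hext : ∀ s ∈ S, ∀ s' ∈ S, ∃ x : Fin κ → ℂ, (∀ i, x (φ i) = s i - s' i) ∧
      ∀ j ∈ J, ‖Z x j‖ ≤ β j)
    {δ : ℝ} (hδ : 0 < δ) (hδ1 : 2 * (3 ^ κ * (1 + K) + K) * δ < 1) :
    (S.card : ℝ) ≤ (∏ j ∈ J, (2 * (β j / δ) + 3) ^ 2) *
      ((2 * (2 * η / δ) + 3) ^ 2) ^ (Fintype.card P - J.card) := by
  have h3κ : (1 : ℝ) ≤ 3 ^ κ := one_le_pow₀ (by norm_num)
  have hcellη : (1 : ℝ) ≤ (2 * (2 * η / δ) + 3) ^ 2 := by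
    have : 0 ≤ 2 * η / δ := by positivity
    nlinarith
  rcases S.eq_empty_or_nonempty with rfl | ⟨s₀, hs₀⟩
  · simp only [Finset.card_empty, Nat.cast_zero]
    refine mul_nonneg (Finset.prod_nonneg fun _ _ => sq_nonneg _) ?_
    positivity
  have hβ : ∀ j ∈ J, 0 ≤ β j := fun j hj => by
    obtain ⟨x, -, hx⟩ := hext s₀ hs₀ s₀ hs₀
    exact (norm_nonneg _).trans (hx j hj)
  choose! X hX1 hX2 using fun s hs => hext s hs s₀ hs₀
  have hinj : Function.Injective Z := by
    rw [← LinearMap.ker_eq_bot, LinearMap.ker_eq_bot']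
    intro x hx
    funext i
    have := hZ x 0 le_rfl (fun j => by simp [hx]) i
    rw [mul_zero] at this
    exact norm_le_zero_iff.1 this
  have hsurj : Function.Surjective Z :=
    (LinearMap.injective_iff_surjective_of_finrank_eq_finrank (by simp [hP])).1 hinj
  -- The subspace on which the forms in `J` vanish, and its projection to the coordinates `φ`.
  set W : Submodule ℂ (Fin κ → ℂ) :=
    LinearMap.ker ((LinearMap.funLeft ℂ ℂ (fun j : J => (j : P))).comp Z) with hW
  have hWfin : Module.finrank ℂ W ≤ Fintype.card P - J.card := by
    set T : W →ₗ[ℂ] ({j // j ∉ J} → ℂ) :=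
      ((LinearMap.funLeft ℂ ℂ (fun j : {j // j ∉ J} => (j : P))).comp Z).comp W.subtype with hT
    have hTinj : Function.Injective T := by
      rw [← LinearMap.ker_eq_bot, LinearMap.ker_eq_bot']
      rintro ⟨x, hx⟩ hTx
      apply Subtype.ext
      apply hinj
      rw [Submodule.coe_zero, map_zero]
      funext j
      by_cases hj : j ∈ J
      · rw [hW, LinearMap.mem_ker] at hx
        exact congrFun hx ⟨j, hj⟩
      · exact congrFun hTx ⟨j, hj⟩
    have := LinearMap.finrank_le_finrank_of_injective hTinj
    rw [Module.finrank_fintype_fun_eq_card, Fintype.card_subtype_compl, Fintype.card_coe] at this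
    exact this
  set V := W.map (LinearMap.funLeft ℂ ℂ φ) with hV
  have hVfin : Module.finrank ℂ V ≤ Fintype.card P - J.card :=
    (Submodule.finrank_map_le _ _).trans hWfin
  obtain ⟨I, hI, hctl⟩ := exists_controlling_coordinates _ V hVfin
  set code : (Fin k → ℂ) → (J → ℤ × ℤ) × (I → ℤ × ℤ) :=
    fun s => (fun j => cell δ (Z (X s) j), fun i => cell δ (s i)) with hcode
  have hmaps : Set.MapsTo code S
      ((Fintype.piFinset fun j : J => cells δ (β j)) ×ˢ
        (Fintype.piFinset fun _ : I => cells δ (2 * η)) : Finset _) := by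
    intro s hs
    rw [Finset.mem_coe, Finset.mem_product, Fintype.mem_piFinset, Fintype.mem_piFinset]
    refine ⟨fun j => cell_mem_cells hδ (hX2 s hs j j.2), fun i => cell_mem_cells hδ ?_⟩
    exact norm_le_of_mem_constellation (Fintype.mem_piFinset.1 (hS hs) i)
  have hcinj : Set.InjOn code S := by
    intro s hs s' hs' hss
    simp only [hcode, Prod.mk.injEq] at hss
    obtain ⟨hJ, hI'⟩ := hss
    obtain ⟨y, hy⟩ := hsurj fun j => if j ∈ J then Z (X s - X s') j else 0
    have hyle : ∀ i, ‖y i‖ ≤ K * (2 * δ) := by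
      refine hZ y (2 * δ) (by positivity) fun j => ?_
      rw [hy]
      dsimp only
      split_ifs with hj
      · rw [map_sub, Pi.sub_apply]
        exact norm_sub_le_of_cell_eq hδ (congrFun hJ ⟨j, hj⟩)
      · rw [norm_zero]; positivity
    set v : Fin k → ℂ := LinearMap.funLeft ℂ ℂ φ (X s - X s' - y) with hv
    have hvV : v ∈ V := by
      refine Submodule.mem_map_of_mem ?_
      rw [hW, LinearMap.mem_ker]
      funext j
      simp only [LinearMap.comp_apply, LinearMap.funLeft_apply, map_sub, Pi.sub_apply, hy, j.2,
        if_true, Pi.zero_apply, sub_self]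
    have hvi : ∀ i, v i = (s i - s' i) - y (φ i) := by
      intro i
      simp only [hv, LinearMap.funLeft_apply, Pi.sub_apply, hX1 s hs, hX1 s' hs']
      ring
    have hvle := hctl (2 * δ + K * (2 * δ)) (by positivity) v hvV fun i hi => by
      rw [hvi]
      refine (norm_sub_le _ _).trans (add_le_add ?_ (hyle _))
      exact norm_sub_le_of_cell_eq hδ (congrFun hI' ⟨i, hi⟩)
    funext i
    refine eq_of_mem_constellation (Fintype.mem_piFinset.1 (hS hs) i)
      (Fintype.mem_piFinset.1 (hS hs') i) ?_
    have e : s i - s' i = v i + y (φ i) := by rw [hvi]; ring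
    rw [e]
    refine (norm_add_le _ _).trans_lt ((add_le_add (hvle i) (hyle (φ i))).trans_lt ?_)
    have h3 : (3 : ℝ) ^ (Fintype.card P - J.card) ≤ 3 ^ κ :=
      pow_le_pow_right₀ (by norm_num) (by omega)
    have h4 := mul_le_mul_of_nonneg_right h3
      (by positivity : 0 ≤ 2 * δ + K * (2 * δ))
    calc _ ≤ 3 ^ κ * (2 * δ + K * (2 * δ)) + K * (2 * δ) := by linarith
      _ = 2 * (3 ^ κ * (1 + K) + K) * δ := by ring
      _ < 1 := hδ1
  have hcard := Finset.card_le_card_of_injOn code hmaps hcinj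
  have hcard' : (S.card : ℝ) ≤ (∏ j : J, ((cells δ (β j)).card : ℝ)) *
      ((cells δ (2 * η)).card : ℝ) ^ I.card := by
    have : (S.card : ℝ) ≤ _ := Nat.cast_le.2 hcard
    simpa [Finset.card_product, Fintype.card_piFinset] using this
  refine hcard'.trans ?_
  rw [Finset.prod_coe_sort J (fun j => ((cells δ (β j)).card : ℝ))]
  refine mul_le_mul (Finset.prod_le_prod (fun _ _ => Nat.cast_nonneg _) fun j hj =>
    card_cells_le hδ (hβ j hj)) ?_ (by positivity) (Finset.prod_nonneg fun _ _ => sq_nonneg _)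
  calc ((cells δ (2 * η)).card : ℝ) ^ I.card ≤ ((2 * (2 * η / δ) + 3) ^ 2) ^ I.card :=
        pow_le_pow_left₀ (Nat.cast_nonneg _) (card_cells_le hδ (by positivity)) _
    _ ≤ _ := pow_le_pow_right₀ hcellη hI

/-! ### Squared norms and thin QR decompositions -/

section QR

variable {ι m : Type*} [Fintype ι] [Fintype m] {κ k : ℕ}

theorem normSq_nonneg (v : ι → ℂ) : 0 ≤ normSq v :=
  Finset.sum_nonneg fun _ _ => by positivity

theorem norm_sq_le_normSq (v : ι → ℂ) (i : ι) : ‖v i‖ ^ 2 ≤ normSq v :=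
  Finset.single_le_sum (f := fun i => ‖v i‖ ^ 2) (fun _ _ => by positivity) (Finset.mem_univ i)

theorem normSq_le_of_norm_le {v : ι → ℂ} {M : ℝ} (h : ∀ i, ‖v i‖ ≤ M) :
    normSq v ≤ Fintype.card ι * M ^ 2 := by
  refine (Finset.sum_le_card_nsmul _ _ (M ^ 2) fun i _ =>
    pow_le_pow_left₀ (norm_nonneg _) (h i) 2).trans ?_
  rw [nsmul_eq_mul, Finset.card_univ]

theorem normSq_add_le (v w : ι → ℂ) : normSq (v + w) ≤ 2 * normSq v + 2 * normSq w := by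
  simp only [normSq, Finset.mul_sum, ← Finset.sum_add_distrib]
  refine Finset.sum_le_sum fun i _ => ?_
  have h := norm_add_le (v i) (w i)
  have h' : ‖(v + w) i‖ ^ 2 ≤ (‖v i‖ + ‖w i‖) ^ 2 := pow_le_pow_left₀ (norm_nonneg _) h 2
  nlinarith [sq_nonneg (‖v i‖ - ‖w i‖)]

theorem normSq_neg (v : ι → ℂ) : normSq (-v) = normSq v := by
  simp [normSq]

theorem normSq_sub_le (v w : ι → ℂ) : normSq (v - w) ≤ 2 * normSq v + 2 * normSq w := by
  rw [sub_eq_add_neg, ← normSq_neg w]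
  exact normSq_add_le v (-w)

theorem normSq_smul (a : ℂ) (v : ι → ℂ) : normSq (a • v) = ‖a‖ ^ 2 * normSq v := by
  simp [normSq, Finset.mul_sum, mul_pow]

theorem ofReal_normSq (v : ι → ℂ) : ((normSq v : ℝ) : ℂ) = star v ⬝ᵥ v := by
  simp only [normSq, dotProduct, Complex.ofReal_sum, Pi.star_apply, RCLike.star_def]
  refine Finset.sum_congr rfl fun i _ => ?_
  rw [Complex.conj_mul']
  push_cast; rfl

theorem normSq_mulVec_of_unitary {Q : Matrix m (Fin κ) ℂ} (hQ : Qᴴ * Q = 1) (x : Fin κ → ℂ) :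
    normSq (Q *ᵥ x) = normSq x := by
  have : ((normSq (Q *ᵥ x) : ℝ) : ℂ) = (normSq x : ℝ) := by
    rw [ofReal_normSq, ofReal_normSq, Matrix.star_mulVec, Matrix.dotProduct_mulVec,
      Matrix.vecMul_vecMul, hQ, Matrix.vecMul_one]
  exact_mod_cast this

theorem normSq_conjTranspose_mulVec_le {Q : Matrix m (Fin κ) ℂ} (hQ : Qᴴ * Q = 1) (w : m → ℂ) :
    normSq (Qᴴ *ᵥ w) ≤ normSq w := by
  set u := Qᴴ *ᵥ w with hu
  have h1 : star (Q *ᵥ u) ⬝ᵥ (Q *ᵥ u) = star u ⬝ᵥ u := by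
    rw [← ofReal_normSq, ← ofReal_normSq, normSq_mulVec_of_unitary hQ]
  have h2 : star (Q *ᵥ u) ⬝ᵥ w = star u ⬝ᵥ u := by
    rw [Matrix.star_mulVec, ← Matrix.dotProduct_mulVec, ← hu]
  have h3 : star w ⬝ᵥ (Q *ᵥ u) = star u ⬝ᵥ u := by
    rw [Matrix.dotProduct_mulVec]
    congr 1
    rw [hu, Matrix.star_mulVec, Matrix.conjTranspose_conjTranspose]
  have h4 : ((normSq (w - Q *ᵥ u) : ℝ) : ℂ) = ((normSq w - normSq u : ℝ) : ℂ) := by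
    rw [ofReal_normSq, star_sub, sub_dotProduct, dotProduct_sub, dotProduct_sub, h1, h2, h3]
    push_cast
    rw [ofReal_normSq, ofReal_normSq]
    ring
  have h5 : normSq (w - Q *ᵥ u) = normSq w - normSq u := by exact_mod_cast h4
  have := normSq_nonneg (w - Q *ᵥ u)
  linarith

theorem lastIdx_injective (hk : k ≤ κ) : Function.Injective (lastIdx hk) := by
  intro i j h
  simp only [lastIdx, Fin.mk.injEq] at h
  exact Fin.ext (by omega)

theorem normSq_comp_lastIdx_le (hk : k ≤ κ) (v : Fin κ → ℂ) :
    normSq (v ∘ lastIdx hk) ≤ normSq v := by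
  simp only [normSq, Function.comp_apply]
  rw [← Finset.sum_image (s := Finset.univ) (g := lastIdx hk) (f := fun i => ‖v i‖ ^ 2)
    fun i _ j _ h => lastIdx_injective hk h]
  exact Finset.sum_le_sum_of_subset_of_nonneg (Finset.subset_univ _) fun _ _ _ => by positivity

variable {A Q : Matrix m (Fin κ) ℂ} {R : Matrix (Fin κ) (Fin κ) ℂ}

theorem IsThinQR.normSq_mulVec (h : IsThinQR A Q R) (x : Fin κ → ℂ) :
    normSq (A *ᵥ x) = normSq (R *ᵥ x) := by
  rw [← h.mul_eq, ← Matrix.mulVec_mulVec, normSq_mulVec_of_unitary h.unitary]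

theorem IsThinQR.mulVec_comp_lastIdx (h : IsThinQR A Q R) (hk : k ≤ κ) (x : Fin κ → ℂ) :
    (R *ᵥ x) ∘ lastIdx hk =
      R.submatrix (lastIdx hk) (lastIdx hk) *ᵥ (x ∘ lastIdx hk) := by
  funext i
  simp only [Function.comp_apply, Matrix.mulVec, dotProduct, Matrix.submatrix_apply]
  rw [← Finset.sum_image (s := Finset.univ) (g := lastIdx hk)
    (f := fun j => R (lastIdx hk i) j * x j) fun i _ j _ h => lastIdx_injective hk h]
  symm
  refine Finset.sum_subset (Finset.subset_univ _) fun j _ hj => ?_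
  rw [h.upper, zero_mul]
  by_contra hlt
  simp only [Fin.lt_def, lastIdx, not_lt] at hlt
  refine hj (Finset.mem_image.2 ⟨⟨j - (κ - k), ?_⟩, Finset.mem_univ _, ?_⟩)
  · have := j.2; omega
  · exact Fin.ext (by simp [lastIdx]; omega)

/-- The lower right corner of `R` measures at most the distance to the span of the first columns. -/
theorem IsThinQR.normSq_corner_le (h : IsThinQR A Q R) (hk : k ≤ κ) (x : Fin κ → ℂ) :
    normSq (R.submatrix (lastIdx hk) (lastIdx hk) *ᵥ (x ∘ lastIdx hk)) ≤ normSq (A *ᵥ x) := by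
  rw [← h.mulVec_comp_lastIdx, h.normSq_mulVec]
  exact normSq_comp_lastIdx_le hk _

/-- For a full rank matrix, the lower right corner of `R` measures the distance to the span of the
first columns: every vector of last components can be completed with equality. -/
theorem IsThinQR.exists_extension (h : IsThinQR A Q R) (hA : Function.Injective A.mulVec)
    (hk : k ≤ κ) (d : Fin k → ℂ) : ∃ x : Fin κ → ℂ, (∀ i, x (lastIdx hk i) = d i) ∧
      normSq (A *ᵥ x) = normSq (R.submatrix (lastIdx hk) (lastIdx hk) *ᵥ d) := by
  have hR : Function.Injective R.mulVec := by
    intro x y hxy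
    apply hA
    simp only [← h.mul_eq, ← Matrix.mulVec_mulVec]
    exact congrArg _ hxy
  have hRu : IsUnit R := Matrix.mulVec_injective_iff_isUnit.1 hR
  have hRdet : R.det ≠ 0 := ((Matrix.isUnit_iff_isUnit_det R).1 hRu).ne_zero
  rw [Matrix.det_of_isUpperTriangular (fun i j hij => h.upper i j hij), Finset.prod_ne_zero_iff]
    at hRdet
  set B := R.submatrix (lastIdx hk) (lastIdx hk) with hB
  have hBu : IsUnit B := by
    rw [Matrix.isUnit_iff_isUnit_det, isUnit_iff_ne_zero, Matrix.det_of_isUpperTriangular,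
      Finset.prod_ne_zero_iff]
    · exact fun i _ => hRdet _ (Finset.mem_univ _)
    · intro i j hij
      refine h.upper _ _ ?_
      simp only [id, Fin.lt_def, lastIdx] at hij ⊢
      omega
  have hBinj : Function.Injective B.mulVec := Matrix.mulVec_injective_iff_isUnit.2 hBu
  set v : Fin κ → ℂ := fun i =>
    if hi : κ - k ≤ i then (B *ᵥ d) ⟨i - (κ - k), by have := i.2; omega⟩ else 0 with hv
  obtain ⟨x, hx⟩ := Matrix.mulVec_surjective_iff_isUnit.2 hRu v
  have hx : R *ᵥ x = v := hx
  have hvl : v ∘ lastIdx hk = B *ᵥ d := by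
    funext i
    simp only [hv, lastIdx, Function.comp_apply, Nat.le_add_right, dif_pos, Nat.add_sub_cancel_left]
  have hxd : x ∘ lastIdx hk = d := by
    apply hBinj
    rw [hB, ← h.mulVec_comp_lastIdx, hx, hvl]
  refine ⟨x, fun i => congrFun hxd i, ?_⟩
  rw [h.normSq_mulVec, hx, ← hvl]
  simp only [normSq, Function.comp_apply]
  rw [← Finset.sum_image (s := Finset.univ) (g := lastIdx hk)
    (f := fun j => ‖v j‖ ^ 2) fun i _ j _ h => lastIdx_injective hk h]
  symm
  refine Finset.sum_subset (Finset.subset_univ _) fun j _ hj => ?_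
  have : ¬ κ - k ≤ j := by
    intro hle
    refine hj (Finset.mem_image.2 ⟨⟨j - (κ - k), ?_⟩, Finset.mem_univ _, ?_⟩)
    · have := j.2; omega
    · exact Fin.ext (by simp [lastIdx]; omega)
  rw [hv]
  dsimp only
  rw [dif_neg this, norm_zero]
  simp

end QR

/-! ### The threaded code -/

section Code

variable {n nr : ℕ} {C : Fin n → Matrix (Fin n) (Fin n) ℂ} {e : Fin (n * n) ≃ Fin n × Fin n}

/-- The coded symbols of thread `l` are found at the positions `(j - l, j)` of the codeword. -/
theorem orderedThreadedGenerator_mulVec (hn : 1 ≤ n) (C : Fin n → Matrix (Fin n) (Fin n) ℂ)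
    (e : Fin (n * n) ≃ Fin n × Fin n) (x : Fin (n * n) → ℂ) (j l : Fin n) :
    (orderedThreadedGenerator C e *ᵥ x) (j - l, j) =
      (C l *ᵥ fun i => x (e.symm (l, i))) j := by
  have : NeZero n := ⟨by omega⟩
  simp only [orderedThreadedGenerator, Matrix.mulVec, dotProduct, Matrix.submatrix_apply, id,
    threadedGenerator, Matrix.of_apply, sub_right_inj]
  rw [← Equiv.sum_comp e.symm, Fintype.sum_prod_type, Finset.sum_eq_single l]
  · simp
  · intro l' _ hl'
    refine Finset.sum_eq_zero fun i _ => ?_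
    simp [hl'.symm]
  · simp

/-- The code map has a bounded inverse. -/
theorem exists_bound_of_generator (hn : 1 ≤ n) (hC : ∀ l, IsUnit (C l).det)
    (e : Fin (n * n) ≃ Fin n × Fin n) : ∃ K : ℝ, 1 ≤ K ∧ ∀ (x : Fin (n * n) → ℂ) (M : ℝ), 0 ≤ M →
      (∀ p, ‖(orderedThreadedGenerator C e *ᵥ x) p‖ ≤ M) → ∀ i, ‖x i‖ ≤ K * M := by
  have hs : 0 ≤ ∑ l, ∑ i, ∑ j, ‖(C l)⁻¹ i j‖ :=
    Finset.sum_nonneg fun l _ => Finset.sum_nonneg fun i _ => Finset.sum_nonneg fun j _ =>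
      norm_nonneg _
  refine ⟨1 + ∑ l, ∑ i, ∑ j, ‖(C l)⁻¹ i j‖, by linarith, fun x M hM h q => ?_⟩
  obtain ⟨⟨l, i⟩, rfl⟩ := e.symm.surjective q
  have h1 : x (e.symm (l, i)) = ((C l)⁻¹ *ᵥ (C l *ᵥ fun i => x (e.symm (l, i)))) i := by
    rw [Matrix.mulVec_mulVec, Matrix.nonsing_inv_mul _ (hC l), Matrix.one_mulVec]
  rw [h1, Matrix.mulVec, dotProduct]
  refine (norm_sum_le _ _).trans ?_
  have h2 : ∀ j ∈ Finset.univ, ‖(C l)⁻¹ i j * (C l *ᵥ fun i => x (e.symm (l, i))) j‖ ≤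
      ‖(C l)⁻¹ i j‖ * M := by
    intro j _
    rw [norm_mul, ← orderedThreadedGenerator_mulVec hn C e x j l]
    exact mul_le_mul_of_nonneg_left (h _) (norm_nonneg _)
  refine (Finset.sum_le_sum h2).trans ?_
  rw [← Finset.sum_mul]
  refine mul_le_mul_of_nonneg_right ?_ hM
  have h3 : ∑ j, ‖(C l)⁻¹ i j‖ ≤ ∑ i, ∑ j, ‖(C l)⁻¹ i j‖ :=
    Finset.single_le_sum (f := fun i => ∑ j, ‖(C l)⁻¹ i j‖)
      (fun i _ => Finset.sum_nonneg fun j _ => norm_nonneg _) (Finset.mem_univ i)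
  have h4 : ∑ i, ∑ j, ‖(C l)⁻¹ i j‖ ≤ ∑ l, ∑ i, ∑ j, ‖(C l)⁻¹ i j‖ :=
    Finset.single_le_sum (f := fun l => ∑ i, ∑ j, ‖(C l)⁻¹ i j‖)
      (fun l _ => Finset.sum_nonneg fun i _ => Finset.sum_nonneg fun j _ => norm_nonneg _)
      (Finset.mem_univ l)
  linarith

theorem codeChannel_mulVec {κ T nt : ℕ} (G : Matrix (Fin T × Fin nt) (Fin κ) ℂ) (θ : ℝ)
    (H : Fin nr → Fin nt → ℂ) (x : Fin κ → ℂ) (c : Fin T) (i : Fin nr) :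
    (codeChannel G θ H *ᵥ x) (c, i) = θ * ∑ j, H i j * (G *ᵥ x) (c, j) := by
  rw [codeChannel, Matrix.smul_mulVec, Pi.smul_apply, smul_eq_mul, ← Matrix.mulVec_mulVec,
    Matrix.mulVec, dotProduct, Fintype.sum_prod_type, Finset.sum_eq_single c]
  · simp [Matrix.kroneckerMap_apply]
  · intro c' _ hc'
    simp [Matrix.kroneckerMap_apply, hc'.symm]
  · simp

end Code

/-! ### Size and power of the constellation -/

/-- The number of points on a side of the constellation. -/
noncomputable def side (η : ℝ) : ℝ := 2 * ⌊η⌋ + 1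

theorem constellation_injective :
    Function.Injective fun p : ℤ × ℤ => (p.1 : ℂ) + (p.2 : ℂ) * Complex.I := by
  intro p q h
  have h1 := congrArg Complex.re h
  have h2 := congrArg Complex.im h
  simp at h1 h2
  exact Prod.ext h1 h2

theorem card_constellation {η : ℝ} (hη : 0 < η) : ((constellation η).card : ℝ) = side η ^ 2 := by
  have h0 : 0 ≤ ⌊η⌋ := Int.floor_nonneg.2 hη.le
  have h1 : ((Finset.Icc (-⌊η⌋) ⌊η⌋).card : ℝ) = side η := by
    rw [Int.card_Icc, side]
    have : (((⌊η⌋ + 1 - -⌊η⌋).toNat : ℤ) : ℝ) = 2 * ⌊η⌋ + 1 := by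
      rw [Int.toNat_of_nonneg (by omega)]
      push_cast; ring
    rwa [Int.cast_natCast] at this
  rw [constellation, Finset.card_image_of_injective _ constellation_injective, Finset.card_product,
    Nat.cast_mul, h1, sq]

theorem sum_sq_Icc (m : ℕ) : ∑ a ∈ Finset.Icc (-(m : ℤ)) m, (a : ℝ) ^ 2 =
    m * (m + 1) * (2 * m + 1) / 3 := by
  induction m with
  | zero => simp
  | succ m ih =>
    have e : Finset.Icc (-((m + 1 : ℕ) : ℤ)) ((m + 1 : ℕ) : ℤ) =
        insert (-((m + 1 : ℕ) : ℤ)) (insert ((m + 1 : ℕ) : ℤ) (Finset.Icc (-(m : ℤ)) m)) := by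
      ext a
      simp only [Finset.mem_Icc, Finset.mem_insert]
      omega
    rw [e, Finset.sum_insert, Finset.sum_insert, ih]
    · push_cast; ring
    · simp
    · simp only [Finset.mem_insert, Finset.mem_Icc]; omega

/-- The average energy of the constellation is `2 m (m + 1) / 3` for `m = ⌊η⌋`, which is at least
`(2 m + 1) ^ 2 / 7` for `m ≥ 1`. -/
theorem sum_norm_sq_constellation {η : ℝ} (hη : 1 ≤ ⌊η⌋) :
    side η ^ 2 / 7 * ((constellation η).card : ℝ) ≤ ∑ s ∈ constellation η, ‖s‖ ^ 2 := by
  have hη0 : 0 < η := by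
    have : (1 : ℝ) ≤ ⌊η⌋ := by exact_mod_cast hη
    linarith [Int.floor_le η]
  obtain ⟨m, hm⟩ := Int.eq_ofNat_of_zero_le (by omega : 0 ≤ ⌊η⌋)
  have hm1 : (1 : ℝ) ≤ m := by
    have : (1 : ℤ) ≤ m := by omega
    exact_mod_cast this
  have hside : side η = 2 * m + 1 := by rw [side, hm]; simp
  rw [card_constellation hη0, constellation, Finset.sum_image constellation_injective.injOn,
    Finset.sum_product, hm, hside]
  have hn : ∀ a b : ℤ, ‖(a : ℂ) + (b : ℂ) * Complex.I‖ ^ 2 = (a : ℝ) ^ 2 + (b : ℝ) ^ 2 := by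
    intro a b
    rw [Complex.sq_norm, Complex.normSq_apply]
    simp
    ring
  have hc : ((Finset.Icc (-(m : ℤ)) m).card : ℝ) = 2 * m + 1 := by
    rw [Int.card_Icc]
    have : (((m : ℤ) + 1 - -(m : ℤ)).toNat : ℤ) = 2 * m + 1 := by omega
    exact_mod_cast this
  simp only [hn, Finset.sum_add_distrib, Finset.sum_const, nsmul_eq_mul]
  rw [← Finset.mul_sum, sum_sq_Icc, hc]
  have h2 : 0 ≤ ((m : ℝ) - 1) * (m + 2) := mul_nonneg (by linarith) (by linarith)
  have h3 : 0 ≤ (2 * (m : ℝ) + 1) ^ 2 := sq_nonneg _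
  nlinarith [mul_nonneg h2 h3]

theorem constellation_floor (η : ℝ) : constellation (⌊η⌋ : ℝ) = constellation η := by
  simp [constellation]

theorem lt_side {η : ℝ} : η < side η ∨ η < 0 := by
  by_cases h : η < 0
  · exact Or.inr h
  · left
    have h1 := Int.lt_floor_add_one η
    have h2 : (0 : ℝ) ≤ ⌊η⌋ := by exact_mod_cast Int.floor_nonneg.2 (not_lt.1 h)
    rw [side]; linarith

theorem card_symbolVectors {η : ℝ} (hη : 0 < η) (k : ℕ) :
    ((symbolVectors k η).card : ℝ) = (side η ^ 2) ^ k := by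
  rw [symbolVectors, Fintype.card_piFinset_const, Nat.cast_pow, card_constellation hη]

variable {n : ℕ} {C : Fin n → Matrix (Fin n) (Fin n) ℂ} {e : Fin (n * n) ≃ Fin n × Fin n}

theorem generator_mulVec_injective (hn : 1 ≤ n) (hC : ∀ l, IsUnit (C l).det) :
    Function.Injective (orderedThreadedGenerator C e).mulVec := by
  obtain ⟨K, -, hK⟩ := exists_bound_of_generator hn hC e
  intro x y hxy
  have h : orderedThreadedGenerator C e *ᵥ (x - y) = 0 := by
    rw [Matrix.mulVec_sub]; exact sub_eq_zero.2 hxy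
  funext i
  have := hK (x - y) 0 le_rfl (fun p => by simp [h]) i
  rw [mul_zero] at this
  exact sub_eq_zero.1 (norm_le_zero_iff.1 this)

theorem exists_norm_mulVec_le {ι κ : Type*} [Fintype ι] [Fintype κ] (G : Matrix ι κ ℂ) :
    ∃ K : ℝ, 0 < K ∧ ∀ (x : κ → ℂ) (M : ℝ), 0 ≤ M → (∀ i, ‖x i‖ ≤ M) → ∀ p, ‖(G *ᵥ x) p‖ ≤ K * M := by
  have hs : 0 ≤ ∑ p, ∑ i, ‖G p i‖ :=
    Finset.sum_nonneg fun p _ => Finset.sum_nonneg fun i _ => norm_nonneg _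
  refine ⟨1 + ∑ p, ∑ i, ‖G p i‖, by linarith, fun x M hM hx p => ?_⟩
  rw [Matrix.mulVec, dotProduct]
  refine (norm_sum_le _ _).trans ((Finset.sum_le_sum fun i _ => ?_ :
    _ ≤ ∑ i, ‖G p i‖ * M).trans ?_)
  · rw [norm_mul]; exact mul_le_mul_of_nonneg_left (hx i) (norm_nonneg _)
  · rw [← Finset.sum_mul]
    refine mul_le_mul_of_nonneg_right ?_ hM
    have : ∑ i, ‖G p i‖ ≤ ∑ p, ∑ i, ‖G p i‖ := Finset.single_le_sum (f := fun p => ∑ i, ‖G p i‖)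
      (fun p _ => Finset.sum_nonneg fun i _ => norm_nonneg _) (Finset.mem_univ p)
    linarith

/-- The power constraint pins the product of the power scaling and the constellation side. -/
theorem exists_power_bounds (hn : 1 ≤ n) (hC : ∀ l, IsUnit (C l).det)
    (e : Fin (n * n) ≃ Fin n × Fin n) : ∃ c K : ℝ, 0 < c ∧ 0 < K ∧ ∀ θ η ρ : ℝ, 0 < θ → 0 < η →
      0 < ρ → MeetsPowerConstraint (orderedThreadedGenerator C e) θ η ρ →
      1 ≤ ⌊η⌋ ∧ c * ρ ≤ (θ * side η) ^ 2 ∧ (θ * side η) ^ 2 ≤ K * ρ := by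
  set G := orderedThreadedGenerator C e with hG
  obtain ⟨K₁, hK₁1, hK₁⟩ := exists_bound_of_generator hn hC e
  rw [← hG] at hK₁
  obtain ⟨K₂, hK₂0, hK₂⟩ := exists_norm_mulVec_le G
  have hn0 : (0 : ℝ) < n := by exact_mod_cast hn
  set B : ℝ := Fintype.card (Fin n × Fin n) * (K₂ * 2) ^ 2 with hB
  have hB0 : 0 < B := by
    have : (0 : ℝ) < Fintype.card (Fin n × Fin n) := by simp; positivity
    positivity
  refine ⟨n / B, 7 * K₁ ^ 2 * n, by positivity, by positivity, fun θ η ρ hθ hη hρ hpow => ?_⟩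
  have hinj : Set.InjOn (fun s => (θ : ℂ) • (G *ᵥ s)) (symbolVectors (n * n) η) := by
    intro x _ y _ hxy
    have hθ' : (θ : ℂ) ≠ 0 := by exact_mod_cast hθ.ne'
    exact generator_mulVec_injective hn hC (smul_right_injective _ hθ' hxy)
  have hcard : ((symbolVectors (n * n) η).card : ℝ) = (side η ^ 2) ^ (n * n) := card_symbolVectors hη _
  have h0 : 0 ≤ ⌊η⌋ := Int.floor_nonneg.2 hη.le
  have h0' : (0 : ℝ) ≤ ⌊η⌋ := by exact_mod_cast h0
  have hs1 : 1 ≤ side η := by rw [side]; linarith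
  have hcard0 : (0 : ℝ) < (symbolVectors (n * n) η).card := by rw [hcard]; positivity
  rw [MeetsPowerConstraint, codebook, Finset.card_image_of_injOn hinj, Finset.sum_image hinj,
    one_div, inv_mul_eq_iff_eq_mul₀ hcard0.ne'] at hpow
  simp only [normSq_smul, ← Finset.mul_sum] at hpow
  have hθn : ‖(θ : ℂ)‖ = θ := by rw [Complex.norm_real]; exact abs_of_pos hθ
  rw [hθn] at hpow
  have hup : ∑ s ∈ symbolVectors (n * n) η, normSq (G *ᵥ s) ≤
      (symbolVectors (n * n) η).card * (B * (⌊η⌋ : ℝ) ^ 2) := by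
    refine (Finset.sum_le_card_nsmul _ _ (B * (⌊η⌋ : ℝ) ^ 2) fun s hs => ?_).trans
      (le_of_eq (nsmul_eq_mul _ _))
    have h1 := hK₂ s (2 * ⌊η⌋) (by positivity) fun i => by
      have := Fintype.mem_piFinset.1 hs i
      rw [← constellation_floor] at this
      exact norm_le_of_mem_constellation this
    refine (normSq_le_of_norm_le h1).trans (le_of_eq ?_)
    rw [hB]; ring
  have hfl : 1 ≤ ⌊η⌋ := by
    by_contra hlt
    have hz : ⌊η⌋ = 0 := by omega
    rw [hz] at hup
    simp only [Int.cast_zero, ne_eq, OfNat.ofNat_ne_zero, not_false_eq_true, zero_pow, mul_zero] at hup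
    have : 0 < (symbolVectors (n * n) η).card * (ρ * n) := by positivity
    rw [← hpow] at this
    nlinarith [sq_nonneg θ]
  refine ⟨hfl, ?_, ?_⟩
  · have h1 : (symbolVectors (n * n) η).card * (ρ * n) ≤
        (symbolVectors (n * n) η).card * (θ ^ 2 * (B * (⌊η⌋ : ℝ) ^ 2)) := by
      rw [← hpow]
      calc _ ≤ θ ^ 2 * ((symbolVectors (n * n) η).card * (B * (⌊η⌋ : ℝ) ^ 2)) :=
            mul_le_mul_of_nonneg_left hup (sq_nonneg _)
        _ = _ := by ring
    have h2 := le_of_mul_le_mul_left h1 hcard0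
    have h3 : (⌊η⌋ : ℝ) ^ 2 ≤ side η ^ 2 := pow_le_pow_left₀ h0' (by rw [side]; linarith) 2
    rw [div_mul_eq_mul_div, div_le_iff₀ hB0]
    calc n * ρ = ρ * n := mul_comm _ _
      _ ≤ _ := h2
      _ ≤ θ ^ 2 * (B * side η ^ 2) := by gcongr
      _ = _ := by ring
  · set i₀ : Fin (n * n) := ⟨0, by positivity⟩ with hi₀
    have hlow : ∀ s : Fin (n * n) → ℂ, ‖s i₀‖ ^ 2 ≤ K₁ ^ 2 * normSq (G *ᵥ s) := by
      intro s
      have h1 := hK₁ s (√(normSq (G *ᵥ s))) (Real.sqrt_nonneg _) (fun p => by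
        rw [Real.le_sqrt (norm_nonneg _) (normSq_nonneg _)]
        exact norm_sq_le_normSq _ p) i₀
      have h2 := pow_le_pow_left₀ (norm_nonneg _) h1 2
      rwa [mul_pow, Real.sq_sqrt (normSq_nonneg _)] at h2
    have hsum : ∑ s ∈ symbolVectors (n * n) η, ‖s i₀‖ ^ 2 =
        ((constellation η).card : ℝ) ^ (n * n - 1) * ∑ s ∈ constellation η, ‖s‖ ^ 2 := by
      have := Fintype.sum_piFinset_apply (ι := Fin (n * n)) (fun w : ℂ => ‖w‖ ^ 2)
        (constellation η) i₀
      rw [nsmul_eq_mul, Fintype.card_fin, Nat.cast_pow] at this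
      exact this
    have hcard' : ((symbolVectors (n * n) η).card : ℝ) =
        ((constellation η).card : ℝ) ^ (n * n - 1) * (constellation η).card := by
      rw [← pow_succ, Nat.sub_add_cancel (Nat.mul_pos hn hn), symbolVectors,
        Fintype.card_piFinset_const, Nat.cast_pow]
    have h1 : side η ^ 2 / 7 * (symbolVectors (n * n) η).card ≤
        K₁ ^ 2 * ∑ s ∈ symbolVectors (n * n) η, normSq (G *ᵥ s) := by
      rw [Finset.mul_sum]
      refine le_trans ?_ (Finset.sum_le_sum fun s _ => hlow s)
      rw [hsum, hcard', mul_left_comm]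
      exact mul_le_mul_of_nonneg_left (sum_norm_sq_constellation hfl) (by positivity)
    have h2 : (symbolVectors (n * n) η).card * (θ ^ 2 * (side η ^ 2 / 7)) ≤
        (symbolVectors (n * n) η).card * (K₁ ^ 2 * (ρ * n)) := by
      calc _ = θ ^ 2 * (side η ^ 2 / 7 * (symbolVectors (n * n) η).card) := by ring
        _ ≤ θ ^ 2 * (K₁ ^ 2 * ∑ s ∈ symbolVectors (n * n) η, normSq (G *ᵥ s)) := by gcongr
        _ = K₁ ^ 2 * (θ ^ 2 * ∑ s ∈ symbolVectors (n * n) η, normSq (G *ᵥ s)) := by ring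
        _ = K₁ ^ 2 * ((symbolVectors (n * n) η).card * (ρ * n)) := by rw [hpow]
        _ = _ := by ring
    have h3 := le_of_mul_le_mul_left h2 hcard0
    calc (θ * side η) ^ 2 = 7 * (θ ^ 2 * (side η ^ 2 / 7)) := by ring
      _ ≤ 7 * (K₁ ^ 2 * (ρ * n)) := by gcongr
      _ = _ := by ring

/-- The multiplexing gain fixes the growth of the constellation side. -/
theorem OperatesAt.eventually_side (hn : 1 ≤ n) (hC : ∀ l, IsUnit (C l).det) {θ η : ℝ → ℝ} {r : ℝ}
    (h : OperatesAt (orderedThreadedGenerator C e) θ η r) {ε : ℝ} (hε : 0 < ε) :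
    ∀ᶠ ρ in atTop, ρ ^ (r / (2 * n) - ε) ≤ side (η ρ) ∧ side (η ρ) ≤ ρ ^ (r / (2 * n) + ε) := by
  have hn0 : (0 : ℝ) < n := by exact_mod_cast hn
  have hlim : Tendsto (fun ρ => Real.log (side (η ρ)) / Real.log ρ) atTop (𝓝 (r / (2 * n))) := by
    have h1 := h.gain.div_const (2 * (n : ℝ))
    refine h1.congr' ?_
    filter_upwards [h.pos] with ρ hρ
    have hθ' : ((θ ρ : ℝ) : ℂ) ≠ 0 := by exact_mod_cast hρ.1.ne'
    rw [codebook, Finset.card_image_of_injective _ fun x y hxy =>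
      generator_mulVec_injective hn hC (smul_right_injective _ hθ' hxy), card_symbolVectors hρ.2,
      Real.log_pow, Real.log_pow]
    push_cast
    field_simp
  have hlo := hlim.eventually_const_lt (show r / (2 * n) - ε < r / (2 * n) by linarith)
  have hhi := hlim.eventually_lt_const (show r / (2 * n) < r / (2 * n) + ε by linarith)
  filter_upwards [hlo, hhi, eventually_gt_atTop 1, h.pos] with ρ h1 h2 hρ hp
  have hl := Real.log_pos hρ
  have hs0 : 0 < side (η ρ) := by
    have : (0 : ℝ) ≤ ⌊η ρ⌋ := by exact_mod_cast Int.floor_nonneg.2 hp.2.le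
    rw [side]; linarith
  rw [lt_div_iff₀ hl] at h1
  rw [div_lt_iff₀ hl] at h2
  rw [Real.rpow_def_of_pos (by linarith), Real.rpow_def_of_pos (by linarith),
    ← Real.le_log_iff_exp_le hs0, ← Real.log_le_iff_le_exp hs0]
  constructor <;> linarith

/-! ### The complexity over regular channels -/

section Nodes

variable {n nr : ℕ} {C : Fin n → Matrix (Fin n) (Fin n) ℂ} {e : Fin (n * n) ≃ Fin n × Fin n}

theorem mem_nodesAt {T nt κ : ℕ} {qr : QRProcedure nr T κ} {G : Matrix (Fin T × Fin nt) (Fin κ) ℂ}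
    {θ η ξ : ℝ} {ω : Outcome nr nt T κ} {k : ℕ} {hk : k ≤ κ} {s : Fin k → ℂ} :
    s ∈ nodesAt qr G θ η ξ ω k hk ↔ s ∈ symbolVectors k η ∧
      normSq (((qr (codeChannel G θ ω.1)).1ᴴ *ᵥ received G θ ω) ∘ lastIdx hk -
        (qr (codeChannel G θ ω.1)).2.submatrix (lastIdx hk) (lastIdx hk) *ᵥ s) ≤ ξ ^ 2 := by
  simp only [nodesAt, visitedNodes, Finset.mem_filter]

/-- The forms `x ↦ rowForm (X c)` for the columns `X c` of the codeword with symbol vector `x`. -/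
noncomputable def codeForms {κ : ℕ} (pr : ℕ → Fin nr) (pc : ℕ → Fin n)
    (H : Fin nr × Fin n → ℂ) (G : Matrix (Fin n × Fin n) (Fin κ) ℂ) :
    (Fin κ → ℂ) →ₗ[ℂ] (Fin n × Fin n → ℂ) :=
  LinearMap.pi fun p => (rowForm pr pc H p.2).comp
    ((LinearMap.funLeft ℂ ℂ fun j => (p.1, j)).comp G.mulVecLin)

/-- The number of nodes of a layer in terms of the pivots of the channel. The pivots with `short m`
bound the row form `m` of each column by the search radius; for the others the size of the
constellation is used. -/
theorem card_nodesAt_le (hn : 1 ≤ n) {K : ℝ} (hK1 : 1 ≤ K)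
    (hK : ∀ (x : Fin (n * n) → ℂ) (M : ℝ), 0 ≤ M →
      (∀ p, ‖(orderedThreadedGenerator C e *ᵥ x) p‖ ≤ M) → ∀ i, ‖x i‖ ≤ K * M)
    {qr : QRProcedure nr n (n * n)} (hqr : ∀ M, IsThinQR M (qr M).1 (qr M).2)
    {θ η ξ : ℝ} (hθ : 0 < θ) (hη : 0 < η) (hξ : 0 ≤ ξ) (ω : Outcome nr n n (n * n))
    {pr : ℕ → Fin nr} {pc : ℕ → Fin n} (hpiv : IsPivoting pr pc n fun p => ω.1 p.1 p.2)
    (hne : ∀ m < n, elim pr pc m (fun p => ω.1 p.1 p.2) (pr m, pc m) ≠ 0)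
    (short : ℕ → Prop) [DecidablePred short] {δ : ℝ} (hδ : 0 < δ)
    (hδ1 : 2 * (3 ^ (n * n) * (1 + K * ((n : ℝ) + 1) ^ n) + K * ((n : ℝ) + 1) ^ n) * δ < 1)
    {k : ℕ} (hk : k ≤ n * n) :
    ((nodesAt qr (orderedThreadedGenerator C e) θ η ξ ω k hk).card : ℝ) ≤
      ∏ m : Fin n, (if short m then
        (2 * (2 ^ n * (2 * ξ / θ) /
          ‖elim pr pc m (fun p => ω.1 p.1 p.2) (pr m, pc m)‖ / δ) + 3) ^ 2
        else (2 * (2 * η / δ) + 3) ^ 2) ^ n := by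
  set G := orderedThreadedGenerator C e with hG
  set F : Fin nr × Fin n → ℂ := fun p => ω.1 p.1 p.2 with hF
  set M := codeChannel G θ ω.1 with hM
  have hrow : ∀ (x : Fin (n * n) → ℂ) (B : ℝ), 0 ≤ B → normSq (M *ᵥ x) ≤ B ^ 2 → ∀ p : Fin n × Fin n,
      ‖elim pr pc p.2 F (pr p.2, pc p.2)‖ * ‖codeForms pr pc F G x p‖ ≤ 2 ^ n * (B / θ) := by
    intro x B hB hx p
    have h1 : ∀ i, ‖∑ j, F (i, j) * (G *ᵥ x) (p.1, j)‖ ≤ B / θ := by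
      intro i
      have h2 := (norm_sq_le_normSq (M *ᵥ x) (p.1, i)).trans hx
      have h3 := le_of_sq_le_sq h2 hB
      rw [hM, codeChannel_mulVec, norm_mul, Complex.norm_real, Real.norm_eq_abs, abs_of_pos hθ] at h3
      rw [le_div_iff₀ hθ, mul_comm]
      exact h3
    refine (norm_pivot_mul_rowForm_le hpiv h1 p.2.2).trans ?_
    have : (2 : ℝ) ^ (p.2 : ℕ) ≤ 2 ^ n := pow_le_pow_right₀ (by norm_num) p.2.2.le
    exact mul_le_mul_of_nonneg_right this (by positivity)
  have hZ : ∀ x : Fin (n * n) → ℂ, ∀ δ : ℝ, 0 ≤ δ → (∀ j, ‖codeForms pr pc F G x j‖ ≤ δ) →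
      ∀ i, ‖x i‖ ≤ K * ((n : ℝ) + 1) ^ n * δ := by
    intro x δ hδ hx i
    rw [mul_assoc]
    refine hK x _ (by positivity) (fun p => ?_) i
    exact norm_le_of_rowForm_le hpiv hne (x := fun j => (G *ᵥ x) (p.1, j))
      (fun m hm => hx (p.1, ⟨m, hm⟩)) p.2
  have hMinj : Function.Injective M.mulVec := by
    intro x y hxy
    have h0 : M *ᵥ (x - y) = 0 := by rw [Matrix.mulVec_sub]; exact sub_eq_zero.2 hxy
    have h1 := hrow (x - y) 0 le_rfl (by rw [h0]; simp [normSq])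
    funext i
    have h2 := hZ (x - y) 0 le_rfl (fun p => by
      have h3 := h1 p
      rw [zero_div, mul_zero] at h3
      have h4 := norm_pos_iff.2 (hne p.2 p.2.2)
      by_contra! hcon
      exact absurd h3 (not_le.2 (mul_pos h4 hcon))) i
    rw [mul_zero] at h2
    exact sub_eq_zero.1 (norm_le_zero_iff.1 h2)
  set J : Finset (Fin n × Fin n) := Finset.univ.filter fun p => short p.2 with hJ
  set β : Fin n × Fin n → ℝ := fun p =>
    2 ^ n * (2 * ξ / θ) / ‖elim pr pc p.2 F (pr p.2, pc p.2)‖ with hβ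
  have hmain := card_le_prod_cells (P := Fin n × Fin n) (κ := n * n) (by simp)
    (codeForms pr pc F G) (by positivity) hZ (lastIdx hk) J β hη.le
    (nodesAt qr G θ η ξ ω k hk) (fun s hs => (mem_nodesAt.1 hs).1) ?_ hδ hδ1
  · refine hmain.trans (le_of_eq ?_)
    have h1 : ∏ m : Fin n, (if short m then
        (2 * (2 ^ n * (2 * ξ / θ) / ‖elim pr pc m F (pr m, pc m)‖ / δ) + 3) ^ 2
        else (2 * (2 * η / δ) + 3) ^ 2) ^ n = ∏ p : Fin n × Fin n, (if short p.2 then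
        (2 * (β p / δ) + 3) ^ 2 else (2 * (2 * η / δ) + 3) ^ 2) := by
      rw [Fintype.prod_prod_type_right]
      refine Finset.prod_congr rfl fun m _ => ?_
      simp [hβ]
    rw [h1, Finset.prod_ite, Finset.prod_const]
    congr 2
    have h2 := Finset.card_filter_add_card_filter_not (s := (Finset.univ : Finset (Fin n × Fin n)))
      (fun p : Fin n × Fin n => short p.2)
    rw [Finset.card_univ] at h2
    rw [hJ]
    omega
  · intro s hs s' hs'
    obtain ⟨-, hs⟩ := mem_nodesAt.1 hs
    obtain ⟨-, hs'⟩ := mem_nodesAt.1 hs'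
    obtain ⟨x, hx1, hx2⟩ := (hqr M).exists_extension hMinj hk (s - s')
    refine ⟨x, hx1, fun p _ => ?_⟩
    have h3 : normSq (M *ᵥ x) ≤ (2 * ξ) ^ 2 := by
      rw [hx2, Matrix.mulVec_sub]
      set R := (qr M).2.submatrix (lastIdx hk) (lastIdx hk)
      set v := ((qr M).1ᴴ *ᵥ received G θ ω) ∘ lastIdx hk
      have e1 : R *ᵥ s - R *ᵥ s' = (v - R *ᵥ s') - (v - R *ᵥ s) := by abel
      rw [e1]
      refine (normSq_sub_le _ _).trans ?_
      linarith
    have h4 := hrow x (2 * ξ) (by positivity) h3 p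
    rw [hβ, le_div_iff₀ (norm_pos_iff.2 (hne p.2 p.2.2)), mul_comm]
    exact h4

end Nodes

theorem eventually_sqrt_log_le (C z : ℝ) {s : ℝ} (hs : 0 < s) :
    ∀ᶠ ρ : ℝ in atTop, C * √(z * Real.log ρ) ≤ ρ ^ s := by
  have h := ((isLittleO_log_rpow_atTop hs).const_mul_left (|z|)).bound one_pos
  filter_upwards [h, eventually_gt_atTop 1, eventually_le_rpow |C| (δ := s / 2) (by linarith)]
    with ρ h1 h2 h3
  have h0 : 0 < ρ := by linarith
  rw [one_mul, Real.norm_eq_abs, Real.norm_eq_abs, abs_of_nonneg (Real.rpow_nonneg h0.le _)] at h1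
  have h4 : √(z * Real.log ρ) ≤ ρ ^ (s / 2) := by
    rw [Real.sqrt_le_left (Real.rpow_nonneg h0.le _), ← Real.rpow_natCast, ← Real.rpow_mul h0.le]
    have e : s / 2 * ((2 : ℕ) : ℝ) = s := by push_cast; ring
    rw [e]
    refine le_trans ?_ h1
    have := Real.log_pos h2
    rw [abs_mul, abs_abs, abs_of_pos this]
    exact mul_le_mul_of_nonneg_right (le_abs_self z) this.le
  calc C * √(z * Real.log ρ) ≤ |C| * √(z * Real.log ρ) :=
        mul_le_mul_of_nonneg_right (le_abs_self C) (Real.sqrt_nonneg _)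
    _ ≤ ρ ^ (s / 2) * ρ ^ (s / 2) := mul_le_mul h3 h4 (Real.sqrt_nonneg _) (Real.rpow_nonneg h0.le _)
    _ = ρ ^ s := by rw [← Real.rpow_add h0]; ring_nf

section Upper

variable {n nr : ℕ} {C : Fin n → Matrix (Fin n) (Fin n) ℂ} {e : Fin (n * n) ≃ Fin n × Fin n}

/-- Over channels whose singularity budget is close to the tradeoff curve, the number of visited
nodes is below `ρ ^ x` for each `x` above the complexity exponent. -/
theorem exists_eventually_complexity_lt (hn : 1 ≤ n) (hnr : n ≤ nr) (hC : ∀ l, IsUnit (C l).det)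
    {qr : QRProcedure nr n (n * n)} (hqr : ∀ M, IsThinQR M (qr M).1 (qr M).2)
    {θ η : ℝ → ℝ} {r : ℝ} (hr : r ∈ Set.Icc (0 : ℝ) n)
    (h : OperatesAt (orderedThreadedGenerator C e) θ η r) (z : ℝ) {x : ℝ}
    (hx : sdExponent n r < x) :
    ∃ ε > 0, ∀ᶠ ρ in atTop, ∀ ω : Outcome nr n n (n * n),
      (fun p : Fin nr × Fin n => ω.1 p.1 p.2) ∈ regularChannels nr n (dmt n nr r + ε) ρ →
      (complexity qr (orderedThreadedGenerator C e) (θ ρ) (η ρ) (radius z ρ) ω : ℝ) < ρ ^ x := by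
  obtain ⟨K, hK1, hK⟩ := exists_bound_of_generator hn hC e
  obtain ⟨c, K', hc, hK', hpow⟩ := exists_power_bounds hn hC e
  set G := orderedThreadedGenerator C e with hG
  have hn0 : (0 : ℝ) < n := by exact_mod_cast hn
  set g := x - sdExponent n r with hg
  have hg0 : 0 < g := by linarith
  set L := 2 * (3 ^ (n * n) * (1 + K * ((n : ℝ) + 1) ^ n) + K * ((n : ℝ) + 1) ^ n) with hL
  have hL0 : 0 < L := by positivity
  set δ := 1 / (2 * L) with hδ
  have hδ0 : 0 < δ := by positivity
  have hδ1 : L * δ < 1 := by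
    rw [hδ, mul_one_div, div_lt_one (by positivity)]; linarith
  set s := g / (32 * n ^ 2) with hs
  have hs0 : 0 < s := by positivity
  refine ⟨g / (4 * n), by positivity, ?_⟩
  filter_upwards [h.pos, h.power, h.eventually_side hn hC hs0, eventually_gt_atTop 1,
    eventually_sqrt_log_le (2 ^ (n + 2) / (δ * √c)) z hs0, eventually_le_rpow 4 hs0,
    eventually_le_rpow (4 / δ + 3) hs0, eventually_le_rpow ((n : ℝ) * n) (δ := g / 4) (by linarith)]
    with ρ hpos hpw hside hρ1 hlog h4 hCη hnn ω hreg
  obtain ⟨hθ, hη⟩ := hpos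
  have hρ0 : 0 < ρ := by linarith
  obtain ⟨hfl, hlow, -⟩ := hpow (θ ρ) (η ρ) ρ hθ hη hρ0 hpw
  obtain ⟨pr, pc, hpiv, hne, hbud⟩ := hreg
  set P : ℕ → ℝ := fun m => ‖elim pr pc m (fun p => ω.1 p.1 p.2) (pr m, pc m)‖ with hP
  set t : ℕ → ℝ := fun m => decayExponent ρ (P m) with ht
  have ht01 : ∀ m, 0 ≤ t m ∧ t m ≤ 1 := fun m => decayExponent_mem _ _
  have hsum := sum_max_le_of_weight_le hn hnr hr (by positivity) ht01 hbud
  have hside1 : 1 ≤ side (η ρ) := by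
    have : (0 : ℝ) ≤ ⌊η ρ⌋ := by exact_mod_cast (by omega : 0 ≤ ⌊η ρ⌋)
    rw [side]; linarith
  have hηs : η ρ ≤ side (η ρ) := (lt_side.resolve_right (by linarith)).le
  set ξ := radius z ρ with hξ
  have hξ0 : 0 ≤ ξ := Real.sqrt_nonneg _
  -- the search radius in units of the code, up to the factors `1 / P m`
  have hres : 2 * (2 ^ n * (2 * ξ / θ ρ) / δ) ≤ ρ ^ (r / (2 * n) - 1 / 2 + 2 * s) := by
    have h1 : √c * ρ ^ (1 / 2 : ℝ) ≤ θ ρ * side (η ρ) := by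
      rw [← Real.sqrt_eq_rpow, ← Real.sqrt_mul hc.le]
      exact Real.sqrt_le_iff.2 ⟨by positivity, hlow⟩
    have hsc : 0 < √c := Real.sqrt_pos.2 hc
    have h2 : 1 / θ ρ ≤ side (η ρ) / (√c * ρ ^ (1 / 2 : ℝ)) := by
      rw [div_le_div_iff₀ hθ (by positivity)]
      linarith
    calc 2 * (2 ^ n * (2 * ξ / θ ρ) / δ) = (2 ^ (n + 2) / δ * ξ) * (1 / θ ρ) := by
          rw [pow_add]; ring
      _ ≤ (2 ^ (n + 2) / δ * ξ) * (side (η ρ) / (√c * ρ ^ (1 / 2 : ℝ))) := by gcongr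
      _ = (2 ^ (n + 2) / (δ * √c) * ξ) * (side (η ρ) * ρ ^ (-(1 / 2) : ℝ)) := by
          rw [Real.rpow_neg hρ0.le]; field_simp
      _ ≤ ρ ^ s * (ρ ^ (r / (2 * n) + s) * ρ ^ (-(1 / 2) : ℝ)) := by
          gcongr
          · exact hlog
          · exact hside.2
      _ = _ := by rw [← Real.rpow_add hρ0, ← Real.rpow_add hρ0]; congr 1; ring
  have hfac : ∀ m < n, (if t m < 1 then
      (2 * (2 ^ n * (2 * ξ / θ ρ) / P m / δ) + 3) ^ 2
      else (2 * (2 * η ρ / δ) + 3) ^ 2) ^ n ≤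
        ρ ^ (max 0 (n * t m - (n - r)) + 8 * n * s) := by
    intro m hm
    have hPm : 0 < P m := norm_pos_iff.2 (hne m hm)
    set μ := max 0 (n * t m - (n - r)) / (2 * n) with hμ
    have hbase : ∀ b : ℝ, 0 ≤ b → b ≤ ρ ^ (μ + 4 * s) →
        (b ^ 2) ^ n ≤ ρ ^ (max 0 (n * t m - (n - r)) + 8 * n * s) := by
      intro b hb0 hb
      rw [← pow_mul]
      refine (pow_le_pow_left₀ hb0 hb _).trans (le_of_eq ?_)
      rw [← Real.rpow_natCast, ← Real.rpow_mul hρ0.le, hμ]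
      congr 1
      push_cast
      field_simp
      ring
    have hμ0 : 0 ≤ μ := by positivity
    split_ifs with hlt
    · refine hbase _ (by positivity) ?_
      have h1 := rpow_neg_decayExponent_le hρ1 hPm hlt
      have h2 : 1 / P m ≤ ρ ^ (t m / 2) := by
        rw [neg_div, Real.rpow_neg hρ0.le] at h1
        rw [one_div]
        exact inv_le_of_inv_le₀ (Real.rpow_pos_of_pos hρ0 _) h1
      have h3 : 2 * (2 ^ n * (2 * ξ / θ ρ) / P m / δ) ≤ ρ ^ (μ + 2 * s) := by
        calc _ = 2 * (2 ^ n * (2 * ξ / θ ρ) / δ) * (1 / P m) := by ring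
          _ ≤ ρ ^ (r / (2 * n) - 1 / 2 + 2 * s) * ρ ^ (t m / 2) := by gcongr
          _ = ρ ^ (r / (2 * n) - 1 / 2 + 2 * s + t m / 2) := by rw [← Real.rpow_add hρ0]
          _ ≤ _ := by
              refine Real.rpow_le_rpow_of_exponent_le hρ1.le ?_
              have : (n * t m - (n - r)) / (2 * n) ≤ μ := by
                rw [hμ]; gcongr; exact le_max_right _ _
              have e1 : (n * t m - (n - r)) / (2 * n) = r / (2 * n) - 1 / 2 + t m / 2 := by
                field_simp; ring
              linarith
      have h5 : 1 ≤ ρ ^ (μ + 2 * s) := Real.one_le_rpow hρ1.le (by positivity)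
      calc _ ≤ 4 * ρ ^ (μ + 2 * s) := by linarith
        _ ≤ ρ ^ s * ρ ^ (μ + 2 * s) := by gcongr
        _ = ρ ^ (μ + 3 * s) := by rw [← Real.rpow_add hρ0]; congr 1; ring
        _ ≤ _ := Real.rpow_le_rpow_of_exponent_le hρ1.le (by linarith)
    · refine hbase _ (by positivity) ?_
      have ht1 : t m = 1 := le_antisymm (ht01 m).2 (not_lt.1 hlt)
      have hμr : μ = r / (2 * n) := by
        rw [hμ, ht1]
        congr 1
        rw [max_eq_right] <;> linarith [hr.1]
      calc 2 * (2 * η ρ / δ) + 3 ≤ 2 * (2 * side (η ρ) / δ) + 3 * side (η ρ) := by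
            gcongr; linarith
        _ = (4 / δ + 3) * side (η ρ) := by ring
        _ ≤ ρ ^ s * ρ ^ (r / (2 * n) + s) := by
            gcongr
            exact hside.2
        _ = ρ ^ (μ + 2 * s) := by rw [← Real.rpow_add hρ0, hμr]; congr 1; ring
        _ ≤ _ := Real.rpow_le_rpow_of_exponent_le hρ1.le (by linarith)
  have hlayer : ∀ (k : ℕ) (hk : k ≤ n * n),
      ((nodesAt qr G (θ ρ) (η ρ) ξ ω k hk).card : ℝ) ≤ ρ ^ (sdExponent n r + g / 2) := by
    intro k hk
    refine (card_nodesAt_le hn hK1 hK hqr hθ hη hξ0 ω hpiv hne (fun m => t m < 1) hδ0 hδ1 hk).trans ?_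
    have h1 : ∏ m : Fin n, (if t m < 1 then
        (2 * (2 ^ n * (2 * ξ / θ ρ) / P m / δ) + 3) ^ 2
        else (2 * (2 * η ρ / δ) + 3) ^ 2) ^ n ≤
        ∏ m : Fin n, ρ ^ (max 0 (n * t m - (n - r)) + 8 * n * s) :=
      Finset.prod_le_prod (fun m _ => by positivity) fun m _ => hfac m m.2
    refine h1.trans ?_
    rw [← Real.rpow_sum_of_pos hρ0]
    refine Real.rpow_le_rpow_of_exponent_le hρ1.le ?_
    rw [Finset.sum_add_distrib, Fin.sum_univ_eq_sum_range (fun m => max 0 (n * t m - (n - r))) n]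
    simp only [Finset.sum_const, Finset.card_univ, Fintype.card_fin, nsmul_eq_mul]
    have e1 : (n : ℝ) * (8 * n * s) = g / 4 := by rw [hs]; field_simp; ring
    have e2 : (n : ℝ) * (g / (4 * n)) = g / 4 := by field_simp
    rw [e1]
    rw [e2] at hsum
    linarith
  have htot : (complexity qr G (θ ρ) (η ρ) ξ ω : ℝ) ≤
      (n : ℝ) * n * ρ ^ (sdExponent n r + g / 2) := by
    rw [complexity, Nat.cast_sum]
    refine (Finset.sum_le_card_nsmul _ _ _ fun k _ => hlayer _ _).trans (le_of_eq ?_)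
    rw [nsmul_eq_mul, Finset.card_univ, Fintype.card_fin]
    push_cast; ring
  refine htot.trans_lt ?_
  calc _ ≤ ρ ^ (g / 4) * ρ ^ (sdExponent n r + g / 2) := by gcongr
    _ = ρ ^ (sdExponent n r + 3 * g / 4) := by rw [← Real.rpow_add hρ0]; congr 1; ring
    _ < ρ ^ x := Real.rpow_lt_rpow_of_exponent_lt hρ1 (by rw [hg]; linarith)

theorem measure_preimage_le_of_measurePreserving {α β : Type*} [MeasurableSpace α]
    [MeasurableSpace β] {μ : Measure α} {ν : Measure β} {f : α → β} (hf : MeasurePreserving f μ ν)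
    (s : Set β) : μ (f ⁻¹' s) ≤ ν s := by
  rw [← hf.map_eq]
  exact Measure.le_map_apply hf.measurable.aemeasurable s

theorem isProbabilityMeasure_uniformOn_symbolVectors {η : ℝ} (hη : 0 < η) (k : ℕ) :
    IsProbabilityMeasure (uniformOn (symbolVectors k η : Set (Fin k → ℂ))) := by
  refine isProbabilityMeasure_uniformOn (Finset.finite_toSet _) ?_
  rw [Finset.coe_nonempty, ← Finset.card_pos]
  have h := card_symbolVectors hη k
  have h0 : (0 : ℝ) ≤ ⌊η⌋ := by exact_mod_cast Int.floor_nonneg.2 hη.le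
  have h1 : 0 < side η := by rw [side]; linarith
  have : (0 : ℝ) < (symbolVectors k η).card := by rw [h]; positivity
  exact_mod_cast this

theorem outcomeLaw_channel_le (nr n T κ : ℕ) {η : ℝ} (hη : 0 < η) (S : Set (Fin nr × Fin n → ℂ)) :
    outcomeLaw nr n T κ η {ω | (fun p : Fin nr × Fin n => ω.1 p.1 p.2) ∈ S} ≤
      gaussianFlat nr n S := by
  have := isProbabilityMeasure_uniformOn_symbolVectors hη κ
  exact measure_preimage_le_of_measurePreserving
    ((measurePreserving_uncurry nr n).comp measurePreserving_fst) S

/-- Above the complexity exponent, the probability of a large complexity is negligible compared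
with the error probability. -/
theorem exists_eventually_tailProb_le (hn : 1 ≤ n) (hnr : n ≤ nr) (hC : ∀ l, IsUnit (C l).det)
    {qr : QRProcedure nr n (n * n)} (hqr : ∀ M, IsThinQR M (qr M).1 (qr M).2)
    {θ η : ℝ → ℝ} {r : ℝ} (hr : r ∈ Set.Icc (0 : ℝ) n)
    (h : OperatesAt (orderedThreadedGenerator C e) θ η r) (z : ℝ) {x : ℝ}
    (hx : sdExponent n r < x) :
    ∃ ε > 0, ∀ᶠ ρ in atTop, tailProb qr (orderedThreadedGenerator C e) θ η z x ρ ≤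
      ENNReal.ofReal (ρ ^ (-(dmt n nr r + ε))) := by
  obtain ⟨ε, hε, hev⟩ := exists_eventually_complexity_lt (nr := nr) hn hnr hC hqr hr h z hx
  refine ⟨ε / 2, by linarith, ?_⟩
  filter_upwards [hev, h.pos, eventually_gaussianFlat_compl_regularChannels_le hn hnr
    (dmt n nr r + ε) (half_pos hε)] with ρ h1 h2 h3
  have hsub : complexityTail qr (orderedThreadedGenerator C e) (θ ρ) (η ρ) (radius z ρ) (ρ ^ x) ⊆
      {ω | (fun p : Fin nr × Fin n => ω.1 p.1 p.2) ∈
        (regularChannels nr n (dmt n nr r + ε) ρ)ᶜ} := by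
    intro ω hω hreg
    exact absurd (h1 ω hreg) (not_lt.2 hω)
  refine (measure_mono hsub).trans ((outcomeLaw_channel_le nr n n _ h2.2 _).trans (h3.trans ?_))
  refine ENNReal.ofReal_le_ofReal (le_of_eq ?_)
  congr 1
  ring

end Upper

/-! ### Channels with weak directions -/

section Weak

variable {n nr : ℕ}

/-- The first `h` rows of `Y`, completed to a square matrix by the coordinate forms
`x ↦ x (s i)`, `h ≤ i`. -/
def augment (hnr : n ≤ nr) (h : ℕ) (s : Equiv.Perm (Fin n)) (Y : Fin nr × Fin n → ℂ) :
    Matrix (Fin n) (Fin n) ℂ :=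
  Matrix.of fun i j => if (i : ℕ) < h then Y (Fin.castLE hnr i, j) else if j = s i then 1 else 0

/-- The Vandermonde array: each of its square submatrices formed from the first rows is regular. -/
noncomputable def vandermondeArray (nr n : ℕ) : Fin nr × Fin n → ℂ := fun p => (p.2 : ℂ) ^ (p.1 : ℕ)

theorem augment_mulVec_of_lt {hnr : n ≤ nr} {h : ℕ} {s : Equiv.Perm (Fin n)}
    {Y : Fin nr × Fin n → ℂ} (x : Fin n → ℂ) {i : Fin n} (hi : (i : ℕ) < h) :
    (augment hnr h s Y *ᵥ x) i = ∑ j, Y (Fin.castLE hnr i, j) * x j := by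
  simp [augment, Matrix.mulVec, dotProduct, hi]

theorem augment_mulVec_of_le {hnr : n ≤ nr} {h : ℕ} {s : Equiv.Perm (Fin n)}
    {Y : Fin nr × Fin n → ℂ} (x : Fin n → ℂ) {i : Fin n} (hi : h ≤ (i : ℕ)) :
    (augment hnr h s Y *ᵥ x) i = x (s i) := by
  simp [augment, Matrix.mulVec, dotProduct, not_lt.2 hi]

/-- A vector in the kernel vanishes at the coordinates `s i`, `h ≤ i`, so the first `h` rows form a
Vandermonde system for the other coordinates. -/
theorem det_augment_vandermondeArray_ne_zero (hnr : n ≤ nr) {h : ℕ} (hh : h ≤ n)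
    (s : Equiv.Perm (Fin n)) : (augment hnr h s (vandermondeArray nr n)).det ≠ 0 := by
  set A := augment hnr h s (vandermondeArray nr n) with hA
  have hinj : Function.Injective A.mulVec := by
    suffices H : ∀ x, A *ᵥ x = 0 → x = 0 by
      intro x y hxy
      have := H (x - y) (by rw [Matrix.mulVec_sub]; exact sub_eq_zero.2 hxy)
      exact sub_eq_zero.1 this
    intro x hx
    have hlow : ∀ i : Fin n, h ≤ (i : ℕ) → x (s i) = 0 := by
      intro i hi
      rw [← augment_mulVec_of_le (hnr := hnr) (Y := vandermondeArray nr n) x hi, ← hA, hx]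
      rfl
    have hv : (fun i : Fin h => x (s (Fin.castLE hh i))) = 0 := by
      refine Matrix.eq_zero_of_forall_pow_sum_mul_pow_eq_zero
        (f := fun i : Fin h => ((s (Fin.castLE hh i) : ℕ) : ℂ)) ?_ fun i => ?_
      · intro i j hij
        have h1 : s (Fin.castLE hh i) = s (Fin.castLE hh j) := Fin.ext (Nat.cast_injective hij)
        have h2 := s.injective h1
        exact Fin.castLE_injective hh h2
      · have h1 : (A *ᵥ x) (Fin.castLE hh i) = 0 := by rw [hx]; rfl
        rw [hA, augment_mulVec_of_lt x (by exact i.2), ← Equiv.sum_comp s] at h1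
        rw [← h1, ← Finset.sum_image (s := Finset.univ) (g := Fin.castLE hh)
          (f := fun j => x (s j) * ((s j : ℕ) : ℂ) ^ (i : ℕ)) fun i _ j _ h => Fin.castLE_injective hh h]
        have h2 : ∀ j : Fin n, vandermondeArray nr n (Fin.castLE hnr (Fin.castLE hh i), s j) * x (s j) =
            x (s j) * ((s j : ℕ) : ℂ) ^ (i : ℕ) := fun j => by simp [vandermondeArray, mul_comm]
        simp only [h2]
        refine Finset.sum_subset (Finset.subset_univ _) fun j _ hj => ?_
        rw [hlow, zero_mul]
        by_contra hlt
        exact hj (Finset.mem_image.2 ⟨⟨j, by omega⟩, Finset.mem_univ _, Fin.ext rfl⟩)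
    funext j
    obtain ⟨i, rfl⟩ := s.surjective j
    by_cases hi : (i : ℕ) < h
    · exact congrFun hv ⟨i, hi⟩
    · exact hlow i (not_lt.1 hi)
  have := Matrix.mulVec_injective_iff_isUnit.1 hinj
  exact ((Matrix.isUnit_iff_isUnit_det A).1 this).ne_zero

theorem continuous_augment (hnr : n ≤ nr) (h : ℕ) (s : Equiv.Perm (Fin n)) :
    Continuous (augment hnr h s) := by
  refine continuous_matrix fun i j => ?_
  simp only [augment, Matrix.of_apply]
  split_ifs <;> fun_prop

theorem inv_augment_apply (hnr : n ≤ nr) (h : ℕ) (s : Equiv.Perm (Fin n)) (Y : Fin nr × Fin n → ℂ)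
    (i j : Fin n) : (augment hnr h s Y)⁻¹ i j =
      (augment hnr h s Y).det⁻¹ * (augment hnr h s Y).adjugate i j := by
  rw [Matrix.inv_def, Ring.inverse_eq_inv', Matrix.smul_apply, smul_eq_mul]

theorem measurable_inv_augment (hnr : n ≤ nr) (h : ℕ) (s : Equiv.Perm (Fin n)) (i j : Fin n) :
    Measurable fun Y : Fin nr × Fin n → ℂ => (augment hnr h s Y)⁻¹ i j := by
  simp only [inv_augment_apply]
  have hc := continuous_augment (nr := nr) hnr h s
  exact hc.matrix_det.measurable.inv.mul (hc.matrix_adjugate.matrix_elem i j).measurable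

/-- By continuity, arrays whose first rows are close to the Vandermonde array have uniformly regular
completions. -/
theorem exists_bound_inv_augment (hnr : n ≤ nr) {h : ℕ} (hh : h ≤ n) :
    ∃ τ K : ℝ, 0 < τ ∧ τ ≤ 1 ∧ 1 ≤ K ∧ ∀ Y : Fin nr × Fin n → ℂ,
      (∀ p : Fin nr × Fin n, (p.1 : ℕ) < h → ‖Y p - vandermondeArray nr n p‖ ≤ τ) →
      ∀ s, (augment hnr h s Y).det ≠ 0 ∧ ∀ i j, ‖(augment hnr h s Y)⁻¹ i j‖ ≤ K := by
  set V := vandermondeArray nr n with hV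
  have hc := fun s => continuous_augment (nr := nr) hnr h s
  have hd := fun s => det_augment_vandermondeArray_ne_zero hnr hh s
  have hinv : ∀ s i j, ContinuousAt (fun Y : Fin nr × Fin n → ℂ => (augment hnr h s Y)⁻¹ i j) V := by
    intro s i j
    simp only [inv_augment_apply]
    exact ((hc s).matrix_det.continuousAt.inv₀ (hd s)).mul
      ((hc s).matrix_adjugate.matrix_elem i j).continuousAt
  set K := 1 + ∑ s, ∑ i, ∑ j, ‖(augment hnr h s V)⁻¹ i j‖ with hK
  have hterm : ∀ s i j, ‖(augment hnr h s V)⁻¹ i j‖ < K := by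
    intro s i j
    have h1 : ‖(augment hnr h s V)⁻¹ i j‖ ≤ ∑ j, ‖(augment hnr h s V)⁻¹ i j‖ :=
      Finset.single_le_sum (f := fun j => ‖(augment hnr h s V)⁻¹ i j‖) (fun _ _ => norm_nonneg _)
        (Finset.mem_univ j)
    have h2 : ∑ j, ‖(augment hnr h s V)⁻¹ i j‖ ≤ ∑ i, ∑ j, ‖(augment hnr h s V)⁻¹ i j‖ :=
      Finset.single_le_sum (f := fun i => ∑ j, ‖(augment hnr h s V)⁻¹ i j‖)
        (fun _ _ => Finset.sum_nonneg fun _ _ => norm_nonneg _) (Finset.mem_univ i)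
    have h3 : ∑ i, ∑ j, ‖(augment hnr h s V)⁻¹ i j‖ ≤ ∑ s, ∑ i, ∑ j, ‖(augment hnr h s V)⁻¹ i j‖ :=
      Finset.single_le_sum (f := fun s => ∑ i, ∑ j, ‖(augment hnr h s V)⁻¹ i j‖)
        (fun _ _ => Finset.sum_nonneg fun _ _ => Finset.sum_nonneg fun _ _ => norm_nonneg _)
        (Finset.mem_univ s)
    linarith
  have hev : ∀ᶠ Y in 𝓝 V, ∀ s, (augment hnr h s Y).det ≠ 0 ∧
      ∀ i j, ‖(augment hnr h s Y)⁻¹ i j‖ < K := by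
    refine eventually_all.2 fun s => ((hc s).matrix_det.continuousAt.eventually_ne (hd s)).and ?_
    refine eventually_all.2 fun i => eventually_all.2 fun j => ?_
    exact (hinv s i j).norm.eventually_lt_const (hterm s i j)
  obtain ⟨τ, hτ, hball⟩ := Metric.eventually_nhds_iff_ball.1 hev
  have hK1 : 1 ≤ K := by
    have : 0 ≤ ∑ s, ∑ i, ∑ j, ‖(augment hnr h s V)⁻¹ i j‖ := Finset.sum_nonneg fun _ _ =>
      Finset.sum_nonneg fun _ _ => Finset.sum_nonneg fun _ _ => norm_nonneg _
    linarith
  refine ⟨min (τ / 2) 1, K, by positivity, min_le_right _ _, hK1, fun Y hY s => ?_⟩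
  set Y' : Fin nr × Fin n → ℂ := fun p => if (p.1 : ℕ) < h then Y p else V p with hY'
  have hYY' : augment hnr h s Y = augment hnr h s Y' := by
    ext i j
    simp only [augment, Matrix.of_apply, hY', Fin.val_castLE]
    split_ifs <;> rfl
  have hmem : Y' ∈ Metric.ball V τ := by
    rw [Metric.mem_ball]
    refine lt_of_le_of_lt ?_ (half_lt_self hτ)
    rw [dist_pi_le_iff (by positivity)]
    intro p
    rw [hY', dist_eq_norm]
    dsimp only
    split_ifs with hp
    · exact (hY p hp).trans (min_le_left _ _)
    · rw [sub_self, norm_zero]; positivity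
  rw [hYY']
  exact ⟨(hball Y' hmem s).1, fun i j => ((hball Y' hmem s).2 i j).le⟩

/-- `Y` has an `(n - h)`-dimensional space of input directions, in general position with respect
to all coordinate subspaces, on which it is a form of size `a` up to an error of size `b`: the map
`L` parametrizes the space by the coordinates `s i`, `h ≤ i`, and `l` is the form. The parameters
`β i` with `i < h` are placeholders. -/
def HasWeakDirections (h : ℕ) (K a b : ℝ) (Y : Fin nr × Fin n → ℂ) : Prop :=
  ∀ s : Equiv.Perm (Fin n), ∃ (L : (Fin n → ℂ) →ₗ[ℂ] (Fin n → ℂ)) (l : (Fin n → ℂ) →ₗ[ℂ] ℂ),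
    ∀ (β : Fin n → ℂ) (M : ℝ), (∀ i, ‖β i‖ ≤ M) →
      (∀ i : Fin n, h ≤ (i : ℕ) → L β (s i) = β i) ∧ (∀ j, ‖L β j‖ ≤ K * M) ∧ ‖l β‖ ≤ K * M ∧
      ∀ i, ‖∑ j, Y (i, j) * L β j‖ ≤ 3 * a * ‖l β‖ + K * b * M

/-- The matrix that is added to the block of the entries `(i, j)`, `h ≤ i`, `h ≤ j`, to form the Schur
complement of the upper left block of size `h`. -/
noncomputable def weakPart (hnr : n ≤ nr) (h : ℕ) (Y : Fin nr × Fin n → ℂ) (p : Fin nr × Fin n) : ℂ :=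
  ∑ m : Fin n, if (m : ℕ) < h then Y (p.1, m) * (augment hnr h 1 Y)⁻¹ m p.2 else 0

/-- On the kernel of the first `h` rows the array acts as its Schur complement. If this is close to the
matrix of rank one with entries `u i * v j`, the form `∑ v j x j` gives weak directions. -/
theorem hasWeakDirections_of (hnr : n ≤ nr) {h : ℕ} {K a b : ℝ} (hK : 0 ≤ K)
    (hb : 0 ≤ b) {Y : Fin nr × Fin n → ℂ}
    (hinv : ∀ s, (augment hnr h s Y).det ≠ 0 ∧ ∀ i j, ‖(augment hnr h s Y)⁻¹ i j‖ ≤ K)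
    {u : Fin nr → ℂ} {v : Fin n → ℂ} (hu : ∀ i : Fin nr, h ≤ (i : ℕ) → ‖u i‖ ≤ 3 * a) (hv : ∀ j, ‖v j‖ ≤ 1)
    (ha : 0 ≤ a)
    (hD : ∀ (i : Fin nr) (j : Fin n), h ≤ (i : ℕ) → h ≤ (j : ℕ) →
      ‖Y (i, j) + weakPart hnr h Y (i, j) - u i * v j‖ ≤ b) :
    HasWeakDirections h (n * (n * K)) a b Y := by
  intro s
  set A := augment hnr h s Y with hA
  set mask : (Fin n → ℂ) →ₗ[ℂ] (Fin n → ℂ) :=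
    LinearMap.pi fun i => if h ≤ (i : ℕ) then LinearMap.proj i else 0 with hmask
  have hmaskle : ∀ (β : Fin n → ℂ) i, mask β i = if h ≤ (i : ℕ) then β i else 0 := by
    intro β i
    simp only [hmask, LinearMap.pi_apply]
    split_ifs <;> rfl
  set L := A⁻¹.mulVecLin.comp mask with hL
  set l : (Fin n → ℂ) →ₗ[ℂ] ℂ :=
    (∑ j : Fin n, (if h ≤ (j : ℕ) then v j else 0) • LinearMap.proj j).comp L with hl
  have hlap : ∀ β, l β = ∑ j : Fin n, (if h ≤ (j : ℕ) then v j else 0) * L β j := by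
    intro β
    simp only [hl, LinearMap.comp_apply, LinearMap.sum_apply, LinearMap.smul_apply,
      LinearMap.proj_apply, smul_eq_mul]
  refine ⟨L, l, fun β M hβ => ?_⟩
  have hAu : IsUnit A.det := isUnit_iff_ne_zero.2 (hinv s).1
  have hAL : A *ᵥ L β = mask β := by
    change A *ᵥ (A⁻¹ *ᵥ mask β) = mask β
    rw [Matrix.mulVec_mulVec, Matrix.mul_nonsing_inv _ hAu, Matrix.one_mulVec]
  rcases Nat.eq_zero_or_pos n with hn0 | hn
  · subst hn0
    have hM0 : ‖l β‖ = 0 := by rw [hlap]; simp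
    exact ⟨fun i => i.elim0, fun i => i.elim0, by rw [hM0]; simp, fun i => by simp [hM0]⟩
  have hM : 0 ≤ M := (norm_nonneg _).trans (hβ ⟨0, hn⟩)
  have hn1 : (1 : ℝ) ≤ n := by exact_mod_cast hn
  have hcoord : ∀ i : Fin n, h ≤ (i : ℕ) → L β (s i) = β i := by
    intro i hi
    have := congrFun hAL i
    rw [hA, augment_mulVec_of_le _ hi, hmaskle, if_pos hi] at this
    exact this
  have hLle : ∀ j, ‖L β j‖ ≤ n * K * M := by
    intro j
    change ‖(A⁻¹ *ᵥ mask β) j‖ ≤ _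
    rw [Matrix.mulVec, dotProduct]
    refine (norm_sum_le _ _).trans ((Finset.sum_le_card_nsmul _ _ (K * M) fun i _ => ?_).trans
      (le_of_eq ?_))
    · rw [norm_mul]
      refine mul_le_mul ((hinv s).2 j i) ?_ (norm_nonneg _) hK
      rw [hmaskle]
      split_ifs
      · exact hβ i
      · rwa [norm_zero]
    · rw [nsmul_eq_mul, Finset.card_univ, Fintype.card_fin, mul_assoc]
  have hnK : 0 ≤ n * K * M := by positivity
  refine ⟨hcoord, fun j => (hLle j).trans ?_, ?_, fun i => ?_⟩
  · have := mul_le_mul_of_nonneg_right hn1 hnK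
    linarith
  · rw [hlap]
    refine (norm_sum_le _ _).trans ((Finset.sum_le_card_nsmul _ _ (n * K * M) fun j _ => ?_).trans
      (le_of_eq ?_))
    · rw [norm_mul]
      refine (mul_le_of_le_one_left (norm_nonneg _) ?_).trans (hLle j)
      split_ifs
      · exact hv j
      · rw [norm_zero]; exact zero_le_one
    · rw [nsmul_eq_mul, Finset.card_univ, Fintype.card_fin]; ring
  · have hrhs : 0 ≤ 3 * a * ‖l β‖ + n * (n * K) * b * M := by positivity
    by_cases hi : (i : ℕ) < h
    · by_cases hin : (i : ℕ) < n
      · have h1 := congrFun hAL ⟨i, hin⟩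
        rw [hA, augment_mulVec_of_lt _ (by exact hi), hmaskle, if_neg (by simpa using hi)] at h1
        have h2 : Fin.castLE hnr ⟨i, hin⟩ = i := Fin.ext rfl
        rw [h2] at h1
        rw [h1, norm_zero]
        exact hrhs
      · -- here `h` exceeds `n`, so the space of weak directions is zero
        have hz : mask β = 0 := by
          funext j
          rw [hmaskle, if_neg (by have := j.2; omega)]; rfl
        have : L β = 0 := by change A⁻¹ *ᵥ mask β = 0; rw [hz, Matrix.mulVec_zero]
        simp only [this, Pi.zero_apply, mul_zero, Finset.sum_const_zero, norm_zero]
        exact hrhs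
    · have hi : h ≤ (i : ℕ) := not_lt.1 hi
      set B := augment hnr h 1 Y with hB
      have hBu : IsUnit B.det := isUnit_iff_ne_zero.2 (hinv 1).1
      -- the first coordinates of a weak direction are determined by the others
      have hxB : ∀ m : Fin n, L β m = ∑ j : Fin n, if h ≤ (j : ℕ) then B⁻¹ m j * L β j else 0 := by
        intro m
        have h1 : L β = B⁻¹ *ᵥ (B *ᵥ L β) := by
          rw [Matrix.mulVec_mulVec, Matrix.nonsing_inv_mul _ hBu, Matrix.one_mulVec]
        have h2 : ∀ j, (B *ᵥ L β) j = if h ≤ (j : ℕ) then L β j else 0 := by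
          intro j
          split_ifs with hj
          · rw [hB, augment_mulVec_of_le _ hj]; rfl
          · rw [hB, augment_mulVec_of_lt _ (not_le.1 hj),
              ← augment_mulVec_of_lt (s := s) _ (not_le.1 hj), ← hA, hAL, hmaskle, if_neg hj]
        conv_lhs => rw [h1]
        rw [Matrix.mulVec, dotProduct]
        refine Finset.sum_congr rfl fun j _ => ?_
        rw [h2]
        split_ifs
        · rfl
        · rw [mul_zero]
      have hsum : ∑ j, Y (i, j) * L β j = ∑ j : Fin n, if h ≤ (j : ℕ) then
          (Y (i, j) + weakPart hnr h Y (i, j)) * L β j else 0 := by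
        have h1 : ∀ j : Fin n, Y (i, j) * L β j = (if h ≤ (j : ℕ) then Y (i, j) * L β j else 0) +
            if (j : ℕ) < h then Y (i, j) * L β j else 0 := by
          intro j
          by_cases hj : h ≤ (j : ℕ)
          · rw [if_pos hj, if_neg (not_lt.2 hj), add_zero]
          · rw [if_neg hj, if_pos (not_le.1 hj), zero_add]
        have h2 : ∑ m : Fin n, (if (m : ℕ) < h then Y (i, m) * L β m else 0) =
            ∑ j : Fin n, if h ≤ (j : ℕ) then weakPart hnr h Y (i, j) * L β j else 0 := by
          have h3 : ∀ m : Fin n, (if (m : ℕ) < h then Y (i, m) * L β m else 0) =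
              ∑ j : Fin n, if h ≤ (j : ℕ) then
                (if (m : ℕ) < h then Y (i, m) * B⁻¹ m j else 0) * L β j else 0 := by
            intro m
            split_ifs with hm
            · rw [hxB m, Finset.mul_sum]
              refine Finset.sum_congr rfl fun j _ => ?_
              split_ifs
              · ring
              · ring
            · simp
          simp only [h3]
          rw [Finset.sum_comm]
          refine Finset.sum_congr rfl fun j _ => ?_
          split_ifs
          · rw [weakPart, Finset.sum_mul]
          · simp
        calc ∑ j, Y (i, j) * L β j = _ := Finset.sum_congr rfl fun j _ => h1 j
          _ = _ := by
            rw [Finset.sum_add_distrib, h2, ← Finset.sum_add_distrib]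
            refine Finset.sum_congr rfl fun j _ => ?_
            split_ifs
            · ring
            · ring
      have hsplit : ∑ j, Y (i, j) * L β j = u i * l β + ∑ j : Fin n, if h ≤ (j : ℕ) then
          (Y (i, j) + weakPart hnr h Y (i, j) - u i * v j) * L β j else 0 := by
        rw [hsum, hlap, Finset.mul_sum, ← Finset.sum_add_distrib]
        refine Finset.sum_congr rfl fun j _ => ?_
        split_ifs
        · ring
        · ring
      rw [hsplit]
      refine (norm_add_le _ _).trans (add_le_add ?_ ?_)
      · rw [norm_mul]
        exact mul_le_mul_of_nonneg_right (hu i hi) (norm_nonneg _)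
      · refine (norm_sum_le _ _).trans ((Finset.sum_le_card_nsmul _ _ (b * (n * K * M))
          fun j _ => ?_).trans (le_of_eq ?_))
        · split_ifs with hj
          · rw [norm_mul]
            exact mul_le_mul (hD i j hi hj) (hLle j) (norm_nonneg _) hb
          · rw [norm_zero]; positivity
        · rw [nsmul_eq_mul, Finset.card_univ, Fintype.card_fin]; ring

end Weak

/-- Channels with weak directions have at least the probability of the corresponding singularity: a
Schur complement of size `nr - h` by `n - h` with one row and one column of size `a` and entries of
size `b` after a further elimination step. -/
theorem exists_gaussianFlat_hasWeakDirections_ge {n nr : ℕ} (hnr : n ≤ nr) {h : ℕ} (hh : h < n) :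
    ∃ K c : ℝ, 0 < K ∧ 0 < c ∧ ∀ a b : ℝ, 0 < a → a ≤ 1 → 0 < b → b ≤ 1 →
      ENNReal.ofReal (c * ((a ^ 2) ^ ((nr - h) + (n - h) - 1) *
        (b ^ 2) ^ ((nr - h - 1) * (n - h - 1)))) ≤
      gaussianFlat nr n {Y | HasWeakDirections h K a b Y} := by
  obtain ⟨τ, K, hτ, hτ1, hK1, hinv⟩ := exists_bound_inv_augment hnr hh.le
  have hK0 : 0 ≤ K := by linarith
  set V := vandermondeArray nr n with hV
  set r₀ : Fin nr := ⟨h, by omega⟩ with hr₀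
  set c₀ : Fin n := ⟨h, hh⟩ with hc₀
  -- `T₁` takes the Schur complement of the first `h` rows, `T₂` eliminates with the next pivot.
  set T₁ : (Fin nr × Fin n → ℂ) → Fin nr × Fin n → ℂ := fun Y p =>
    if h ≤ (p.1 : ℕ) ∧ h ≤ (p.2 : ℕ) then Y p + weakPart hnr h Y p else Y p with hT₁
  set T₂ : (Fin nr × Fin n → ℂ) → Fin nr × Fin n → ℂ := fun X p =>
    if h < (p.1 : ℕ) ∧ h < (p.2 : ℕ) then X p + -(X (p.1, c₀) * X (r₀, p.2) / X (r₀, c₀)) else X p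
    with hT₂
  have hm₁ : MeasurePreserving T₁ volume volume := by
    refine measurePreserving_shear (fun p : Fin nr × Fin n => h ≤ (p.1 : ℕ) ∧ h ≤ (p.2 : ℕ))
      (weakPart hnr h) ?_ fun X Y hXY p hp => ?_
    · refine measurable_pi_lambda _ fun p => Finset.measurable_sum _ fun m _ => ?_
      split_ifs
      · exact (measurable_pi_apply _).mul (measurable_inv_augment hnr h 1 m p.2)
      · exact measurable_const
    · have haug : augment hnr h 1 X = augment hnr h 1 Y := by
        ext i j
        simp only [augment, Matrix.of_apply]
        split_ifs with hi
        · refine hXY _ fun hcon => ?_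
          have h1 : h ≤ (i : ℕ) := hcon.1
          omega
        · rfl
        · rfl
      simp only [weakPart, haug]
      refine Finset.sum_congr rfl fun m _ => ?_
      split_ifs with hm
      · rw [hXY (p.1, m) fun hcon => by have h1 : h ≤ (m : ℕ) := hcon.2; omega]
      · rfl
  have hm₂ : MeasurePreserving T₂ volume volume := by
    refine measurePreserving_shear (fun p : Fin nr × Fin n => h < (p.1 : ℕ) ∧ h < (p.2 : ℕ))
      (fun X p => -(X (p.1, c₀) * X (r₀, p.2) / X (r₀, c₀))) (by fun_prop) fun X Y hXY p hp => ?_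
    have h1 : ∀ i, X (i, c₀) = Y (i, c₀) := fun i => hXY _ fun hcon => lt_irrefl _ hcon.2
    have h2 : ∀ j, X (r₀, j) = Y (r₀, j) := fun j => hXY _ fun hcon => lt_irrefl _ hcon.1
    simp only [h1, h2]
  -- All entries of the channels below are bounded by `B`.
  set B : ℝ := 1 + ∑ p, ‖V p‖ + 4 + n * K with hB
  obtain ⟨c₁, hc₁0, hc₁t, hlow⟩ := exists_mul_volume_le_gaussianFlat nr n B
  set base : Fin nr × Fin n → ℝ := fun p => if (p.1 : ℕ) < h then τ else 1 with hbase
  have hbase0 : ∀ p, 0 < base p := by intro p; rw [hbase]; dsimp only; split_ifs <;> positivity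
  have hc₁r : 0 < c₁.toReal := ENNReal.toReal_pos hc₁0 hc₁t
  refine ⟨n * (n * K), c₁.toReal * ∏ p, (Real.pi * base p ^ 2), ?_, ?_, fun a b ha ha1 hb hb1 => ?_⟩
  · have : (0 : ℝ) < n := by exact_mod_cast (by omega : 0 < n)
    positivity
  · exact mul_pos hc₁r (Finset.prod_pos fun p _ => by have := hbase0 p; positivity)
  set rad : Fin nr × Fin n → ℝ := fun p => base p * (if h < (p.1 : ℕ) ∧ h < (p.2 : ℕ) then b else
    if h ≤ (p.1 : ℕ) ∧ h ≤ (p.2 : ℕ) then a else 1) with hrad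
  have hrad0 : ∀ p, 0 < rad p := by
    intro p
    rw [hrad]
    have := hbase0 p
    dsimp only
    split_ifs <;> positivity
  -- The pivot lies in a disc around `2 * a` which avoids `0`, so that all quotients by it are bounded.
  set ctr : Fin nr × Fin n → ℂ := fun p =>
    if (p.1 : ℕ) < h then V p else if p = (r₀, c₀) then 2 * a else 0 with hctr
  set box : Set (Fin nr × Fin n → ℂ) := Set.univ.pi fun p => Metric.closedBall (ctr p) (rad p) with hbox
  set S := (T₂ ∘ T₁) ⁻¹' box with hS
  have hmem : ∀ Y ∈ S, (∀ p : Fin nr × Fin n, (p.1 : ℕ) < h → ‖Y p - V p‖ ≤ τ) ∧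
      (∀ p : Fin nr × Fin n, h ≤ (p.1 : ℕ) → (p.2 : ℕ) < h → ‖Y p‖ ≤ 1) ∧
      ‖T₁ Y (r₀, c₀) - 2 * a‖ ≤ a ∧
      (∀ p : Fin nr × Fin n, h ≤ (p.1 : ℕ) → h ≤ (p.2 : ℕ) → p ≠ (r₀, c₀) →
        ¬ (h < (p.1 : ℕ) ∧ h < (p.2 : ℕ)) → ‖T₁ Y p‖ ≤ a) ∧
      (∀ p : Fin nr × Fin n, h < (p.1 : ℕ) → h < (p.2 : ℕ) →
        ‖T₁ Y p + -(T₁ Y (p.1, c₀) * T₁ Y (r₀, p.2) / T₁ Y (r₀, c₀))‖ ≤ b) := by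
    intro Y hY
    have hY' : ∀ p, ‖T₂ (T₁ Y) p - ctr p‖ ≤ rad p := by
      intro p
      rw [← dist_eq_norm]
      exact (Set.mem_univ_pi.1 hY) p
    refine ⟨fun p hp => ?_, fun p hp1 hp2 => ?_, ?_, fun p hp1 hp2 hne hnot => ?_, fun p hp1 hp2 => ?_⟩
    · have h1 := hY' p
      have h2 : ¬ (h < (p.1 : ℕ) ∧ h < (p.2 : ℕ)) := by omega
      have h3 : ¬ (h ≤ (p.1 : ℕ) ∧ h ≤ (p.2 : ℕ)) := by omega
      simpa [hT₂, hT₁, hctr, hrad, hbase, h2, h3, hp] using h1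
    · have h1 := hY' p
      have h2 : ¬ (h < (p.1 : ℕ) ∧ h < (p.2 : ℕ)) := by omega
      have h3 : ¬ (h ≤ (p.1 : ℕ) ∧ h ≤ (p.2 : ℕ)) := by omega
      have h4 : p ≠ (r₀, c₀) := by rintro rfl; exact lt_irrefl _ hp2
      simpa only [hT₂, hT₁, hctr, hrad, hbase, h2, h3, h4, not_lt.2 hp1, if_false, sub_zero, one_mul]
        using h1
    · have h1 := hY' (r₀, c₀)
      have h2 : ¬ (h < ((r₀ : Fin nr) : ℕ) ∧ h < ((c₀ : Fin n) : ℕ)) := fun hcon => lt_irrefl _ hcon.1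
      have h3 : h ≤ ((r₀ : Fin nr) : ℕ) ∧ h ≤ ((c₀ : Fin n) : ℕ) := ⟨le_rfl, le_rfl⟩
      have h4 : ¬ ((r₀ : Fin nr) : ℕ) < h := lt_irrefl _
      simpa only [hT₂, hctr, hrad, hbase, h2, h3, h4, if_false, if_true, and_self, one_mul] using h1
    · have h1 := hY' p
      simpa only [hT₂, hctr, hrad, hbase, hnot, hp1, hp2, not_lt.2 hp1, hne, if_false, if_true,
        and_self, one_mul, sub_zero] using h1
    · have h1 := hY' p
      have h4 : p ≠ (r₀, c₀) := by rintro rfl; exact lt_irrefl _ hp1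
      simpa only [hT₂, hctr, hrad, hbase, hp1, hp2, not_lt.2 hp1.le, h4, if_false, if_true,
        and_self, one_mul, sub_zero] using h1
  have hpiv : ∀ Y ∈ S, a ≤ ‖T₁ Y (r₀, c₀)‖ ∧ ‖T₁ Y (r₀, c₀)‖ ≤ 3 * a := by
    intro Y hY
    have h1 := (hmem Y hY).2.2.1
    have h2 : ‖(2 * a : ℂ)‖ = 2 * a := by
      rw [norm_mul, Complex.norm_real, Real.norm_of_nonneg ha.le]; norm_num
    have h3 := norm_sub_norm_le (2 * a : ℂ) (T₁ Y (r₀, c₀))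
    have h4 := norm_sub_norm_le (T₁ Y (r₀, c₀)) (2 * a : ℂ)
    rw [norm_sub_rev] at h3
    rw [h2] at h3 h4
    constructor <;> linarith
  have hrow : ∀ Y ∈ S, ∀ j : Fin n, h ≤ (j : ℕ) → j ≠ c₀ → ‖T₁ Y (r₀, j)‖ ≤ a := by
    intro Y hY j hj hne
    refine (hmem Y hY).2.2.2.1 (r₀, j) le_rfl hj (fun hcon => hne (Prod.ext_iff.1 hcon).2) ?_
    exact fun hcon => lt_irrefl _ hcon.1
  have hcol : ∀ Y ∈ S, ∀ i : Fin nr, h ≤ (i : ℕ) → ‖T₁ Y (i, c₀)‖ ≤ 3 * a := by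
    intro Y hY i hi
    by_cases hne : i = r₀
    · rw [hne]; exact (hpiv Y hY).2
    · have := (hmem Y hY).2.2.2.1 (i, c₀) hi le_rfl (fun hcon => hne (Prod.ext_iff.1 hcon).1)
        fun hcon => lt_irrefl _ hcon.2
      linarith
  set v : (Fin nr × Fin n → ℂ) → Fin n → ℂ := fun Y j =>
    if h ≤ (j : ℕ) then T₁ Y (r₀, j) / T₁ Y (r₀, c₀) else 0 with hv
  have hvle : ∀ Y ∈ S, ∀ j, ‖v Y j‖ ≤ 1 := by
    intro Y hY j
    rw [hv]
    dsimp only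
    split_ifs with hj
    · rw [norm_div]
      refine div_le_one_of_le₀ ?_ (norm_nonneg _)
      by_cases hne : j = c₀
      · rw [hne]
      · exact (hrow Y hY j hj hne).trans (hpiv Y hY).1
    · rw [norm_zero]; exact zero_le_one
  have hD : ∀ Y ∈ S, ∀ (i : Fin nr) (j : Fin n), h ≤ (i : ℕ) → h ≤ (j : ℕ) →
      ‖T₁ Y (i, j) - T₁ Y (i, c₀) * v Y j‖ ≤ b := by
    intro Y hY i j hi hj
    have hne : T₁ Y (r₀, c₀) ≠ 0 := norm_pos_iff.1 (ha.trans_le (hpiv Y hY).1)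
    have hvj : v Y j = T₁ Y (r₀, j) / T₁ Y (r₀, c₀) := by rw [hv]; simp only [hj, if_true]
    rw [hvj]
    rcases hi.eq_or_lt with hi' | hi'
    · have : i = r₀ := Fin.ext hi'.symm
      rw [this, mul_div_cancel₀ _ hne, sub_self, norm_zero]; exact hb.le
    rcases hj.eq_or_lt with hj' | hj'
    · have : j = c₀ := Fin.ext hj'.symm
      rw [this, div_self hne, mul_one, sub_self, norm_zero]; exact hb.le
    have := (hmem Y hY).2.2.2.2 (i, j) hi' hj'
    rwa [← sub_eq_add_neg, mul_div_assoc] at this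
  have hsub : S ⊆ {Y | HasWeakDirections h (n * (n * K)) a b Y} := by
    intro Y hY
    refine hasWeakDirections_of hnr hK0 hb.le (hinv Y (hmem Y hY).1)
      (u := fun i => T₁ Y (i, c₀)) (v := v Y) (hcol Y hY) (hvle Y hY) ha.le fun i j hi hj => ?_
    have := hD Y hY i j hi hj
    simpa only [hT₁, hi, hj, and_self, if_true] using this
  have hbdd : ∀ Y ∈ S, ∀ p, ‖Y p‖ ≤ B := by
    intro Y hY p
    have hVle : ‖V p‖ ≤ ∑ p, ‖V p‖ :=
      Finset.single_le_sum (f := fun p => ‖V p‖) (fun _ _ => norm_nonneg _) (Finset.mem_univ p)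
    have hV0 := norm_nonneg (V p)
    have hnK : 0 ≤ n * K := by positivity
    obtain ⟨h1, h2, -⟩ := hmem Y hY
    by_cases hp1 : (p.1 : ℕ) < h
    · have h3 := h1 p hp1
      have h4 := norm_sub_norm_le (Y p) (V p)
      rw [hB]; linarith
    by_cases hp2 : (p.2 : ℕ) < h
    · have h3 := h2 p (not_lt.1 hp1) hp2
      rw [hB]; linarith
    have hp1 := not_lt.1 hp1
    have hp2 := not_lt.1 hp2
    have h3 := hD Y hY p.1 p.2 hp1 hp2
    have h4 : ‖T₁ Y (p.1, c₀) * v Y p.2‖ ≤ 3 := by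
      rw [norm_mul]
      have h5 := hcol Y hY p.1 hp1
      have h6 := hvle Y hY p.2
      have h7 := mul_le_of_le_one_right (norm_nonneg (T₁ Y (p.1, c₀))) h6
      linarith
    have h5 : ‖weakPart hnr h Y p‖ ≤ n * K := by
      rw [weakPart]
      refine (norm_sum_le _ _).trans ((Finset.sum_le_card_nsmul _ _ K fun m _ => ?_).trans
        (le_of_eq ?_))
      · split_ifs with hm
        · rw [norm_mul]
          exact (mul_le_of_le_one_left (norm_nonneg _) (h2 (p.1, m) hp1 hm)).trans
            ((hinv Y h1 1).2 m p.2)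
        · rw [norm_zero]; exact hK0
      · rw [nsmul_eq_mul, Finset.card_univ, Fintype.card_fin]
    have h6 : Y p = (T₁ Y (p.1, p.2) - T₁ Y (p.1, c₀) * v Y p.2) + T₁ Y (p.1, c₀) * v Y p.2 -
        weakPart hnr h Y p := by
      have : T₁ Y (p.1, p.2) = Y p + weakPart hnr h Y p := by
        simp only [hT₁, hp1, hp2, and_self, if_true]
      rw [this]; ring
    have h7 := norm_sub_le ((T₁ Y (p.1, p.2) - T₁ Y (p.1, c₀) * v Y p.2) + T₁ Y (p.1, c₀) * v Y p.2)
      (weakPart hnr h Y p)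
    have h8 := norm_add_le (T₁ Y (p.1, p.2) - T₁ Y (p.1, c₀) * v Y p.2) (T₁ Y (p.1, c₀) * v Y p.2)
    rw [← h6] at h7
    rw [hB]
    linarith
  refine le_trans (le_of_eq ?_) ((hlow S hbdd).trans (measure_mono hsub))
  rw [hS, (hm₂.comp hm₁).measure_preimage
    (MeasurableSet.univ_pi fun p => measurableSet_closedBall).nullMeasurableSet, volume_pi_pi]
  simp only [Complex.volume_closedBall]
  have hfac : ∀ p, ENNReal.ofReal (rad p) ^ 2 * (NNReal.pi : ℝ≥0∞) =
      ENNReal.ofReal (Real.pi * rad p ^ 2) := by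
    intro p
    rw [← ENNReal.ofReal_pow (hrad0 p).le, ← NNReal.coe_real_pi, mul_comm,
      ENNReal.ofReal_mul (NNReal.coe_nonneg _), ENNReal.ofReal_coe_nnreal]
  simp only [hfac]
  rw [← ENNReal.ofReal_prod_of_nonneg fun p _ => by have := hrad0 p; positivity]
  conv_rhs => rw [← ENNReal.ofReal_toReal hc₁t]
  rw [← ENNReal.ofReal_mul hc₁r.le, mul_assoc]
  congr 2
  have hsq : ∀ p, Real.pi * rad p ^ 2 = (Real.pi * base p ^ 2) *
      (if h < (p.1 : ℕ) ∧ h < (p.2 : ℕ) then b ^ 2 else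
        if h ≤ (p.1 : ℕ) ∧ h ≤ (p.2 : ℕ) then a ^ 2 else 1) := by
    intro p
    rw [hrad]
    dsimp only
    split_ifs <;> ring
  rw [Finset.prod_congr rfl fun p _ => hsq p, Finset.prod_mul_distrib
    (f := fun p => Real.pi * base p ^ 2)]
  congr 1
  have hcard2 : (Finset.univ.filter fun p : Fin nr × Fin n => h < (p.1 : ℕ) ∧ h < (p.2 : ℕ)).card =
      (nr - h - 1) * (n - h - 1) := by
    have : (Finset.univ.filter fun p : Fin nr × Fin n => h < (p.1 : ℕ) ∧ h < (p.2 : ℕ)) =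
        Finset.Ioi r₀ ×ˢ Finset.Ioi c₀ := by
      ext p
      simp [Fin.lt_def, hr₀, hc₀]
    rw [this, Finset.card_product, Fin.card_Ioi, Fin.card_Ioi]
    congr 1 <;> simp [hr₀, hc₀] <;> omega
  have hcard1 : (Finset.univ.filter fun p : Fin nr × Fin n => h ≤ (p.1 : ℕ) ∧ h ≤ (p.2 : ℕ)).card =
      (nr - h) * (n - h) := by
    have : (Finset.univ.filter fun p : Fin nr × Fin n => h ≤ (p.1 : ℕ) ∧ h ≤ (p.2 : ℕ)) =
        Finset.Ici r₀ ×ˢ Finset.Ici c₀ := by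
      ext p
      simp [Fin.le_def, hr₀, hc₀]
    rw [this, Finset.card_product, Fin.card_Ici, Fin.card_Ici]
  rw [Finset.prod_ite, Finset.prod_const, hcard2, mul_comm]
  congr 1
  rw [Finset.prod_ite, Finset.prod_const, Finset.prod_const_one, mul_one]
  congr 1
  have hsd : (Finset.filter (fun p : Fin nr × Fin n => h ≤ (p.1 : ℕ) ∧ h ≤ (p.2 : ℕ))
      (Finset.univ.filter fun p : Fin nr × Fin n => ¬ (h < (p.1 : ℕ) ∧ h < (p.2 : ℕ)))) =
      (Finset.univ.filter fun p : Fin nr × Fin n => h ≤ (p.1 : ℕ) ∧ h ≤ (p.2 : ℕ)) \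
      (Finset.univ.filter fun p : Fin nr × Fin n => h < (p.1 : ℕ) ∧ h < (p.2 : ℕ)) := by
    ext p
    simp only [Finset.mem_filter, Finset.mem_univ, true_and, Finset.mem_sdiff]
    tauto
  rw [hsd, Finset.card_sdiff_of_subset, hcard1, hcard2]
  · obtain ⟨x, hx⟩ : ∃ x, nr - h = x + 1 := ⟨nr - h - 1, by omega⟩
    obtain ⟨y, hy⟩ : ∃ y, n - h = y + 1 := ⟨n - h - 1, by omega⟩
    rw [hx, hy]
    have : (x + 1) * (y + 1) = x * y + (x + y + 1) := by ring
    simp only [Nat.add_sub_cancel]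
    omega
  · intro p hp
    simp only [Finset.mem_filter, Finset.mem_univ, true_and] at hp ⊢
    omega

/-! ### The complexity over channels with weak directions -/

section Extend

variable {n nr : ℕ} {C : Fin n → Matrix (Fin n) (Fin n) ℂ} {e : Fin (n * n) ≃ Fin n × Fin n}

/-- The thread whose symbols occupy the `i`-th block of `n` positions. -/
def blockThread (e : Fin (n * n) ≃ Fin n × Fin n) (i : Fin n) : Fin n :=
  (e ⟨(i : ℕ) * n, Nat.mul_lt_mul_of_pos_right i.2 (Nat.zero_lt_of_lt i.2)⟩).1

theorem thread_eq_blockThread (he : IsThreadwiseGrouping e) (q : Fin (n * n)) {i : Fin n}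
    (hi : (q : ℕ) / n = i) : (e q).1 = blockThread e i := by
  have hn : 0 < n := Nat.zero_lt_of_lt i.2
  refine he _ _ ?_
  rw [hi]
  exact (Nat.mul_div_cancel _ hn).symm

theorem blockThread_bijective (he : IsThreadwiseGrouping e) :
    Function.Bijective (blockThread e) := by
  rw [← Finite.surjective_iff_bijective]
  intro l
  set q := e.symm (l, l) with hq
  have hlt : (q : ℕ) / n < n := Nat.div_lt_of_lt_mul q.2
  exact ⟨⟨(q : ℕ) / n, hlt⟩, by rw [← thread_eq_blockThread he q rfl, hq, Equiv.apply_symm_apply]⟩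

/-- Over a channel with weak directions, the symbols in the last `n - h` blocks can be completed by
complex numbers in the first `h` blocks so that each received column is a small multiple of one
form in these symbols, up to a smaller error. -/
theorem exists_completion (hn : 1 ≤ n) (hC : ∀ l, IsUnit (C l).det)
    (he : IsThreadwiseGrouping e) {h : ℕ} {K a b : ℝ} {H : Fin nr → Fin n → ℂ}
    (hH : HasWeakDirections h K a b fun p : Fin nr × Fin n => H p.1 p.2) :
    ∃ F : (Fin (n * n) → ℂ) →ₗ[ℂ] (Fin n → ℂ), ∀ (x₀ : Fin (n * n) → ℂ) (M : ℝ),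
      (∀ p, ‖(orderedThreadedGenerator C e *ᵥ x₀) p‖ ≤ M) → (∀ c, ‖F x₀ c‖ ≤ K * M) ∧
      ∃ x : Fin (n * n) → ℂ, (∀ q : Fin (n * n), h * n ≤ (q : ℕ) → x q = x₀ q) ∧
        ∀ c i, ‖∑ j, H i j * (orderedThreadedGenerator C e *ᵥ x) (c, j)‖ ≤
          3 * a * ‖F x₀ c‖ + K * b * M := by
  have : NeZero n := ⟨by omega⟩
  set G := orderedThreadedGenerator C e with hG
  set lam : Equiv.Perm (Fin n) := Equiv.ofBijective _ (blockThread_bijective he) with hlam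
  have hlam' : ∀ i, lam i = blockThread e i := fun i => rfl
  -- In column `c`, thread `l` is sent by antenna `c + l`.
  set σ : Fin n → Equiv.Perm (Fin n) := fun c => lam.trans (Equiv.addLeft c) with hσ
  have hσ' : ∀ c i, σ c i = c + lam i := fun c i => rfl
  choose L l hLl using fun c => hH (σ c)
  set β : Fin n → (Fin (n * n) → ℂ) →ₗ[ℂ] (Fin n → ℂ) := fun c =>
    (LinearMap.funLeft ℂ ℂ fun i => (c, σ c i)).comp G.mulVecLin with hβ
  have hβ' : ∀ c x i, β c x i = (G *ᵥ x) (c, σ c i) := fun c x i => rfl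
  refine ⟨LinearMap.pi fun c => (l c).comp (β c), fun x₀ M hM => ?_⟩
  have hb : ∀ c i, ‖β c x₀ i‖ ≤ M := fun c i => hM _
  refine ⟨fun c => (hLl c _ _ (hb c)).2.2.1, ?_⟩
  have hsurj : Function.Surjective G.mulVecLin :=
    (LinearMap.injective_iff_surjective_of_finrank_eq_finrank (by simp)).1
      (generator_mulVec_injective hn hC)
  obtain ⟨x, hx⟩ := hsurj fun p => L p.1 (β p.1 x₀) p.2
  have hx' : ∀ c j, (G *ᵥ x) (c, j) = L c (β c x₀) j := fun c j => congrFun hx (c, j)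
  refine ⟨x, fun q hq => ?_, fun c i => ?_⟩
  · have hi : (q : ℕ) / n < n := Nat.div_lt_of_lt_mul q.2
    set i : Fin n := ⟨(q : ℕ) / n, hi⟩ with hi_def
    have hhi : h ≤ (i : ℕ) := (Nat.le_div_iff_mul_le hn).2 hq
    have hq1 : (e q).1 = lam i := thread_eq_blockThread he q rfl
    have hthread : ∀ j, (C (lam i) *ᵥ fun m => x (e.symm (lam i, m))) j =
        (C (lam i) *ᵥ fun m => x₀ (e.symm (lam i, m))) j := by
      intro j
      have hj : σ (j - lam i) i = j := by rw [hσ', sub_add_cancel]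
      rw [← orderedThreadedGenerator_mulVec hn C e x j (lam i),
        ← orderedThreadedGenerator_mulVec hn C e x₀ j (lam i), ← hG, hx']
      have h1 := (hLl (j - lam i) _ _ (hb (j - lam i))).1 i hhi
      rw [hβ', hj] at h1
      exact h1
    have h2 : (fun m => x (e.symm (lam i, m))) = fun m => x₀ (e.symm (lam i, m)) :=
      Matrix.mulVec_injective_iff_isUnit.2 ((Matrix.isUnit_iff_isUnit_det _).2 (hC _))
        (funext hthread)
    have h3 := congrFun h2 (e q).2
    rwa [← hq1, Prod.mk.eta, Equiv.symm_apply_apply] at h3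
  · simp only [hx']
    exact (hLl c _ _ (hb c)).2.2.2 i

end Extend

section Append

variable {κ k : ℕ}

/-- The vector with first components `u` and last components `d`. -/
def prependTo (hk : k ≤ κ) (u : Fin (κ - k) → ℂ) (d : Fin k → ℂ) : Fin κ → ℂ := fun q =>
  if h : (q : ℕ) < κ - k then u ⟨q, h⟩ else d ⟨q - (κ - k), by omega⟩

theorem prependTo_lastIdx (hk : k ≤ κ) (u : Fin (κ - k) → ℂ) (d : Fin k → ℂ) :
    prependTo hk u d ∘ lastIdx hk = d := by
  funext i
  have h : ¬ κ - k + (i : ℕ) < κ - k := by omega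
  rw [Function.comp_apply, lastIdx, prependTo, dif_neg h]
  have hi : (⟨κ - k + i - (κ - k), by omega⟩ : Fin k) = i := Fin.ext (Nat.add_sub_cancel_left ..)
  exact congrArg d hi

theorem prependTo_injective (hk : k ≤ κ) :
    Function.Injective fun p : (Fin (κ - k) → ℂ) × (Fin k → ℂ) => prependTo hk p.1 p.2 := by
  rintro ⟨u, d⟩ ⟨u', d'⟩ h
  dsimp only at h
  refine Prod.ext (funext fun i => ?_) ?_
  · have := congrFun h ⟨i, by omega⟩
    simpa [prependTo] using this
  · rw [← prependTo_lastIdx hk u d, h, prependTo_lastIdx]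

theorem prependTo_mem_symbolVectors (hk : k ≤ κ) {η : ℝ} {u : Fin (κ - k) → ℂ} {d : Fin k → ℂ}
    (hu : u ∈ symbolVectors (κ - k) η) (hd : d ∈ symbolVectors k η) :
    prependTo hk u d ∈ symbolVectors κ η := by
  rw [symbolVectors, Fintype.mem_piFinset] at hu hd ⊢
  intro q
  rw [prependTo]
  split_ifs
  exacts [hu _, hd _]

theorem uniformOn_finset {α : Type*} [MeasurableSpace α] [MeasurableSingletonClass α]
    (s t : Finset α) (h : t ⊆ s) (hs : s.Nonempty) :
    uniformOn (s : Set α) t = ENNReal.ofReal ((t.card : ℝ) / s.card) := by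
  have h0 : (0 : ℝ) < s.card := by exact_mod_cast hs.card_pos
  rw [uniformOn, cond_apply s.measurableSet, Set.inter_eq_right.2 (by exact_mod_cast h),
    Measure.count_apply_finset, Measure.count_apply_finset, mul_comm, ← div_eq_mul_inv,
    ENNReal.ofReal_div_of_pos h0, ENNReal.ofReal_natCast, ENNReal.ofReal_natCast]

/-- The last components of a uniform symbol vector are uniform. -/
theorem le_uniformOn_lastIdx (hk : k ≤ κ) {η : ℝ} (hη : 0 < η) (D : Finset (Fin k → ℂ))
    (hD : D ⊆ symbolVectors k η) :
    ENNReal.ofReal ((D.card : ℝ) / (symbolVectors k η).card) ≤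
      uniformOn (symbolVectors κ η : Set (Fin κ → ℂ))
        {s | s ∈ symbolVectors κ η ∧ s ∘ lastIdx hk ∈ D} := by
  classical
  have h0 : (0 : ℝ) ≤ ⌊η⌋ := by exact_mod_cast Int.floor_nonneg.2 hη.le
  have h1 : 0 < side η := by rw [side]; linarith
  set A := ((symbolVectors (κ - k) η) ×ˢ D).image fun p => prependTo hk p.1 p.2 with hA
  have hcard : A.card = (symbolVectors (κ - k) η).card * D.card := by
    rw [hA, Finset.card_image_of_injective _ (prependTo_injective hk), Finset.card_product]
  have hAs : A ⊆ symbolVectors κ η := by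
    intro s hs
    obtain ⟨p, hp, rfl⟩ := Finset.mem_image.1 hs
    obtain ⟨hp1, hp2⟩ := Finset.mem_product.1 hp
    exact prependTo_mem_symbolVectors hk hp1 (hD hp2)
  have hsub : (A : Set (Fin κ → ℂ)) ⊆ {s | s ∈ symbolVectors κ η ∧ s ∘ lastIdx hk ∈ D} := by
    intro s hs
    refine ⟨hAs hs, ?_⟩
    obtain ⟨p, hp, rfl⟩ := Finset.mem_image.1 hs
    rw [prependTo_lastIdx]
    exact (Finset.mem_product.1 hp).2
  refine le_trans (le_of_eq ?_) (measure_mono hsub)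
  have hne : (symbolVectors κ η).Nonempty := by
    rw [← Finset.card_pos]
    have h := card_symbolVectors hη κ
    have : (0 : ℝ) < (symbolVectors κ η).card := by rw [h]; positivity
    exact_mod_cast this
  rw [uniformOn_finset _ _ hAs hne, hcard]
  congr 1
  push_cast
  rw [card_symbolVectors hη, card_symbolVectors hη, card_symbolVectors hη]
  have : (side η ^ 2) ^ κ = (side η ^ 2) ^ (κ - k) * (side η ^ 2) ^ k := by
    rw [← pow_add, Nat.sub_add_cancel hk]
  rw [this]
  field_simp

end Append

/-- At least half of the points lie in a fiber which is not much smaller than the average fiber. -/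
theorem card_le_two_mul_card_large_fibers {α τ : Type*} [DecidableEq τ] (D : Finset α) (T : Finset τ)
    (f : α → τ) (hf : ∀ d ∈ D, f d ∈ T) {B : ℝ} (hT : (T.card : ℝ) ≤ B) (hB : 0 < B) :
    (D.card : ℝ) ≤ 2 * ((D.filter fun d =>
      (D.card : ℝ) / (2 * B) ≤ ((D.filter fun d' => f d' = f d).card : ℝ)).card : ℝ) := by
  set t := (D.card : ℝ) / (2 * B) with ht
  have ht0 : 0 ≤ t := by positivity
  have h1 := Finset.card_filter_add_card_filter_not (s := D)
    (fun d => t ≤ ((D.filter fun d' => f d' = f d).card : ℝ))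
  have h2 : ((D.filter fun d => ¬ t ≤ ((D.filter fun d' => f d' = f d).card : ℝ)).card : ℝ) ≤
      T.card * t := by
    rw [Finset.card_eq_sum_card_fiberwise (f := f) (t := T)
      fun d hd => hf d (Finset.mem_filter.1 hd).1]
    push_cast
    refine (Finset.sum_le_card_nsmul _ _ t fun b _ => ?_).trans (le_of_eq (nsmul_eq_mul _ _))
    rcases Finset.eq_empty_or_nonempty (((D.filter fun d =>
      ¬ t ≤ ((D.filter fun d' => f d' = f d).card : ℝ))).filter fun d => f d = b) with h0 | ⟨d, hd⟩
    · rw [h0]; simpa using ht0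
    · obtain ⟨hd1, rfl⟩ := Finset.mem_filter.1 hd
      refine le_trans ?_ (not_le.1 (Finset.mem_filter.1 hd1).2).le
      exact_mod_cast Finset.card_le_card (Finset.filter_subset_filter _ (Finset.filter_subset _ _))
  have h3 : T.card * t ≤ (D.card : ℝ) / 2 := by
    calc T.card * t ≤ B * t := mul_le_mul_of_nonneg_right hT ht0
      _ = _ := by rw [ht]; field_simp
  have h4 : ((D.filter fun d => t ≤ ((D.filter fun d' => f d' = f d).card : ℝ)).card : ℝ) +
      ((D.filter fun d => ¬ t ≤ ((D.filter fun d' => f d' = f d).card : ℝ)).card : ℝ) = D.card := by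
    exact_mod_cast h1
  linarith

theorem card_nodesAt_le_complexity {nr nt T κ : ℕ} (qr : QRProcedure nr T κ)
    (G : Matrix (Fin T × Fin nt) (Fin κ) ℂ) (θ η ξ : ℝ) (ω : Outcome nr nt T κ) {k : ℕ}
    (hk0 : 0 < k) (hk : k ≤ κ) :
    (nodesAt qr G θ η ξ ω k hk).card ≤ complexity qr G θ η ξ ω := by
  obtain ⟨m, rfl⟩ : ∃ m, k = m + 1 := ⟨k - 1, by omega⟩
  exact Finset.single_le_sum (f := fun k : Fin κ => (nodesAt qr G θ η ξ ω ((k : ℕ) + 1) k.isLt).card)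
    (fun _ _ => Nat.zero_le _) (Finset.mem_univ ⟨m, hk⟩)

theorem received_sub_comp_lastIdx {nr nt T κ : ℕ} {qr : QRProcedure nr T κ}
    (hqr : ∀ M, IsThinQR M (qr M).1 (qr M).2) (G : Matrix (Fin T × Fin nt) (Fin κ) ℂ) (θ : ℝ)
    (ω : Outcome nr nt T κ) {k : ℕ} (hk : k ≤ κ) (d : Fin k → ℂ) :
    ((qr (codeChannel G θ ω.1)).1ᴴ *ᵥ received G θ ω) ∘ lastIdx hk -
        (qr (codeChannel G θ ω.1)).2.submatrix (lastIdx hk) (lastIdx hk) *ᵥ d =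
      (qr (codeChannel G θ ω.1)).2.submatrix (lastIdx hk) (lastIdx hk) *ᵥ (ω.2.2 ∘ lastIdx hk - d) +
        ((qr (codeChannel G θ ω.1)).1ᴴ *ᵥ Matrix.vec (Matrix.of ω.2.1)) ∘ lastIdx hk := by
  set M := codeChannel G θ ω.1 with hM
  have h := hqr M
  have h1 : (qr M).1ᴴ *ᵥ (M *ᵥ ω.2.2) = (qr M).2 *ᵥ ω.2.2 := by
    have h2 : (qr M).1ᴴ * M = (qr M).2 := by
      calc (qr M).1ᴴ * M = (qr M).1ᴴ * ((qr M).1 * (qr M).2) := by rw [h.mul_eq]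
        _ = (qr M).2 := by rw [← Matrix.mul_assoc, h.unitary, Matrix.one_mul]
    rw [Matrix.mulVec_mulVec, h2]
  rw [received, ← hM, Matrix.mulVec_add, h1, Matrix.mulVec_sub, ← h.mulVec_comp_lastIdx]
  funext i
  simp only [Pi.add_apply, Pi.sub_apply, Function.comp_apply]
  ring

/-- The transmitted symbols are visited when the noise stays in the search sphere. -/
theorem comp_lastIdx_mem_nodesAt {nr nt T κ : ℕ} {qr : QRProcedure nr T κ}
    (hqr : ∀ M, IsThinQR M (qr M).1 (qr M).2) {G : Matrix (Fin T × Fin nt) (Fin κ) ℂ} {θ η ξ : ℝ}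
    {ω : Outcome nr nt T κ} (hs : ω.2.2 ∈ symbolVectors κ η)
    (hw : normSq (Matrix.vec (Matrix.of ω.2.1)) ≤ ξ ^ 2) {k : ℕ} (hk : k ≤ κ) :
    ω.2.2 ∘ lastIdx hk ∈ nodesAt qr G θ η ξ ω k hk := by
  rw [mem_nodesAt]
  refine ⟨?_, ?_⟩
  · rw [symbolVectors, Fintype.mem_piFinset] at hs ⊢
    exact fun i => hs _
  · rw [received_sub_comp_lastIdx hqr, sub_self, Matrix.mulVec_zero, zero_add]
    exact (normSq_comp_lastIdx_le hk _).trans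
      ((normSq_conjTranspose_mulVec_le (hqr _).unitary _).trans hw)

section Lower

variable {n nr : ℕ} {C : Fin n → Matrix (Fin n) (Fin n) ℂ} {e : Fin (n * n) ≃ Fin n × Fin n}

/-- Over a channel with weak directions and for small noise, at least half of the symbol vectors
lead to a large number of nodes at the layer of the last `n - h` threads: all partial symbol vectors
are visited for which the form in each column lies in the same cell as for the transmitted one. -/
theorem exists_good_symbolVectors (hn : 1 ≤ n) (hC : ∀ l, IsUnit (C l).det)
    (he : IsThreadwiseGrouping e) {KG : ℝ} (hKG0 : 0 < KG)
    (hKG : ∀ (x : Fin (n * n) → ℂ) (M : ℝ), 0 ≤ M → (∀ i, ‖x i‖ ≤ M) →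
      ∀ p, ‖(orderedThreadedGenerator C e *ᵥ x) p‖ ≤ KG * M)
    {qr : QRProcedure nr n (n * n)} (hqr : ∀ M, IsThinQR M (qr M).1 (qr M).2)
    {h : ℕ} (hh : h < n) {K a b : ℝ} (hK : 0 < K) (ha : 0 < a)
    {H : Fin nr → Fin n → ℂ} (hH : HasWeakDirections h K a b fun p : Fin nr × Fin n => H p.1 p.2)
    {θ η ξ φ : ℝ} (hθ : 0 < θ) (hη : 0 < η) (hφ : 0 < φ)
    (hξ : n * nr * (θ * (6 * a * (φ * (K * (KG * (2 * η)))) + K * b * (KG * (4 * η)))) ^ 2 ≤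
      ξ ^ 2 / 4) {B : ℝ} (hB : ((2 * φ⁻¹ + 3) ^ 2) ^ n ≤ B) :
    ENNReal.ofReal (1 / 2) ≤ uniformOn (symbolVectors (n * n) η : Set (Fin (n * n) → ℂ))
      {s | s ∈ symbolVectors (n * n) η ∧ ∀ W : Fin nr → Fin n → ℂ,
        normSq (Matrix.vec (Matrix.of W)) ≤ ξ ^ 2 / 4 →
        (side η ^ 2) ^ (n * n - h * n) / (2 * B) ≤
          (complexity qr (orderedThreadedGenerator C e) θ η ξ (H, W, s) : ℝ)} := by
  classical
  set G := orderedThreadedGenerator C e with hG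
  have hhn : h * n < n * n := Nat.mul_lt_mul_of_pos_right hh hn
  set k := n * n - h * n with hk
  have hkκ : k ≤ n * n := Nat.sub_le _ _
  have hk0 : 0 < k := Nat.sub_pos_of_lt hhn
  have hκk : n * n - k = h * n := by omega
  obtain ⟨F, hF⟩ := exists_completion hn hC he hH
  set β := K * (KG * (2 * η)) with hβ
  have hβ0 : 0 < β := by positivity
  set δ := φ * β with hδ
  have hδ0 : 0 < δ := by positivity
  set D := symbolVectors k η with hD
  set ext : (Fin k → ℂ) → (Fin (n * n) → ℂ) := fun d => prependTo hkκ 0 d with hext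
  have hext_le : ∀ d ∈ D, ∀ q, ‖ext d q‖ ≤ 2 * η := by
    intro d hd q
    rw [hext]
    simp only [prependTo]
    split_ifs
    · rw [Pi.zero_apply, norm_zero]; positivity
    · exact norm_le_of_mem_constellation (Fintype.mem_piFinset.1 hd _)
  have hext_idx : ∀ d i, ext d (lastIdx hkκ i) = d i := fun d i =>
    congrFun (prependTo_lastIdx hkκ 0 d) i
  -- the cells of the forms of all columns
  set f : (Fin k → ℂ) → (Fin n → ℤ × ℤ) := fun d c => cell δ (F (ext d) c) with hf
  have hfT : ∀ d ∈ D, f d ∈ Fintype.piFinset fun _ : Fin n => cells δ β := by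
    intro d hd
    rw [Fintype.mem_piFinset]
    exact fun c => cell_mem_cells hδ0
      ((hF (ext d) (KG * (2 * η)) (hKG _ _ (by positivity) (hext_le d hd))).1 c)
  have hT : ((Fintype.piFinset fun _ : Fin n => cells δ β).card : ℝ) ≤ B := by
    rw [Fintype.card_piFinset_const, Nat.cast_pow]
    refine (pow_le_pow_left₀ (Nat.cast_nonneg _) (card_cells_le hδ0 hβ0.le) n).trans ?_
    rw [hδ, div_mul_cancel_right₀ hβ0.ne']
    exact hB
  have hB0 : 0 < B := lt_of_lt_of_le (by positivity) hB
  set good := D.filter fun d =>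
    (D.card : ℝ) / (2 * B) ≤ ((D.filter fun d' => f d' = f d).card : ℝ) with hgood
  have hhalf := card_le_two_mul_card_large_fibers D _ f hfT hT hB0
  rw [← hgood] at hhalf
  have hDcard := card_symbolVectors hη k
  have hside : 0 < side η := by
    have : (0 : ℝ) ≤ ⌊η⌋ := by exact_mod_cast Int.floor_nonneg.2 hη.le
    rw [side]; linarith
  have hD0 : (0 : ℝ) < D.card := by rw [hD, hDcard]; positivity
  refine le_trans (ENNReal.ofReal_le_ofReal ?_) ((le_uniformOn_lastIdx hkκ hη good
    (Finset.filter_subset _ _)).trans (measure_mono ?_))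
  · rw [div_le_div_iff₀ two_pos hD0]; linarith
  rintro s ⟨hs, hsg⟩
  refine ⟨hs, fun W hW => ?_⟩
  obtain ⟨hsD, hlarge⟩ := Finset.mem_filter.1 hsg
  rw [hD, hDcard] at hlarge
  refine hlarge.trans ?_
  rw [Nat.cast_le]
  refine le_trans (Finset.card_le_card fun d hd => ?_) (card_nodesAt_le_complexity qr G θ η ξ
    (H, W, s) hk0 hkκ)
  obtain ⟨hdD, hfd⟩ := Finset.mem_filter.1 hd
  rw [mem_nodesAt]
  refine ⟨hdD, ?_⟩
  rw [received_sub_comp_lastIdx hqr]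
  dsimp only
  refine (normSq_add_le _ _).trans ?_
  have h1 : normSq (((qr (codeChannel G θ H)).1ᴴ *ᵥ Matrix.vec (Matrix.of W)) ∘ lastIdx hkκ) ≤
      ξ ^ 2 / 4 := (normSq_comp_lastIdx_le hkκ _).trans
      ((normSq_conjTranspose_mulVec_le (hqr _).unitary _).trans hW)
  set x₀ := ext (s ∘ lastIdx hkκ) - ext d with hx₀
  have hx₀le : ∀ p, ‖(G *ᵥ x₀) p‖ ≤ KG * (4 * η) := by
    refine hKG _ _ (by positivity) fun q => ?_
    rw [hx₀, Pi.sub_apply]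
    refine (norm_sub_le _ _).trans ?_
    have h2 := hext_le _ hsD q
    have h3 := hext_le _ hdD q
    linarith
  obtain ⟨-, x, hx1, hx2⟩ := hF x₀ _ hx₀le
  have hxlast : x ∘ lastIdx hkκ = s ∘ lastIdx hkκ - d := by
    funext i
    have h2 : h * n ≤ (lastIdx hkκ i : ℕ) := by
      simp only [lastIdx]; omega
    rw [Function.comp_apply, hx1 _ h2, hx₀, Pi.sub_apply, hext_idx, hext_idx, Pi.sub_apply]
  have h2 : normSq ((qr (codeChannel G θ H)).2.submatrix (lastIdx hkκ) (lastIdx hkκ) *ᵥ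
      (s ∘ lastIdx hkκ - d)) ≤ ξ ^ 2 / 4 := by
    rw [← hxlast]
    refine ((hqr _).normSq_corner_le hkκ x).trans (le_trans ?_ hξ)
    refine (normSq_le_of_norm_le (M := θ * (6 * a * δ + K * b * (KG * (4 * η)))) fun p => ?_).trans
      (le_of_eq ?_)
    · obtain ⟨c, i⟩ := p
      rw [codeChannel_mulVec, norm_mul, Complex.norm_real, Real.norm_of_nonneg hθ.le]
      refine mul_le_mul_of_nonneg_left ((hx2 c i).trans ?_) hθ.le
      have h3 : ‖F x₀ c‖ ≤ 2 * δ := by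
        rw [hx₀, map_sub, Pi.sub_apply]
        exact norm_sub_le_of_cell_eq hδ0 (congrFun hfd c).symm
      have h4 := mul_le_mul_of_nonneg_left h3 (by positivity : 0 ≤ 3 * a)
      linarith
    · simp
  linarith

/-- A lower bound for the measure of a set that is not assumed to be measurable, from its sections. -/
theorem mul_le_prod_of_forall_le {α β : Type*} [MeasurableSpace α] [MeasurableSpace β]
    {μ : Measure α} {ν : Measure β} [SFinite ν] {A : Set (α × β)} {S : Set α} {c : ℝ≥0∞}
    (h : ∀ x ∈ S, c ≤ ν (Prod.mk x ⁻¹' A)) : c * μ S ≤ (μ.prod ν) A := by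
  rw [← measure_toMeasurable A, Measure.prod_apply (measurableSet_toMeasurable _ _)]
  refine le_trans ?_ (mul_meas_ge_le_lintegral
    (measurable_measure_prodMk_left (measurableSet_toMeasurable (μ.prod ν) A)) c)
  gcongr
  intro x hx
  exact (h x hx).trans (measure_mono (Set.preimage_mono (subset_toMeasurable _ _)))

theorem gaussianFlat_eq_gaussianArray (a b : ℕ) (S : Set (Fin a × Fin b → ℂ)) :
    gaussianFlat a b S = gaussianArray a b {H | (fun p : Fin a × Fin b => H p.1 p.2) ∈ S} := by
  have h : MeasurePreserving (MeasurableEquiv.curry (Fin a) (Fin b) ℂ).symm (gaussianArray a b)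
      (gaussianFlat a b) := measurePreserving_uncurry a b
  exact (h.measure_preimage_equiv S).symm

theorem normSq_vec (a b : ℕ) (W : Fin a → Fin b → ℂ) :
    normSq (Matrix.vec (Matrix.of W)) = normSq fun p : Fin a × Fin b => W p.1 p.2 := by
  simp only [normSq, Matrix.vec]
  rw [← Equiv.sum_comp (Equiv.prodComm (Fin a) (Fin b))]
  rfl

theorem eventually_half_le_gaussianArray (a b : ℕ) {z : ℝ} (hz : 0 < z) :
    ∀ᶠ ρ in atTop, ENNReal.ofReal (1 / 2) ≤
      gaussianArray a b {W | normSq (Matrix.vec (Matrix.of W)) ≤ radius z ρ ^ 2 / 4} := by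
  obtain ⟨C, hC, hCt⟩ := exists_gaussianFlat_tail a b (l := 1 / 2) (by norm_num) (by norm_num)
  have hlim : Tendsto (fun ρ => C * Real.exp (-(1 / 2 * (z * Real.log ρ / 4)))) atTop (𝓝 0) := by
    have h1 : Tendsto (fun ρ => 1 / 2 * (z * Real.log ρ / 4)) atTop atTop := by
      have := Real.tendsto_log_atTop.const_mul_atTop (by positivity : 0 < z / 8)
      refine this.congr fun ρ => by ring
    have h2 := (Real.tendsto_exp_neg_atTop_nhds_zero.comp h1).const_mul C
    rw [mul_zero] at h2
    exact h2
  filter_upwards [hlim.eventually_le_const (by norm_num : (0 : ℝ) < 1 / 2), eventually_gt_atTop 1]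
    with ρ hρ hρ1
  have hsq : radius z ρ ^ 2 = z * Real.log ρ :=
    Real.sq_sqrt (mul_nonneg hz.le (Real.log_pos hρ1).le)
  set A := {W : Fin a → Fin b → ℂ | normSq (Matrix.vec (Matrix.of W)) ≤ radius z ρ ^ 2 / 4} with hA
  have h1 : gaussianArray a b Aᶜ ≤ ENNReal.ofReal (1 / 2) := by
    have h2 := (hCt (z * Real.log ρ / 4)).trans (ENNReal.ofReal_le_ofReal hρ)
    rw [gaussianFlat_eq_gaussianArray] at h2
    refine (measure_mono fun W hW => ?_).trans h2
    rw [hA, Set.mem_compl_iff, Set.mem_ofPred_eq, hsq, normSq_vec] at hW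
    exact (not_le.1 hW).le
  have h2 : (1 : ℝ≥0∞) ≤ gaussianArray a b A + gaussianArray a b Aᶜ := by
    rw [← measure_univ (μ := gaussianArray a b)]
    exact measure_univ_le_add_compl A
  have h3 : (1 : ℝ≥0∞) = ENNReal.ofReal (1 / 2) + ENNReal.ofReal (1 / 2) := by
    rw [← ENNReal.ofReal_add (by norm_num) (by norm_num)]; norm_num
  rw [h3] at h2
  exact (ENNReal.add_le_add_iff_right ENNReal.ofReal_ne_top).1
    (h2.trans (add_le_add_right h1 _))

/-- The complexity is large at least with the probability of a channel with weak directions of sizes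
`a = ρ ^ (-(1 - φ) / 2)` and `b = ρ ^ (-1 / 2)`. The cells for the form have relative size
`ρ ^ (-φ / 2)`, such that both errors are of the order of the noise. -/
theorem exists_eventually_le_tailProb_of_weak (hn : 1 ≤ n) (hnr : n ≤ nr)
    (hC : ∀ l, IsUnit (C l).det) (he : IsThreadwiseGrouping e)
    {qr : QRProcedure nr n (n * n)} (hqr : ∀ M, IsThinQR M (qr M).1 (qr M).2)
    {θ η : ℝ → ℝ} {r : ℝ} (hop : OperatesAt (orderedThreadedGenerator C e) θ η r) {z : ℝ} (hz : 0 < z)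
    {h : ℕ} (hh : h < n) {φ : ℝ} (hφ0 : 0 ≤ φ) (hφ1 : φ ≤ 1) {x : ℝ}
    (hx : x < ((n : ℝ) - h) * r - n * φ) :
    ∃ c > 0, ∀ᶠ ρ in atTop, ENNReal.ofReal (c * ρ ^ (-((1 - φ) * (((nr : ℝ) - h) + (n - h) - 1) +
      ((nr : ℝ) - h - 1) * ((n : ℝ) - h - 1)))) ≤
        tailProb qr (orderedThreadedGenerator C e) θ η z x ρ := by
  obtain ⟨K, c₀, hK, hc₀, hweak⟩ := exists_gaussianFlat_hasWeakDirections_ge (nr := nr) hnr hh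
  obtain ⟨KG, hKG0, hKG⟩ := exists_norm_mulVec_le (orderedThreadedGenerator C e)
  obtain ⟨c, K', hc, hK', hpow⟩ := exists_power_bounds hn hC e
  set G := orderedThreadedGenerator C e with hG
  have hn0 : (0 : ℝ) < n := by exact_mod_cast hn
  set g := ((n : ℝ) - h) * r - n * φ - x with hg
  have hg0 : 0 < g := by linarith
  have hlog : ∀ᶠ ρ : ℝ in atTop, n * nr * (256 * (K' * (K ^ 2 * KG ^ 2))) ≤ z * Real.log ρ / 4 :=
    ((Real.tendsto_log_atTop.const_mul_atTop hz).atTop_div_const (by norm_num)).eventually_ge_atTop _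
  refine ⟨c₀ / 4, by positivity, ?_⟩
  filter_upwards [hop.pos, hop.power, hop.eventually_side hn hC
    (by positivity : 0 < g / (4 * n ^ 2)), eventually_gt_atTop 1, hlog,
    eventually_half_le_gaussianArray nr n hz, eventually_le_rpow (2 * 25 ^ n) (half_pos hg0)]
    with ρ hpos hpw hside hρ1 hlog hnoise hconst
  obtain ⟨hθ, hη⟩ := hpos
  have hρ0 : 0 < ρ := by linarith
  obtain ⟨hfl, -, hup⟩ := hpow (θ ρ) (η ρ) ρ hθ hη hρ0 hpw
  have hηs : η ρ ≤ side (η ρ) := (lt_side.resolve_right (by linarith)).le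
  set a := ρ ^ (-((1 - φ) / 2)) with ha
  set b := ρ ^ (-(1 / 2) : ℝ) with hb
  set φ' := ρ ^ (-(φ / 2)) with hφ'
  have ha0 : 0 < a := Real.rpow_pos_of_pos hρ0 _
  have hb0 : 0 < b := Real.rpow_pos_of_pos hρ0 _
  have hφ'0 : 0 < φ' := Real.rpow_pos_of_pos hρ0 _
  have haφ : a * φ' = b := by
    rw [ha, hφ', hb, ← Real.rpow_add hρ0]; congr 1; ring
  have ha1 : a ≤ 1 := Real.rpow_le_one_of_one_le_of_nonpos hρ1.le (by linarith)
  have hb1 : b ≤ 1 := Real.rpow_le_one_of_one_le_of_nonpos hρ1.le (by norm_num)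
  have hb2 : b ^ 2 = ρ⁻¹ := by
    rw [hb, ← Real.rpow_natCast, ← Real.rpow_mul hρ0.le, ← Real.rpow_neg_one]; norm_num
  have ha2 : a ^ 2 = ρ ^ (-(1 - φ)) := by
    rw [ha, ← Real.rpow_natCast, ← Real.rpow_mul hρ0.le]
    congr 1
    push_cast; ring
  have hξsq : radius z ρ ^ 2 = z * Real.log ρ :=
    Real.sq_sqrt (mul_nonneg hz.le (Real.log_pos hρ1).le)
  have hξ : n * nr * (θ ρ * (6 * a * (φ' * (K * (KG * (2 * η ρ)))) +
      K * b * (KG * (4 * η ρ)))) ^ 2 ≤ radius z ρ ^ 2 / 4 := by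
    rw [hξsq]
    refine le_trans (mul_le_mul_of_nonneg_left ?_ (by positivity)) hlog
    have e1 : θ ρ * (6 * a * (φ' * (K * (KG * (2 * η ρ)))) + K * b * (KG * (4 * η ρ))) =
        16 * (θ ρ * η ρ) * (b * (K * KG)) := by rw [← haφ]; ring
    have h1 : (θ ρ * η ρ) ^ 2 ≤ K' * ρ :=
      (pow_le_pow_left₀ (by positivity) (mul_le_mul_of_nonneg_left hηs hθ.le) 2).trans hup
    calc _ = 256 * ((θ ρ * η ρ) ^ 2 * (b ^ 2 * (K ^ 2 * KG ^ 2))) := by rw [e1]; ring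
      _ ≤ 256 * ((K' * ρ) * (b ^ 2 * (K ^ 2 * KG ^ 2))) := by gcongr
      _ = _ := by rw [hb2]; field_simp
  set B := 25 ^ n * ρ ^ (n * φ) with hB
  have hBle : ((2 * φ'⁻¹ + 3) ^ 2) ^ n ≤ B := by
    have h1 : φ'⁻¹ = ρ ^ (φ / 2) := by rw [hφ', Real.rpow_neg hρ0.le, inv_inv]
    have h2 : 1 ≤ ρ ^ (φ / 2) := Real.one_le_rpow hρ1.le (by positivity)
    have h3 : ρ ^ (n * φ) = ((ρ ^ (φ / 2)) ^ 2) ^ n := by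
      rw [← pow_mul, ← Real.rpow_natCast, ← Real.rpow_mul hρ0.le]
      congr 1
      push_cast; ring
    rw [h1, hB, h3, ← mul_pow]
    refine pow_le_pow_left₀ (by positivity) ?_ n
    calc _ ≤ (5 * ρ ^ (φ / 2)) ^ 2 := pow_le_pow_left₀ (by positivity) (by linarith) 2
      _ = _ := by ring
  have hcount : ρ ^ x ≤ (side (η ρ) ^ 2) ^ (n * n - h * n) / (2 * B) := by
    have hB0 : 0 < B := by positivity
    have hs0 : 0 < ρ ^ (r / (2 * n) - g / (4 * n ^ 2)) := Real.rpow_pos_of_pos hρ0 _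
    rw [le_div_iff₀ (by positivity)]
    have hcast : ((n * n - h * n : ℕ) : ℝ) = n * (n - h) := by
      rw [Nat.cast_sub (Nat.mul_le_mul_right n hh.le)]
      push_cast; ring
    have hle : g / 2 * ((n - h) / n) ≤ g / 2 := by
      refine mul_le_of_le_one_right (by positivity) ?_
      rw [div_le_one hn0]
      linarith [(Nat.cast_nonneg h : (0 : ℝ) ≤ h)]
    calc ρ ^ x * (2 * B) = ρ ^ x * ρ ^ (n * φ) * (2 * 25 ^ n) := by rw [hB]; ring
      _ ≤ ρ ^ x * ρ ^ (n * φ) * ρ ^ (g / 2) := by gcongr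
      _ = ρ ^ (((n : ℝ) - h) * r - g / 2) := by
          rw [← Real.rpow_add hρ0, ← Real.rpow_add hρ0]; congr 1; rw [hg]; ring
      _ ≤ ρ ^ (((n : ℝ) - h) * r - g / 2 * ((n - h) / n)) :=
          Real.rpow_le_rpow_of_exponent_le hρ1.le (by linarith)
      _ = ((ρ ^ (r / (2 * n) - g / (4 * n ^ 2))) ^ 2) ^ (n * n - h * n) := by
          rw [← pow_mul, ← Real.rpow_natCast, ← Real.rpow_mul hρ0.le]
          congr 1
          push_cast
          rw [hcast]
          field_simp
          ring
      _ ≤ _ := by gcongr; exact hside.1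
  have := isProbabilityMeasure_uniformOn_symbolVectors hη (n * n)
  have hcond : ∀ H ∈ {H : Fin nr → Fin n → ℂ | (fun p : Fin nr × Fin n => H p.1 p.2) ∈
      {Y | HasWeakDirections h K a b Y}}, ENNReal.ofReal (1 / 4) ≤
      ((gaussianArray nr n).prod (uniformOn (symbolVectors (n * n) (η ρ) : Set (Fin (n * n) → ℂ))))
        (Prod.mk H ⁻¹' complexityTail qr G (θ ρ) (η ρ) (radius z ρ) (ρ ^ x)) := by
    intro H hH
    have h1 := exists_good_symbolVectors hn hC he hKG0 hKG hqr hh hK ha0 hH hθ hη hφ'0 hξ hBle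
    have h2 : ENNReal.ofReal (1 / 4) = ENNReal.ofReal (1 / 2) * ENNReal.ofReal (1 / 2) := by
      rw [← ENNReal.ofReal_mul (by norm_num)]; norm_num
    rw [h2]
    refine (mul_le_mul' hnoise h1).trans ?_
    rw [← Measure.prod_prod]
    refine measure_mono ?_
    rintro ⟨W, s⟩ ⟨hW, -, hs⟩
    exact hcount.trans (hs W hW)
  -- The complexity is bounded below on all channels with weak directions, for at least a quarter of the
  -- noise and symbol vectors.
  refine le_trans ?_ (mul_le_prod_of_forall_le hcond)
  rw [← gaussianFlat_eq_gaussianArray]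
  refine le_trans (le_of_eq ?_) (mul_le_mul_right (hweak a b ha0 ha1 hb0 hb1) _)
  rw [← ENNReal.ofReal_mul (by norm_num)]
  congr 1
  have hρe : ρ ^ (-((1 - φ) * (((nr : ℝ) - h) + (n - h) - 1) +
      ((nr : ℝ) - h - 1) * ((n : ℝ) - h - 1))) =
      (a ^ 2) ^ ((nr - h) + (n - h) - 1) * (b ^ 2) ^ ((nr - h - 1) * (n - h - 1)) := by
    have e1 : (((nr - h) + (n - h) - 1 : ℕ) : ℝ) = ((nr : ℝ) - h) + (n - h) - 1 := by
      rw [Nat.cast_sub (by omega), Nat.cast_add, Nat.cast_sub (by omega), Nat.cast_sub (by omega)]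
      push_cast; ring
    have e2 : (((nr - h - 1) * (n - h - 1) : ℕ) : ℝ) = ((nr : ℝ) - h - 1) * ((n : ℝ) - h - 1) := by
      rw [Nat.cast_mul, Nat.cast_sub (by omega), Nat.cast_sub (by omega), Nat.cast_sub (by omega),
        Nat.cast_sub (by omega)]
      push_cast; ring
    rw [ha2, hb2, ← Real.rpow_neg_one, ← Real.rpow_natCast (ρ ^ (-(1 - φ))),
      ← Real.rpow_natCast (ρ ^ (-1 : ℝ)), ← Real.rpow_mul hρ0.le, ← Real.rpow_mul hρ0.le,
      ← Real.rpow_add hρ0, e1, e2]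
    congr 1
    ring
  rw [hρe]
  ring

theorem dmt_nonneg (hn : 1 ≤ n) (hnr : n ≤ nr) {r : ℝ} (hr : r ∈ Set.Icc (0 : ℝ) n) :
    0 ≤ dmt n nr r := by
  obtain ⟨k, f, hk, hf0, hf1, -, hd, -⟩ := exists_linear_piece hn nr hr
  have h1 : (k : ℝ) + 1 ≤ n := by exact_mod_cast hk
  have h2 : (n : ℝ) ≤ nr := by exact_mod_cast hnr
  have h3 : 0 ≤ ((n : ℝ) - k - 1) * ((nr : ℝ) - k - 1) :=
    mul_nonneg (by linarith) (by linarith)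
  have h4 : f * ((n : ℝ) + nr - 2 * k - 1) ≤ (n : ℝ) + nr - 2 * k - 1 :=
    mul_le_of_le_one_left (by linarith) hf1
  rw [hd]
  nlinarith

theorem uniformOn_symbolVectors_self {η : ℝ} (hη : 0 < η) (κ : ℕ) :
    uniformOn (symbolVectors κ η : Set (Fin κ → ℂ)) (symbolVectors κ η) = 1 := by
  have := isProbabilityMeasure_uniformOn_symbolVectors hη κ
  refine uniformOn_self (Finset.finite_toSet _) ?_
  by_contra h0
  rw [Set.not_nonempty_iff_eq_empty] at h0
  have h1 := measure_univ (μ := uniformOn (symbolVectors κ η : Set (Fin κ → ℂ)))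
  rw [h0, uniformOn_empty_meas] at h1
  simp at h1

/-- With small noise, at least the transmitted vector is visited. -/
theorem eventually_half_le_tailProb_of_neg {qr : QRProcedure nr n (n * n)} (hn : 1 ≤ n)
    (hqr : ∀ M, IsThinQR M (qr M).1 (qr M).2) {G : Matrix (Fin n × Fin n) (Fin (n * n)) ℂ}
    {θ η : ℝ → ℝ} (hη : ∀ᶠ ρ in atTop, 0 < η ρ) {z : ℝ} (hz : 0 < z) {x : ℝ} (hx : x < 0) :
    ∀ᶠ ρ in atTop, ENNReal.ofReal (1 / 2) ≤ tailProb qr G θ η z x ρ := by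
  filter_upwards [hη, eventually_half_le_gaussianArray nr n hz, eventually_gt_atTop 1]
    with ρ hη hnoise hρ1
  have := isProbabilityMeasure_uniformOn_symbolVectors hη (n * n)
  have hone : ρ ^ x ≤ 1 := Real.rpow_le_one_of_one_le_of_nonpos hρ1.le hx.le
  have hs := uniformOn_symbolVectors_self hη (n * n)
  have hcond : ∀ H ∈ (Set.univ : Set (Fin nr → Fin n → ℂ)), ENNReal.ofReal (1 / 2) ≤
      ((gaussianArray nr n).prod (uniformOn (symbolVectors (n * n) (η ρ) : Set (Fin (n * n) → ℂ))))
        (Prod.mk H ⁻¹' complexityTail qr G (θ ρ) (η ρ) (radius z ρ) (ρ ^ x)) := by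
    intro H _
    have h1 := hnoise
    rw [← mul_one (gaussianArray nr n _), ← hs, ← Measure.prod_prod] at h1
    refine h1.trans (measure_mono ?_)
    rintro ⟨W, s⟩ ⟨hW, hs⟩
    refine hone.trans ?_
    have hκ : 0 < n * n := Nat.mul_pos hn hn
    have hmem := comp_lastIdx_mem_nodesAt (ω := (H, W, s)) (G := G) (θ := θ ρ)
      (ξ := radius z ρ) hqr hs ((hW : _ ≤ _).trans (by linarith [sq_nonneg (radius z ρ)])) le_rfl
    have h2 := card_nodesAt_le_complexity qr G (θ ρ) (η ρ) (radius z ρ) (H, W, s) hκ le_rfl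
    exact_mod_cast (Finset.card_pos.2 ⟨_, hmem⟩).trans_le h2
  have h := mul_le_prod_of_forall_le (μ := gaussianArray nr n) hcond
  rwa [measure_univ, mul_one] at h

/-- Below the complexity exponent, a large complexity is at least as likely as an error. -/
theorem eventually_le_tailProb (hn : 1 ≤ n) (hnr : n ≤ nr)
    (hC : ∀ l, IsUnit (C l).det) (he : IsThreadwiseGrouping e)
    {qr : QRProcedure nr n (n * n)} (hqr : ∀ M, IsThinQR M (qr M).1 (qr M).2)
    {θ η : ℝ → ℝ} {r : ℝ} (hr : r ∈ Set.Icc (0 : ℝ) n)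
    (hop : OperatesAt (orderedThreadedGenerator C e) θ η r) {z : ℝ} (hz : 0 < z)
    {x : ℝ} (hx : x < sdExponent n r) {ε : ℝ} (hε : 0 < ε) :
    ∀ᶠ ρ in atTop, ENNReal.ofReal (ρ ^ (-(dmt n nr r + ε))) ≤
      tailProb qr (orderedThreadedGenerator C e) θ η z x ρ := by
  have hd0 := dmt_nonneg hn hnr hr
  have hn0 : (0 : ℝ) < n := by exact_mod_cast hn
  have absorb : ∀ {c D : ℝ}, 0 < c → D ≤ dmt n nr r → ∀ᶠ ρ : ℝ in atTop,
      ENNReal.ofReal (ρ ^ (-(dmt n nr r + ε))) ≤ ENNReal.ofReal (c * ρ ^ (-D)) := by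
    intro c D hc hD
    filter_upwards [eventually_le_rpow c⁻¹ hε, eventually_gt_atTop 1] with ρ h1 hρ1
    have hρ0 : 0 < ρ := by linarith
    refine ENNReal.ofReal_le_ofReal ?_
    have h2 : ρ ^ (-ε) ≤ c := by
      rw [Real.rpow_neg hρ0.le]
      exact inv_le_of_inv_le₀ hc h1
    calc ρ ^ (-(dmt n nr r + ε)) = ρ ^ (-ε) * ρ ^ (-dmt n nr r) := by
          rw [← Real.rpow_add hρ0]; congr 1; ring
      _ ≤ c * ρ ^ (-D) := by
          gcongr
          exact hρ1.le
  obtain ⟨k, f, hk, hf0, hf1, hrk, hd, hsd⟩ := exists_linear_piece hn nr hr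
  have h1 : (k : ℝ) + 1 ≤ n := by exact_mod_cast hk
  have h2 : (n : ℝ) ≤ nr := by exact_mod_cast hnr
  rcases le_or_gt r (n * f) with hrf | hrf
  · rw [max_eq_right (by linarith), add_zero] at hsd
    by_cases hk1 : k + 1 < n
    · obtain ⟨c, hc, hev⟩ := exists_eventually_le_tailProb_of_weak (nr := nr) hn hnr hC he hqr hop hz
        hk1 le_rfl zero_le_one (x := x) (by push_cast; linarith)
      have hD : (1 - 0) * (((nr : ℝ) - (k + 1 : ℕ)) + (n - (k + 1 : ℕ)) - 1) +
          ((nr : ℝ) - (k + 1 : ℕ) - 1) * ((n : ℝ) - (k + 1 : ℕ) - 1) ≤ dmt n nr r := by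
        have h4 : f * ((n : ℝ) + nr - 2 * k - 1) ≤ (n : ℝ) + nr - 2 * k - 1 :=
          mul_le_of_le_one_left (by linarith) hf1
        rw [hd]
        push_cast
        nlinarith
      filter_upwards [hev, absorb hc hD] with ρ h3 h4
      exact h4.trans h3
    · -- here the exponent is zero, and one visited node suffices
      have hkn : (k : ℝ) + 1 = n := by exact_mod_cast (by omega : k + 1 = n)
      have hx0 : x < 0 := by
        rw [hsd, ← hkn] at hx
        simpa using hx
      filter_upwards [eventually_half_le_tailProb_of_neg hn hqr (G := orderedThreadedGenerator C e)
        (θ := θ) (hop.pos.mono fun _ h => h.2) hz hx0, absorb (c := 1 / 2) (by norm_num) hd0]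
        with ρ h3 h4
      rw [neg_zero, Real.rpow_zero, mul_one] at h4
      exact h4.trans h3
  · rw [max_eq_left (by linarith)] at hsd
    obtain ⟨c, hc, hev⟩ := exists_eventually_le_tailProb_of_weak (nr := nr) hn hnr hC he hqr hop hz
      hk hf0 hf1 (x := x) (by linarith)
    have hD : (1 - f) * (((nr : ℝ) - k) + (n - k) - 1) +
        ((nr : ℝ) - k - 1) * ((n : ℝ) - k - 1) ≤ dmt n nr r := by
      rw [hd]
      nlinarith
    filter_upwards [hev, absorb hc hD] with ρ h3 h4
    exact h4.trans h3

end Lower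

/-! ### SNR exponents and the error probability of the sphere decoder -/

section Exponents

theorem snrExponent_anti {p q : ℝ → ℝ≥0∞} {ρ : ℝ} (hρ : 1 < ρ) (h : p ρ ≤ q ρ) :
    snrExponent q ρ ≤ snrExponent p ρ :=
  EReal.div_le_div_right_of_nonneg (EReal.coe_nonneg.2 (Real.log_pos hρ).le)
    (EReal.neg_le_neg_iff.2 (ENNReal.log_monotone h))

theorem snrExponent_rpow (D : ℝ) {ρ : ℝ} (hρ : 1 < ρ) :
    snrExponent (fun ρ => ENNReal.ofReal (ρ ^ (-D))) ρ = D := by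
  have h0 : 0 < ρ := by linarith
  have hlog := Real.log_pos hρ
  rw [snrExponent, ENNReal.log_ofReal_of_pos (Real.rpow_pos_of_pos h0 _), Real.log_rpow h0,
    ← EReal.coe_neg, ← EReal.coe_div]
  congr 1
  field_simp

theorem le_snrExponent {p : ℝ → ℝ≥0∞} {D ρ : ℝ} (hρ : 1 < ρ)
    (h : p ρ ≤ ENNReal.ofReal (ρ ^ (-D))) : (D : EReal) ≤ snrExponent p ρ := by
  rw [← snrExponent_rpow D hρ]
  exact snrExponent_anti hρ h

theorem snrExponent_le {p : ℝ → ℝ≥0∞} {D ρ : ℝ} (hρ : 1 < ρ)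
    (h : ENNReal.ofReal (ρ ^ (-D)) ≤ p ρ) : snrExponent p ρ ≤ D := by
  rw [← snrExponent_rpow D hρ]
  exact snrExponent_anti hρ h

theorem le_rpow_of_lt_snrExponent {p : ℝ → ℝ≥0∞} {D ρ : ℝ} (hρ : 1 < ρ)
    (h : (D : EReal) < snrExponent p ρ) : p ρ ≤ ENNReal.ofReal (ρ ^ (-D)) := by
  by_contra hcon
  exact absurd (snrExponent_le hρ (not_le.1 hcon).le) (not_le.2 h)

theorem absorb_const_rpow (C : ℝ) {D D' : ℝ} (h : D < D') :
    ∀ᶠ ρ : ℝ in atTop, C * ρ ^ (-D') ≤ ρ ^ (-D) := by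
  filter_upwards [eventually_le_rpow C (sub_pos.2 h), eventually_gt_atTop 0] with ρ h1 hρ0
  calc C * ρ ^ (-D') ≤ ρ ^ (D' - D) * ρ ^ (-D') := by gcongr
    _ = ρ ^ (-D) := by rw [← Real.rpow_add hρ0]; congr 1; ring

/-- Additional events whose probability decays faster do not change the SNR exponent. -/
theorem tendsto_snrExponent_of_le_add {p q u : ℝ → ℝ≥0∞} {d C ε : ℝ} (hε : 0 < ε)
    (hp : Tendsto (snrExponent p) atTop (𝓝 (d : EReal))) (hpq : ∀ᶠ ρ in atTop, p ρ ≤ q ρ)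
    (hqu : ∀ᶠ ρ in atTop, q ρ ≤ p ρ + u ρ)
    (hu : ∀ᶠ ρ in atTop, u ρ ≤ ENNReal.ofReal (C * ρ ^ (-(d + ε)))) :
    Tendsto (snrExponent q) atTop (𝓝 (d : EReal)) := by
  rw [tendsto_order] at hp ⊢
  refine ⟨fun a ha => ?_, fun a ha => ?_⟩
  · obtain ⟨D, haD, hDd⟩ := EReal.lt_iff_exists_real_btwn.1 ha
    obtain ⟨D', hDD', hD'd⟩ := EReal.lt_iff_exists_real_btwn.1 hDd
    have hDD' : D < D' := EReal.coe_lt_coe_iff.1 hDD'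
    have hD'd' : D' < d := EReal.coe_lt_coe_iff.1 hD'd
    filter_upwards [hp.1 _ hD'd, hqu, hu, eventually_gt_atTop 1,
      absorb_const_rpow C (by linarith : D' < d + ε), absorb_const_rpow 2 hDD']
      with ρ h1 h2 h3 hρ1 h4 h5
    have hρ0 : 0 < ρ := by linarith
    refine haD.trans_le (le_snrExponent hρ1 (h2.trans ((add_le_add (le_rpow_of_lt_snrExponent hρ1 h1)
      (h3.trans (ENNReal.ofReal_le_ofReal h4))).trans ?_)))
    rw [← ENNReal.ofReal_add (Real.rpow_nonneg hρ0.le _) (Real.rpow_nonneg hρ0.le _)]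
    exact ENNReal.ofReal_le_ofReal (by linarith)
  · filter_upwards [hp.2 a ha, hpq, eventually_gt_atTop 1] with ρ h1 h2 hρ1
    exact (snrExponent_anti hρ1 h2).trans_lt h1

end Exponents

section Sphere

variable {n nr : ℕ} {C : Fin n → Matrix (Fin n) (Fin n) ℂ} {e : Fin (n * n) ≃ Fin n × Fin n}

/-- With squared radius `z log ρ`, `z > d`, an empty search sphere is less likely than `ρ ^ (-d)`:
the squared norm of the noise has exponential tails. -/
theorem exists_eventually_emptySphere_le {T nt κ : ℕ} {qr : QRProcedure nr T κ}
    (hqr : ∀ M, IsThinQR M (qr M).1 (qr M).2) (G : Matrix (Fin T × Fin nt) (Fin κ) ℂ)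
    {θ η : ℝ → ℝ} (hη : ∀ᶠ ρ in atTop, 0 < η ρ) {d z : ℝ} (hd : 0 ≤ d) (hz : d < z) :
    ∃ C : ℝ, ∀ᶠ ρ in atTop, outcomeLaw nr nt T κ (η ρ)
      {ω | nodesAt qr G (θ ρ) (η ρ) (radius z ρ) ω κ le_rfl = ∅} ≤
        ENNReal.ofReal (C * ρ ^ (-(d + (z - d) / 2))) := by
  have hz0 : 0 < z := by linarith
  obtain ⟨C, hC, hCt⟩ := exists_gaussianFlat_tail nr T (l := (d + z) / (2 * z)) (by positivity)
    (by rw [div_lt_one (by positivity)]; linarith)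
  refine ⟨C, ?_⟩
  filter_upwards [hη, eventually_gt_atTop 1] with ρ hη hρ1
  have hρ0 : 0 < ρ := by linarith
  have hsq : radius z ρ ^ 2 = z * Real.log ρ :=
    Real.sq_sqrt (mul_nonneg hz0.le (Real.log_pos hρ1).le)
  have := isProbabilityMeasure_uniformOn_symbolVectors hη κ
  set A : Set (Outcome nr nt T κ) :=
    {ω | z * Real.log ρ ≤ normSq fun p : Fin nr × Fin T => ω.2.1 p.1 p.2} with hA
  set B : Set (Outcome nr nt T κ) := {ω | ω.2.2 ∈ (symbolVectors κ (η ρ) : Set (Fin κ → ℂ))ᶜ} with hB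
  have hsub : {ω : Outcome nr nt T κ |
      nodesAt qr G (θ ρ) (η ρ) (radius z ρ) ω κ le_rfl = ∅} ⊆ A ∪ B := by
    intro ω hω
    by_contra hcon
    simp only [hA, hB, Set.mem_union, Set.mem_ofPred_eq, Set.mem_compl_iff, not_or, not_not,
      not_le, Finset.mem_coe] at hcon
    have hmem := comp_lastIdx_mem_nodesAt (G := G) (θ := θ ρ) (ξ := radius z ρ) hqr hcon.2
      (by rw [normSq_vec, hsq]; exact hcon.1.le) le_rfl
    rw [show nodesAt qr G (θ ρ) (η ρ) (radius z ρ) ω κ le_rfl = ∅ from hω] at hmem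
    exact Finset.notMem_empty _ hmem
  have hAle : outcomeLaw nr nt T κ (η ρ) A ≤ ENNReal.ofReal (C * ρ ^ (-(d + (z - d) / 2))) := by
    refine (measure_preimage_le_of_measurePreserving ((measurePreserving_uncurry nr T).comp
      (measurePreserving_fst.comp measurePreserving_snd))
      {w | z * Real.log ρ ≤ normSq w}).trans ((hCt _).trans (le_of_eq ?_))
    rw [Real.rpow_def_of_pos hρ0]
    congr 3
    field_simp
    ring
  have hBle : outcomeLaw nr nt T κ (η ρ) B = 0 := by
    refine le_antisymm ((measure_preimage_le_of_measurePreserving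
      (measurePreserving_snd.comp measurePreserving_snd) _).trans (le_of_eq ?_)) zero_le
    rw [prob_compl_eq_zero_iff (Finset.measurableSet _)]
    exact uniformOn_symbolVectors_self hη κ
  refine (measure_mono hsub).trans ((measure_union_le _ _).trans ?_)
  rw [hBle, add_zero]
  exact hAle

/-- The infimum is determined by the exponents of the tail probabilities away from `c`, whatever values
the rate function has where the limit does not exist. -/
theorem complexityExponent_eq {T nt κ : ℕ} {qr : QRProcedure nr T κ}
    {G : Matrix (Fin T × Fin nt) (Fin κ) ℂ} {θ η : ℝ → ℝ} {z d c : ℝ} {Ψ : ℝ → EReal}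
    (hΨ : IsRateFunction qr G θ η z Ψ)
    (hup : ∀ x > c, ∃ ε > 0, ∀ᶠ ρ in atTop, tailProb qr G θ η z x ρ ≤
      ENNReal.ofReal (ρ ^ (-(d + ε))))
    (hlow : ∀ x < c, ∀ ε > 0, ∀ᶠ ρ in atTop, ENNReal.ofReal (ρ ^ (-(d + ε))) ≤
      tailProb qr G θ η z x ρ) : complexityExponent Ψ d = c := by
  rw [complexityExponent]
  refine le_antisymm (le_of_forall_gt_imp_ge_of_dense fun a ha => ?_) (le_sInf ?_)
  · obtain ⟨x, hcx, hxa⟩ := EReal.lt_iff_exists_real_btwn.1 ha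
    obtain ⟨ε, hε, hev⟩ := hup x (EReal.coe_lt_coe_iff.1 hcx)
    have h1 : ((d + ε : ℝ) : EReal) ≤ liminf (snrExponent (tailProb qr G θ η z x)) atTop := by
      refine le_liminf_of_le (by isBoundedDefault) ?_
      filter_upwards [hev, eventually_gt_atTop 1] with ρ h hρ using le_snrExponent hρ h
    have h2 : (d : EReal) < Ψ x :=
      (EReal.coe_lt_coe_iff.2 (by linarith)).trans_le (h1.trans (hΨ x).1)
    exact (sInf_le (Set.mem_image_of_mem (fun x : ℝ => (x : EReal))
      (show x ∈ {x : ℝ | (d : EReal) < Ψ x} from h2))).trans hxa.le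
  · rintro _ ⟨x, hx, rfl⟩
    by_contra hcon
    have hxc : x < c := EReal.coe_lt_coe_iff.1 (not_le.1 hcon)
    obtain ⟨D, hdD, hD⟩ := EReal.lt_iff_exists_real_btwn.1 (show (d : EReal) < Ψ x from hx)
    have hdD' : d < D := EReal.coe_lt_coe_iff.1 hdD
    have h1 : limsup (snrExponent (tailProb qr G θ η z x)) atTop ≤ (D : EReal) := by
      refine limsup_le_of_le (by isBoundedDefault) ?_
      filter_upwards [hlow x hxc (D - d) (by linarith), eventually_gt_atTop 1] with ρ h hρ
      refine snrExponent_le hρ ?_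
      rwa [add_sub_cancel] at h
    exact absurd ((hΨ x).2.trans h1) (not_le.2 hD)

theorem sdAchieves_of_isDMTOptimalAt (hn : 1 ≤ n) (hnr : n ≤ nr) (hC : ∀ l, IsUnit (C l).det)
    {qr : QRProcedure nr n (n * n)} (hqr : ∀ M, IsThinQR M (qr M).1 (qr M).2)
    {θ η : ℝ → ℝ} {r : ℝ} (hr : r ∈ Set.Icc (0 : ℝ) n)
    (hopt : IsDMTOptimalAt nr (orderedThreadedGenerator C e) θ η r) {z : ℝ}
    (hz : dmt n nr r < z) :
    SDAchieves qr (orderedThreadedGenerator C e) θ η z (sdExponent n r) (dmt n nr r) := by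
  obtain ⟨K, hK⟩ := exists_eventually_emptySphere_le hqr (orderedThreadedGenerator C e)
    (θ := θ) (hopt.operates.pos.mono fun _ h => h.2) (dmt_nonneg hn hnr hr) hz
  have hsd := tendsto_snrExponent_of_le_add (by linarith : 0 < (z - dmt n nr r) / 2) hopt.diversity
    (q := fun ρ => outcomeLaw nr n n (n * n) (η ρ)
      (sdError qr (orderedThreadedGenerator C e) (θ ρ) (η ρ) (radius z ρ)))
    (Eventually.of_forall fun ρ => measure_mono Set.subset_union_left)
    (Eventually.of_forall fun ρ => measure_union_le _ _) hK
  refine ⟨hsd, fun x hx => ?_⟩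
  obtain ⟨ε, hε, hev⟩ := exists_eventually_tailProb_le (nr := nr) hn hnr hC hqr hr hopt.operates z
    (EReal.coe_lt_coe_iff.1 hx)
  exact tendsto_snrExponent_of_le_add (C := 1) hε hsd
    (Eventually.of_forall fun ρ => measure_mono Set.subset_union_left)
    (Eventually.of_forall fun ρ => measure_union_le _ _) (by simp only [one_mul]; exact hev)

theorem sdExponent_natCast (n k : ℕ) : sdExponent n k = k * ((n : ℝ) - k) := by
  have h : (n : ℝ) * k - k * ((n : ℝ) - 1) = k := by ring
  rw [sdExponent, Int.floor_natCast, Int.cast_natCast, h, max_eq_left (Nat.cast_nonneg k)]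
  ring

end Sphere

end MIMO

theorem theorem6 {n nr : ℕ} (hn : 1 ≤ n) (hnr : n ≤ nr)
    -- a threaded code with full rank component generators, and a thread-wise symbol ordering
    (C : Fin n → Matrix (Fin n) (Fin n) ℂ) (hC : ∀ l, IsUnit (C l).det)
    (e : Fin (n * n) ≃ Fin n × Fin n) (he : MIMO.IsThreadwiseGrouping e)
    (G : Matrix (Fin n × Fin n) (Fin (n * n)) ℂ) (hG : G = MIMO.orderedThreadedGenerator C e)
    -- power scaling and constellation size as functions of the multiplexing gain and the SNR
    (θ η : ℝ → ℝ → ℝ)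
    -- the sphere decoder: radius `ξ² = z log ρ` with `z > d(r)`, and any QR decomposition
    (z : ℝ → ℝ) (hz : ∀ r ∈ Set.Icc (0 : ℝ) n, MIMO.dmt n nr r < z r)
    (qr : MIMO.QRProcedure nr n (n * n)) (hqr : ∀ M, MIMO.IsThinQR M (qr M).1 (qr M).2)
    -- the complexity rate functions and the complexity exponent
    (Ψ : ℝ → ℝ → EReal)
    (hΨ : ∀ r ∈ Set.Icc (0 : ℝ) n, MIMO.IsRateFunction qr G (θ r) (η r) (z r) (Ψ r))
    (c : ℝ → EReal) (hc : ∀ r, c r = MIMO.complexityExponent (Ψ r) (MIMO.dmt n nr r)) :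
    (∀ r ∈ Set.Icc (0 : ℝ) n, MIMO.IsDMTOptimalAt nr G (θ r) (η r) r →
      c r = ((r * ((n : ℝ) - ⌊r⌋ - 1) + max ((n : ℝ) * ⌊r⌋ - r * ((n : ℝ) - 1)) 0 : ℝ) : EReal) ∧
      MIMO.SDAchieves qr G (θ r) (η r) (z r) (c r) (MIMO.dmt n nr r)) ∧
    (∀ k : ℕ, k ≤ n → MIMO.IsDMTOptimalAt nr G (θ k) (η k) k →
      c k = (((k : ℝ) * ((n : ℝ) - k) : ℝ) : EReal)) ∧
    (2 ≤ n → (∀ r ∈ Set.Icc (0 : ℝ) n, MIMO.IsDMTOptimalAt nr G (θ r) (η r) r) →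
      ¬ MonotoneOn c (Set.Icc 0 (n : ℝ)) ∧ ¬ AntitoneOn c (Set.Icc 0 (n : ℝ))) := by
  subst hG
  have hval : ∀ r ∈ Set.Icc (0 : ℝ) n,
      MIMO.IsDMTOptimalAt nr (MIMO.orderedThreadedGenerator C e) (θ r) (η r) r →
      c r = (MIMO.sdExponent n r : EReal) := by
    intro r hr hopt
    rw [hc]
    have hz0 : 0 < z r := (MIMO.dmt_nonneg hn hnr hr).trans_lt (hz r hr)
    exact MIMO.complexityExponent_eq (hΨ r hr)
      (fun x hx => MIMO.exists_eventually_tailProb_le hn hnr hC hqr hr hopt.operates _ hx)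
      fun x hx ε hε => MIMO.eventually_le_tailProb hn hnr hC he hqr hr hopt.operates hz0 hx hε
  have hint : ∀ k : ℕ, k ≤ n →
      MIMO.IsDMTOptimalAt nr (MIMO.orderedThreadedGenerator C e) (θ k) (η k) k →
      c k = (((k : ℝ) * ((n : ℝ) - k) : ℝ) : EReal) := by
    intro k hk hopt
    rw [hval k ⟨Nat.cast_nonneg k, Nat.cast_le.2 hk⟩ hopt, MIMO.sdExponent_natCast]
  refine ⟨fun r hr hopt => ⟨hval r hr hopt, ?_⟩, hint, fun hn2 hopt => ?_⟩
  · rw [hval r hr hopt]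
    exact MIMO.sdAchieves_of_isDMTOptimalAt hn hnr hC hqr hr hopt (hz r hr)
  · have hn2' : (2 : ℝ) ≤ n := by exact_mod_cast hn2
    have hmem : ∀ k : ℕ, k ≤ n → (k : ℝ) ∈ Set.Icc (0 : ℝ) n :=
      fun k hk => ⟨Nat.cast_nonneg k, Nat.cast_le.2 hk⟩
    have hk : ∀ k : ℕ, k ≤ n → c k = (((k : ℝ) * ((n : ℝ) - k) : ℝ) : EReal) :=
      fun k hk => hint k hk (hopt k (hmem k hk))
    refine ⟨fun hmono => ?_, fun hanti => ?_⟩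
    · have h := hmono (hmem 1 hn) (hmem n le_rfl) (Nat.cast_le.2 hn)
      rw [hk 1 hn, hk n le_rfl, EReal.coe_le_coe_iff] at h
      push_cast at h
      linarith
    · have h := hanti (hmem 0 (Nat.zero_le n)) (hmem 1 hn) (Nat.cast_le.2 zero_le_one)
      rw [hk 1 hn, hk 0 (Nat.zero_le n), EReal.coe_le_coe_iff] at h
      push_cast at h
      linarith
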